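/- **Theorem.** For every integer $q\ge 2$, the search problem End-of-Line is many-one reducible to the search problem $\mathrm{Lonely}_q$, and $\mathrm{PPAD}\subseteq \mathrm{PPA}_q$. *Search problems.* A search problem consists of a set of instances $x\in\{0,1\}^*$ and a relation "$y\in\{0,1\}^*$ is a solution of the instance $x$". It is in $\mathrm{TFNP}$ if the set of instances and the solution relation are decidable in polynomial time, and every instance $x$ has a solution of length at most $p(|x|)$, for some fixed polynomial $p$. A problem $R$ is many-one (Karp) reducible to a problem $S$ if there are polynomial-time computable functions $f,g$ such that for each instance $x$ of $R$, $f(x)$ is an instance of $S$, and for each solution $y$ of $f(x)$, $g(x,f(x),y)$ is a solution of $x$. Circuits are Boolean circuits with gates $\wedge,\vee,\neg$, encoded as bit strings. *End-of-Line.* An instance consists of a circuit $C:\{0,1\}^n\to\{0,1\}^n\times\{0,1\}^n$, $C(v)=(P(v),S(v))$, and a designated vertex $v^*\in\{0,1\}^n$. The circuit encodes the directed graph on $\{0,1\}^n$ with an edge $u\to v$ whenever $u\ne v$, $S(u)=v$ and $P(v)=u$ (so all in- and out-degrees are at most $1$); it is required that $v^*$ has in-degree $0$ and out-degree $1$. A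 solution is a vertex $v$ that is a sink (in-degree $1$, out-degree $0$), or a source (in-degree $0$, out-degree $1$) with $v\neq v^*$. *$\mathrm{Lonely}_q$.* An instance consists of an integer $n\ge1$, a circuit $C$ on $[q]^n$ (each element of $[q]$ is written as a block of $\lceil\log_2 q\rceil$ bits) and a set $V^*\subseteq[q]^n$ of designated vertices, listed explicitly, with $1\le|V^*|\le q-1$. The circuit encodes the $q$-uniform hypergraph (a $q$-dimensional matching) on $[q]^n$ whose hyperedges are the sets $\{v_1,\dots,v_q\}$ of $q$ distinct vertices with $C(v_i)=v_{i+1}$ for $1\le i<q$ and $C(v_q)=v_1$. (A vertex whose output is not the code of an element of $[q]^n$ lies in no hyperedge.) A solution is a vertex $v\in V^*$ of degree $1$ or a vertex $v\notin V^*$ of degree $0$. *Classes.* $\mathrm{PPAD}$ is the class of all problems in $\mathrm{TFNP}$ that are many-one reducible to End-of-Line, and $\mathrm{PPA}_q$ is the class of all problems in $\mathrm{TFNP}$ that are many-one reducible to $\mathrm{Lonely}_q$. -/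

import Mathlib

namespace SearchClasses

/-! ### Search problems, polynomial time, many-one reductions -/

/-- A search problem over the binary alphabet: the set of strings that are (encodings of)
instances, and the relation "`y` is a solution of the instance `x`". A relation on all of
`{0,1}* × {0,1}*` is the case in which every string is an instance. -/
structure SearchProblem where
  IsInstance : List Bool → Prop
  IsSolution : List Bool → List Bool → Prop

/-- `f` is computed in polynomial time by a (multi-stack) Turing machine, with respect to the
given encodings of its arguments and values. -/
def PolyTime {α β A B : Type} (ea : α → List A) (eb : β → List B) (f : α → β) : Prop :=
  Nonempty (Turing.TM2ComputableInPolyTime ea eb f)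

/-- A pair of bit strings, written on the input with a separator `none`. -/
def encPair (p : List Bool × List Bool) : List (Option Bool) :=
  p.1.map some ++ none :: p.2.map some

/-- A triple of bit strings, written on the input with separators `none`. -/
def encTriple (t : List Bool × List Bool × List Bool) : List (Option Bool) :=
  t.1.map some ++ none :: encPair t.2

open Classical in
/-- `FNP`: it can be decided in polynomial time whether a string is an instance, and whether
a pair of strings consists of an instance and one of its solutions. -/
def SearchProblem.InFNP (R : SearchProblem) : Prop :=
  PolyTime id Computability.encodeBool (fun x => decide (R.IsInstance x)) ∧
  PolyTime encPair Computability.encodeBool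
    (fun p => decide (R.IsInstance p.1 ∧ R.IsSolution p.1 p.2))

/-- `TFNP`: the `FNP` problems in which every instance has a solution of polynomial length. -/
def SearchProblem.InTFNP (R : SearchProblem) : Prop :=
  R.InFNP ∧ ∃ p : Polynomial ℕ, ∀ x, R.IsInstance x →
    ∃ y : List Bool, y.length ≤ p.eval x.length ∧ R.IsSolution x y

/-- Many-one (Karp) reducibility of search problems. -/
def SearchProblem.Reducible (R S : SearchProblem) : Prop :=
  ∃ (f : List Bool → List Bool) (g : List Bool × List Bool × List Bool → List Bool),
    PolyTime id id f ∧ PolyTime encTriple id g ∧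
    ∀ x, R.IsInstance x → S.IsInstance (f x) ∧
      ∀ y, S.IsSolution (f x) y → R.IsSolution x (g (x, f x, y))

/-! ### Boolean circuits -/

/-- A gate of a Boolean circuit. The circuit is a straight-line program; the wires computed so
far are listed with the most recent one first, and the arguments of a gate are positions in
that list. -/
inductive Gate where
  | and (i j : ℕ)
  | or (i j : ℕ)
  | not (i : ℕ)

/-- The arguments of the gate lie among the first `k` wires. -/
def Gate.InRange (k : ℕ) : Gate → Prop
  | .and i j => i < k ∧ j < k
  | .or i j => i < k ∧ j < k
  | .not i => i < k

/-- Value of a gate on a list of wire values (the default is never used in a circuit). -/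
def Gate.eval (w : List Bool) : Gate → Bool
  | .and i j => w.getD i false && w.getD j false
  | .or i j => w.getD i false || w.getD j false
  | .not i => !(w.getD i false)

/-- Every gate of the list only refers to one of the `k` initial wires or to an earlier gate. -/
def WellFormed : ℕ → List Gate → Prop
  | _, [] => True
  | k, g :: gs => g.InRange k ∧ WellFormed (k + 1) gs

/-- Evaluate the gates in order, each one putting its value in front of the wire values. -/
def runGates : List Gate → List Bool → List Bool
  | [], w => w
  | g :: gs, w => runGates gs (g.eval w :: w)

theorem length_runGates (gs : List Gate) (w : List Bool) :
    (runGates gs w).length = w.length + gs.length := by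
  induction gs generalizing w with
  | nil => simp [runGates]
  | cons g gs ih => simp [runGates, ih]; omega

/-- A Boolean circuit (`∧`, `∨`, `¬`) with `n` inputs and `m` outputs. The initial wires are the
inputs; the outputs are the `m` most recent wires at the end. -/
structure Circuit (n m : ℕ) where
  gates : List Gate
  wellFormed : WellFormed n gates
  enough : m ≤ n + gates.length

/-- The function `{0,1}ⁿ → {0,1}ᵐ` computed by a circuit. -/
def Circuit.eval {n m : ℕ} (C : Circuit n m) (x : List.Vector Bool n) : List.Vector Bool m :=
  ⟨(runGates C.gates x.toList).take m, by
    rw [List.length_take, length_runGates, List.Vector.toList_length]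
    exact min_eq_left C.enough⟩

/-- A natural number in unary. -/
def unary (k : ℕ) : List Bool := List.replicate k true ++ [false]

/-- A gate as a bit string: a two-bit tag and the arguments in unary. -/
def Gate.code : Gate → List Bool
  | .and i j => true :: true :: (unary i ++ unary j)
  | .or i j => true :: false :: (unary i ++ unary j)
  | .not i => false :: true :: unary i

/-- A circuit as a bit string: its gates in order, followed by an end marker. -/
def Circuit.code {n m : ℕ} (C : Circuit n m) : List Bool :=
  C.gates.flatMap Gate.code ++ [false, false]

/-! ### End-of-Line -/

/-- A circuit mapping each `v ∈ {0,1}ⁿ` to a pair of strings of length `n`, its candidate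
predecessor and its candidate successor, and a vertex. -/
structure EOLData where
  n : ℕ
  circuit : Circuit n (n + n)
  start : List.Vector Bool n

namespace EOLData

/-- The first half of the output of the circuit. -/
def pred (I : EOLData) (v : List.Vector Bool I.n) : List Bool :=
  (I.circuit.eval v).toList.take I.n

/-- The second half of the output of the circuit. -/
def succ (I : EOLData) (v : List.Vector Bool I.n) : List Bool :=
  (I.circuit.eval v).toList.drop I.n

/-- The directed graph on `{0,1}ⁿ`: there is an edge `u → v` if `u ≠ v`, the candidate successor
of `u` is `v` and the candidate predecessor of `v` is `u`. All in- and out-degrees are at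
most `1`. -/
def Edge (I : EOLData) (u v : List.Vector Bool I.n) : Prop :=
  u ≠ v ∧ I.succ u = v.toList ∧ I.pred v = u.toList

noncomputable def inDeg (I : EOLData) (v : List.Vector Bool I.n) : ℕ :=
  Set.ncard {u | I.Edge u v}

noncomputable def outDeg (I : EOLData) (v : List.Vector Bool I.n) : ℕ :=
  Set.ncard {u | I.Edge v u}

/-- The designated vertex is a source. -/
def Valid (I : EOLData) : Prop := I.inDeg I.start = 0 ∧ I.outDeg I.start = 1

/-- A sink, or a source other than the designated one. -/
def IsSol (I : EOLData) (v : List.Vector Bool I.n) : Prop :=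
  (I.inDeg v = 1 ∧ I.outDeg v = 0) ∨ (I.inDeg v = 0 ∧ I.outDeg v = 1 ∧ v ≠ I.start)

def code (I : EOLData) : List Bool :=
  unary I.n ++ I.circuit.code ++ I.start.toList

end EOLData

/-- The search problem End-of-Line. -/
def EndOfLine : SearchProblem where
  IsInstance x := ∃ I : EOLData, I.Valid ∧ x = I.code
  IsSolution x y := ∃ I : EOLData, I.Valid ∧ x = I.code ∧ ∃ v, y = v.toList ∧ I.IsSol v

/-! ### Lonely -/

/-- An element of `[q]` as a block of `⌈log₂ q⌉` bits, least significant bit first. -/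
def block {q : ℕ} (a : Fin q) : List Bool :=
  List.ofFn fun j : Fin (Nat.clog 2 q) => (a : ℕ).testBit j

/-- An element of `[q]ⁿ` as a string of `n ⌈log₂ q⌉` bits. -/
def vertexCode {q n : ℕ} (v : List.Vector (Fin q) n) : List.Vector Bool (n * Nat.clog 2 q) :=
  ⟨v.toList.flatMap block, by
    rw [List.length_flatMap, List.map_congr_left (g := fun _ => Nat.clog 2 q)
      (fun a _ => by simp [block])]
    simp⟩

/-- An instance of `Lonely_q`: a circuit on `[q]ⁿ`, `n ≥ 1`, in the binary encoding above, and
the list of the designated vertices, at least one and at most `q - 1` of them. -/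
structure LonelyData (q : ℕ) where
  n : ℕ
  n_pos : 1 ≤ n
  circuit : Circuit (n * Nat.clog 2 q) (n * Nat.clog 2 q)
  designated : List (List.Vector (Fin q) n)
  nodup : designated.Nodup
  one_le : 1 ≤ designated.length
  le_pred : designated.length ≤ q - 1

namespace LonelyData

variable {q : ℕ}

/-- The circuit maps the vertex `v` to the vertex `w`. (If the output at `v` is not the code of
an element of `[q]ⁿ`, then `v` is not mapped to any vertex.) -/
def Maps (I : LonelyData q) (v w : List.Vector (Fin q) I.n) : Prop :=
  I.circuit.eval (vertexCode v) = vertexCode w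

/-- The hyperedges: `{v₁, …, v_q}` with distinct `vᵢ` such that the circuit maps `vᵢ` to `vᵢ₊₁`
and `v_q` to `v₁`. -/
def edges (I : LonelyData q) : Set (Set (List.Vector (Fin q) I.n)) :=
  {e | ∃ u : Fin q → List.Vector (Fin q) I.n,
    Function.Injective u ∧ (∀ i, I.Maps (u i) (u (finRotate q i))) ∧ e = Set.range u}

noncomputable def deg (I : LonelyData q) (v : List.Vector (Fin q) I.n) : ℕ :=
  Set.ncard {e | e ∈ I.edges ∧ v ∈ e}

/-- A designated vertex that is not isolated, or an isolated vertex that is not designated. -/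
def IsSol (I : LonelyData q) (v : List.Vector (Fin q) I.n) : Prop :=
  (v ∈ I.designated ∧ I.deg v = 1) ∨ (v ∉ I.designated ∧ I.deg v = 0)

def code (I : LonelyData q) : List Bool :=
  unary I.n ++ I.circuit.code ++ I.designated.flatMap fun v => (vertexCode v).toList

end LonelyData

/-- The search problem `Lonely_q`. -/
def Lonely (q : ℕ) : SearchProblem where
  IsInstance x := ∃ I : LonelyData q, x = I.code
  IsSolution x y := ∃ I : LonelyData q, x = I.code ∧ ∃ v, y = (vertexCode v).toList ∧ I.IsSol v

/-! ### The classes -/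

/-- `PPAD`: the total search problems reducible to End-of-Line. -/
def PPAD : Set SearchProblem := {R | R.InTFNP ∧ R.Reducible EndOfLine}

/-- `PPA_q`: the total search problems reducible to `Lonely_q`. -/
def PPA (q : ℕ) : Set SearchProblem := {R | R.InTFNP ∧ R.Reducible (Lonely q)}

end SearchClasses

/-! Write q = k + 2, and let P and S be the candidate predecessor and successor maps of the given
graph. Take q copies (c, v) of every vertex v, with c in Z/q, and turn each edge u → v into the
hyperedge {(0, v), (1, u), ..., (q-1, u)}. Copy 0 of a vertex is consumed by its incoming edge, the
other q-1 copies by its outgoing edge. A source therefore leaves exactly copy 0 unmatched, a sink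
leaves the q-1 other copies, and a vertex with both edges leaves nothing. Isolated vertices, and
words of [q]ⁿ that use digits other than 0 and 1, are matched with their own copies. With (0, v*) as
the only designated vertex, which is indeed unmatched, every solution projects to a sink or to a
source other than v*.

This matching is given by a single map: (c, w) goes to (c+1, w), except that w is replaced by p(w)
when c = 0 and by s(w) when c = q-1, where p and s are P and S made to fix the words that are to be
matched with themselves. Starting at (0, w), q steps lead to (0, s(p(w))), so (0, w) lies in a
hyperedge iff s(p(w)) = w (`IsShift.exists_cycle`, `IsShift.eq_of_cycle`). An unmatched (0, w) then
forces a source and an unmatched (c, w) with c ≠ 0 a sink (`exists_of_follow_succ_pred_ne` and its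
mirror image); `isSol_of_isSol_lonelyData` collects this.

The map has a small circuit (`isShift_lonelyCircuit`). It runs the given circuit at v, P(v) and
S(v), and then handles one digit at a time with gadgets whose size depends on q only; these exist
for every Boolean function of boundedly many bits (`exists_gates_bool`). Arguments of gates are
counted back from the latest wire and all gadgets of one kind have equal size, so each argument is
an affine function of n, of the number of gates and of a loop counter, up to a truncated subtraction
of 1.

Polynomial time is certified by a calculus of programs for multi-stack machines. `Emits` is closed
under constants, concatenation, finite transducers, local variables, counted loops and calls of
given machines, and `Emits.polyTime` turns an emitted function into a machine. Calls are needed only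
for transitivity of reductions (`SearchProblem.Reducible.trans`), which gives the inclusion of the
classes. -/

namespace SearchClasses

open Turing Function

/-! ### Programs on stacks -/

/-- `RunsIn f n c c'`: exactly `n` steps of `f` lead from `c` to `c'`. -/
inductive RunsIn {C : Type*} (f : C → Option C) : ℕ → C → C → Prop where
  | refl (c : C) : RunsIn f 0 c c
  | head {n : ℕ} {c c' c'' : C} : f c = some c' → RunsIn f n c' c'' → RunsIn f (n + 1) c c''

theorem RunsIn.trans {C : Type*} {f : C → Option C} {m n : ℕ} {a b c : C}
    (h : RunsIn f m a b) (h' : RunsIn f n b c) : RunsIn f (m + n) a c := by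
  induction h with
  | refl => simpa using h'
  | head e _ ih => rw [Nat.add_right_comm]; exact .head e (ih h')

theorem RunsIn.single {C : Type*} {f : C → Option C} {a b : C} (h : f a = some b) :
    RunsIn f 1 a b := .head h (.refl b)

/-- The link to the library's notion of a run, which iterates the step function on `Option`. As
`none` is absorbing, an iterate that ends in `some` has all its intermediate steps defined. -/
theorem runsIn_iff_iterate {C : Type*} {f : C → Option C} {n : ℕ} {a b : C} :
    RunsIn f n a b ↔ (flip bind f)^[n] (some a) = some b := by
  have none_iter : ∀ n, (flip bind f)^[n] none = none := fun n => by
    induction n with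
    | zero => rfl
    | succ n ih => rw [iterate_succ_apply]; exact ih
  constructor
  · intro h
    induction h with
    | refl => rfl
    | head e _ ih =>
      rw [iterate_succ_apply]
      change (flip bind f)^[_] (f _) = _
      rw [e]; exact ih
  · intro h
    induction n generalizing a with
    | zero => cases h; exact .refl _
    | succ n ih =>
      rw [iterate_succ_apply] at h
      change (flip bind f)^[n] (f a) = _ at h
      cases e : f a with
      | none => rw [e, none_iter] at h; cases h
      | some a' => rw [e] at h; exact .head e (ih h)

/-- A program acting on stacks with alphabets `Γ`. -/
structure Prog {K : Type} (Γ : K → Type) where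
  Λ : Type
  finΛ : Fintype Λ
  main : Λ
  σ : Type
  finσ : Fintype σ
  init : σ
  m : Λ → TM2.Stmt Γ Λ σ

/-- Started on the stacks `S`, the program halts with the stacks `S'` after at most `t` steps,
and its internal state is again the initial one. -/
def Prog.Exec {K : Type} [DecidableEq K] {Γ : K → Type} (p : Prog Γ) (S S' : ∀ k, List (Γ k))
    (t : ℕ) : Prop :=
  ∃ n ≤ t, RunsIn (TM2.step p.m) n ⟨some p.main, p.init, S⟩ ⟨none, p.init, S'⟩

theorem Prog.Exec.mono {K : Type} [DecidableEq K] {Γ : K → Type} {p : Prog Γ}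
    {S S' : ∀ k, List (Γ k)} {t t' : ℕ} (h : p.Exec S S' t) (ht : t ≤ t') : p.Exec S S' t' :=
  let ⟨n, hn, r⟩ := h
  ⟨n, hn.trans ht, r⟩

/-! ### Transport of programs along maps of stacks, labels and states. -/

section lift

variable {K K' : Type} {Λ Λ' σ σ' ρ : Type} {Γ' : K' → Type}

/-- Transport a statement along a map of stacks, a map of labels and an extension of the internal
state, replacing `halt` by the statement `h`. -/
def liftStmt (κ : K → K') (e : Λ → Λ') (φ : σ × ρ ≃ σ') (h : TM2.Stmt Γ' Λ' σ') :
    TM2.Stmt (fun k => Γ' (κ k)) Λ σ → TM2.Stmt Γ' Λ' σ'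
  | .push k f q => .push (κ k) (fun v => f (φ.symm v).1) (liftStmt κ e φ h q)
  | .peek k f q =>
    .peek (κ k) (fun v o => φ (f (φ.symm v).1 o, (φ.symm v).2)) (liftStmt κ e φ h q)
  | .pop k f q =>
    .pop (κ k) (fun v o => φ (f (φ.symm v).1 o, (φ.symm v).2)) (liftStmt κ e φ h q)
  | .load f q => .load (fun v => φ (f (φ.symm v).1, (φ.symm v).2)) (liftStmt κ e φ h q)
  | .branch f q₁ q₂ =>
    .branch (fun v => f (φ.symm v).1) (liftStmt κ e φ h q₁) (liftStmt κ e φ h q₂)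
  | .goto f => .goto fun v => e (f (φ.symm v).1)
  | .halt => h

variable [DecidableEq K] [DecidableEq K'] {κ : K → K'} (hκ : Injective κ) (e : Λ → Λ')
  (φ : σ × ρ ≃ σ') (h : TM2.Stmt Γ' Λ' σ')

include hκ in
-- Injectivity of `κ` makes an update of one embedded stack invisible to the others. Stacks outside
-- the range of `κ` and the extra state component `r` are never touched, which is what later allows
-- programs to be combined.
theorem stepAux_liftStmt (s : TM2.Stmt (fun k => Γ' (κ k)) Λ σ) (v : σ) (r : ρ)
    (S : ∀ k, List (Γ' k)) :
    ∃ S' : ∀ k, List (Γ' k),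
      (∀ k, S' (κ k) = (TM2.stepAux s v fun k => S (κ k)).stk k) ∧
      (∀ k', (∀ k, κ k ≠ k') → S' k' = S k') ∧
      TM2.stepAux (liftStmt κ e φ h s) (φ (v, r)) S =
        match (TM2.stepAux s v fun k => S (κ k)).l with
        | some l => ⟨some (e l), φ ((TM2.stepAux s v fun k => S (κ k)).var, r), S'⟩
        | none => TM2.stepAux h (φ ((TM2.stepAux s v fun k => S (κ k)).var, r)) S' := by
  induction s generalizing v S with
  | push k f q ih =>
    obtain ⟨S', h1, h2, h3⟩ := ih v (update S (κ k) (f v :: S (κ k)))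
    rw [update_comp_eq_of_injective' S hκ] at h1 h3
    refine ⟨S', h1, fun k' hk' => ?_, ?_⟩
    · rw [h2 k' hk', update_of_ne (hk' k).symm]
    · simpa [liftStmt] using h3
  | peek k f q ih =>
    obtain ⟨S', h1, h2, h3⟩ := ih (f v (S (κ k)).head?) S
    exact ⟨S', h1, h2, by simpa [liftStmt] using h3⟩
  | pop k f q ih =>
    obtain ⟨S', h1, h2, h3⟩ := ih (f v (S (κ k)).head?) (update S (κ k) (S (κ k)).tail)
    rw [update_comp_eq_of_injective' S hκ] at h1 h3
    refine ⟨S', h1, fun k' hk' => ?_, ?_⟩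
    · rw [h2 k' hk', update_of_ne (hk' k).symm]
    · simpa [liftStmt] using h3
  | load f q ih =>
    obtain ⟨S', h1, h2, h3⟩ := ih (f v) S
    exact ⟨S', h1, h2, by simpa [liftStmt] using h3⟩
  | branch f q₁ q₂ ih₁ ih₂ =>
    cases hf : f v with
    | true =>
      obtain ⟨S', h1, h2, h3⟩ := ih₁ v S
      exact ⟨S', by simpa [hf] using h1, h2, by simpa [liftStmt, hf] using h3⟩
    | false =>
      obtain ⟨S', h1, h2, h3⟩ := ih₂ v S
      exact ⟨S', by simpa [hf] using h1, h2, by simpa [liftStmt, hf] using h3⟩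
  | goto f => exact ⟨S, fun _ => rfl, fun _ _ => rfl, by simp [liftStmt]⟩
  | halt => exact ⟨S, fun _ => rfl, fun _ _ => rfl, by simp [liftStmt]⟩

include hκ in
-- The substitute `h` for `halt` is executed inside the step that would have halted, so the number
-- of steps does not change.
theorem RunsIn.liftStmt {M : Λ → TM2.Stmt (fun k => Γ' (κ k)) Λ σ} {M' : Λ' → TM2.Stmt Γ' Λ' σ'}
    (hM : ∀ l, M' (e l) = liftStmt κ e φ h (M l)) (r : ρ) {n : ℕ} {l : Λ} {v v' : σ}
    {S : ∀ k, List (Γ' k)} {S₁ : ∀ k, List (Γ' (κ k))}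
    (H : RunsIn (TM2.step M) n ⟨some l, v, fun k => S (κ k)⟩ ⟨none, v', S₁⟩) :
    ∃ S' : ∀ k, List (Γ' k), (∀ k, S' (κ k) = S₁ k) ∧
      (∀ k', (∀ k, κ k ≠ k') → S' k' = S k') ∧
      RunsIn (TM2.step M') n ⟨some (e l), φ (v, r), S⟩ (TM2.stepAux h (φ (v', r)) S') := by
  induction n generalizing l v S with
  | zero => cases H
  | succ n ih =>
    cases H with
    | @head _ _ c₁ _ h1 H =>
      obtain ⟨S', hS, hS', hstep⟩ := stepAux_liftStmt hκ e φ h (M l) v r S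
      rw [TM2.step.eq_2] at h1
      have h1 := Option.some.inj h1
      rw [h1] at hS hstep
      clear h1
      obtain ⟨l', v₁, S₂⟩ := c₁
      obtain rfl : S₂ = fun k => S' (κ k) := funext fun k => (hS k).symm
      have hs : TM2.step M' ⟨some (e l), φ (v, r), S⟩ =
          some (TM2.stepAux (SearchClasses.liftStmt κ e φ h (M l)) (φ (v, r)) S) := by
        rw [TM2.step.eq_2, hM]
      cases l' with
      | none =>
        cases H with
        | refl => exact ⟨S', hS, hS', .single (by rw [hs, hstep])⟩
        | head h2 _ => simp at h2
      | some l' =>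
        obtain ⟨S'', g1, g2, g3⟩ := ih H
        exact ⟨S'', g1, fun k' hk' => by rw [g2 k' hk', hS' k' hk'],
          .head (by rw [hs, hstep]) g3⟩

end lift

/-! ### Sequencing, loops and embeddings. -/

section combinators

variable {K : Type} {Γ : K → Type}

/-- One program after the other. -/
def Prog.seq (p q : Prog Γ) : Prog Γ where
  Λ := p.Λ ⊕ q.Λ
  finΛ := haveI := p.finΛ; haveI := q.finΛ; inferInstance
  main := .inl p.main
  σ := p.σ × q.σ
  finσ := haveI := p.finσ; haveI := q.finσ; inferInstance
  init := (p.init, q.init)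
  m
    | .inl l => liftStmt id .inl (Equiv.refl _) (.goto fun _ => .inr q.main) (p.m l)
    | .inr l => liftStmt id .inr (Equiv.prodComm _ _) .halt (q.m l)

/-- As long as the stack `k` is nonempty, pop a symbol and run the program. -/
def Prog.loop (k : K) (p : Prog Γ) : Prog Γ where
  Λ := Option p.Λ
  finΛ := haveI := p.finΛ; inferInstance
  main := none
  σ := p.σ × Bool
  finσ := haveI := p.finσ; inferInstance
  init := (p.init, false)
  m
    | none => .pop k (fun v o => (v.1, o.isSome)) <| .branch (fun v => v.2)
        (.load (fun v => (v.1, false)) (.goto fun _ => some p.main)) .halt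
    | some l => liftStmt id some (Equiv.refl _) (.goto fun _ => none) (p.m l)

/-- A stack program as a part of a program with more stacks. -/
def Prog.embed {K' : Type} {Γ' : K' → Type} (κ : K → K') (p : Prog fun k => Γ' (κ k)) :
    Prog Γ' where
  Λ := p.Λ
  finΛ := p.finΛ
  main := p.main
  σ := p.σ
  finσ := p.finσ
  init := p.init
  m l := liftStmt κ id (Equiv.prodUnique _ Unit) .halt (p.m l)

variable [DecidableEq K]

/-- The state of the inactive program rides along as the passive component; it is initial
throughout, because an execution ends in the initial state again. -/
theorem Prog.Exec.seq {p q : Prog Γ} {S S' S'' : ∀ k, List (Γ k)} {t t' : ℕ}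
    (hp : p.Exec S S' t) (hq : q.Exec S' S'' t') : (p.seq q).Exec S S'' (t + t') := by
  obtain ⟨n, hn, hp⟩ := hp
  obtain ⟨n', hn', hq⟩ := hq
  obtain ⟨T, h1, -, h2⟩ := RunsIn.liftStmt (M' := (p.seq q).m) (κ := id) injective_id Sum.inl
    (Equiv.refl _) (.goto fun _ => .inr q.main) (fun _ => rfl) q.init hp
  obtain ⟨T', h1', -, h2'⟩ := RunsIn.liftStmt (M' := (p.seq q).m) (κ := id) injective_id Sum.inr
    (Equiv.prodComm _ _) .halt (fun _ => rfl) p.init hq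
  obtain rfl : T = S' := funext h1
  obtain rfl : T' = S'' := funext h1'
  exact ⟨n + n', add_le_add hn hn', h2.trans h2'⟩

theorem Prog.exec_loop_nil {k : K} {p : Prog Γ} {S : ∀ k, List (Γ k)} (h : S k = []) :
    (p.loop k).Exec S S 1 := by
  refine ⟨1, le_rfl, .single ?_⟩
  have : update S k [] = S := by rw [← h, update_eq_self]
  simp [Prog.loop, h, this]

/-- The body returns to its initial state, so each round starts from the same control state. The
summand 1 pays for the pop. -/
theorem Prog.exec_loop_cons {k : K} {p : Prog Γ} {S S' S'' : ∀ k, List (Γ k)} {a : Γ k}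
    {l : List (Γ k)} {t t' : ℕ} (h : S k = a :: l) (hp : p.Exec (update S k l) S' t)
    (hl : (p.loop k).Exec S' S'' t') : (p.loop k).Exec S S'' (1 + t + t') := by
  obtain ⟨n, hn, hp⟩ := hp
  obtain ⟨n', hn', hl⟩ := hl
  obtain ⟨T, h1, -, h2⟩ := RunsIn.liftStmt (M' := (p.loop k).m) (κ := id) injective_id some
    (Equiv.refl _) (.goto fun _ => none) (fun _ => rfl) false hp
  obtain rfl : T = S' := funext h1
  refine ⟨1 + n + n', by omega, (RunsIn.trans (.single ?_) h2).trans hl⟩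
  simp [Prog.loop, h]

theorem Prog.Exec.embed {K' : Type} [DecidableEq K'] {Γ' : K' → Type} {κ : K → K'}
    (hκ : Injective κ) {p : Prog fun k => Γ' (κ k)} {S : ∀ k, List (Γ' k)}
    {S₁ : ∀ k, List (Γ' (κ k))} {t : ℕ} (hp : p.Exec (fun k => S (κ k)) S₁ t)
    {S' : ∀ k, List (Γ' k)} (h₁ : ∀ k, S' (κ k) = S₁ k)
    (h₂ : ∀ k', (∀ k, κ k ≠ k') → S' k' = S k') : (p.embed κ).Exec S S' t := by
  obtain ⟨n, hn, hp⟩ := hp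
  obtain ⟨T, g1, g2, g3⟩ := RunsIn.liftStmt (M' := (p.embed κ).m) hκ id
    (Equiv.prodUnique _ Unit) .halt (fun _ => rfl) () hp
  obtain rfl : T = S' := by
    funext k'
    by_cases hk : ∃ k, κ k = k'
    · obtain ⟨k, rfl⟩ := hk
      rw [g1, h₁]
    · push Not at hk
      rw [g2 k' hk, h₂ k' hk]
  exact ⟨n, hn, g3⟩

end combinators

/-! ### Sequential transducers -/

section transducer

/-- The output of a transducer (a Mealy machine) started in the state `q`. -/
def transduce {Q B C : Type*} (δ : Q → B → Q) (out : Q → B → List C) : Q → List B → List C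
  | _, [] => []
  | q, b :: l => out q b ++ transduce δ out (δ q b) l

theorem length_transduce_le {Q B C : Type*} (δ : Q → B → Q) (out : Q → B → List C) {n : ℕ}
    (h : ∀ q b, (out q b).length ≤ n) (q : Q) (l : List B) :
    (transduce δ out q l).length ≤ n * l.length := by
  induction l generalizing q with
  | nil => simp [transduce]
  | cons b l ih =>
    have := h q b
    have := ih (δ q b)
    simp only [transduce, List.length_append, List.length_cons]
    linarith

theorem transduce_singleton {Q B C : Type*} (δ : Q → B → Q) (f : B → C) (q : Q) (l : List B) :
    transduce δ (fun _ b => [f b]) q l = l.map f := by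
  induction l generalizing q with
  | nil => rfl
  | cons b l ih => simp [transduce, ih]

theorem transduce_nil {Q B C : Type*} (δ : Q → B → Q) (q : Q) (l : List B) :
    transduce δ (fun _ _ => ([] : List C)) q l = [] := by
  induction l generalizing q with
  | nil => rfl
  | cons b l ih => simp [transduce, ih]

variable {K : Type} {Γ : K → Type} {Λ σ : Type}

/-- Push the first `n` symbols of the list `f v`. -/
def pushList (k : K) (d : Γ k) :
    ℕ → (σ → List (Γ k)) → TM2.Stmt Γ Λ σ → TM2.Stmt Γ Λ σ
  | 0, _, s => s
  | n + 1, f, s => .branch (fun v => (f v).isEmpty) s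
      (.push k (fun v => (f v).headD d) (pushList k d n (fun v => (f v).tail) s))

/-- A whole list is pushed within one machine step. The bound `n` is needed because a statement is a
finite tree, while the list depends on the internal state. -/
theorem stepAux_pushList [DecidableEq K] (k : K) (d : Γ k) (n : ℕ) (f : σ → List (Γ k))
    (s : TM2.Stmt Γ Λ σ) (v : σ) (S : ∀ k, List (Γ k)) (h : (f v).length ≤ n) :
    TM2.stepAux (pushList k d n f s) v S =
      TM2.stepAux s v (update S k ((f v).reverse ++ S k)) := by
  induction n generalizing f S with
  | zero => simp [pushList, List.length_eq_zero_iff.1 (Nat.le_zero.1 h)]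
  | succ n ih =>
    cases hf : f v with
    | nil => simp [pushList, hf]
    | cons a l =>
      rw [hf, List.length_cons] at h
      simp only [pushList, TM2.stepAux, hf, List.isEmpty_cons, cond_false, List.headD_cons]
      rw [ih _ _ (by simp only [hf, List.tail_cons]; omega)]
      simp [hf]

variable {B Q : Type} [Fintype B] [Fintype Q]

/-- Empty the stack `k`, symbol by symbol, while running an automaton with transition function
`δ` and doing the pushes prescribed by `act`. -/
def Prog.drain (k : K) (c : Γ k → B) (q₀ : Q) (δ : Q → B → Q)
    (act : TM2.Stmt Γ Unit (Q × Option B) → TM2.Stmt Γ Unit (Q × Option B)) : Prog Γ where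
  Λ := Unit
  finΛ := inferInstance
  main := ()
  σ := Q × Option B
  finσ := inferInstance
  init := (q₀, none)
  m _ := .pop k (fun v o => (v.1, o.map c)) <| .branch (fun v => v.2.isNone)
    (.load (fun _ => (q₀, none)) .halt)
    (act (.load (fun v => (v.2.elim v.1 (δ v.1), none)) (.goto fun _ => ())))

variable (k : K) (c : Γ k → B) (q₀ : Q) (δ : Q → B → Q)

/-- Empty the stack `k` and push the output of a transducer on the stack `k₁`. -/
def Prog.transducer (k₁ : K) (d : Γ k₁) (out : Q → B → List (Γ k₁)) : Prog Γ :=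
  Prog.drain k c q₀ δ (pushList k₁ d (Finset.univ.sup fun p : Q × B => (out p.1 p.2).length)
    (fun v => v.2.elim [] (out v.1)))

/-- Empty the stack `k` and push its symbols on `k₁` and, translated by `f`, on `k₂`. -/
def Prog.unzip (k₁ k₂ : K) (d₁ : Γ k₁) (d₂ : Γ k₂) (f₁ : B → Γ k₁) (f₂ : B → Γ k₂) : Prog Γ :=
  Prog.drain k c () (fun _ _ => ())
    (fun s => .push k₁ (fun v => v.2.elim d₁ f₁) (.push k₂ (fun v => v.2.elim d₂ f₂) s))

variable [DecidableEq K]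

theorem Prog.exec_transducer {k₁ : K} (hk : k ≠ k₁) (d : Γ k₁) (out : Q → B → List (Γ k₁))
    (S : ∀ k, List (Γ k)) :
    (Prog.transducer k c q₀ δ k₁ d out).Exec S
      (update (update S k []) k₁ ((transduce δ out q₀ ((S k).map c)).reverse ++ S k₁))
      ((S k).length + 1) := by
  refine ⟨_, le_rfl, ?_⟩
  -- The starting state is generalised for the induction, but not the final one: halting reloads
  -- `q₀`.
  suffices ∀ (q : Q), RunsIn (TM2.step (Prog.transducer k c q₀ δ k₁ d out).m) ((S k).length + 1)
      ⟨some (), (q, none), S⟩ ⟨none, (q₀, none), update (update S k []) k₁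
        ((transduce δ out q ((S k).map c)).reverse ++ S k₁)⟩ from this q₀
  generalize hl : S k = l
  induction l generalizing S with
  | nil =>
    intro q
    refine .single ?_
    have h1 : update S k [] = S := by rw [← hl, update_eq_self]
    simp [transducer, Prog.drain, hl, h1, transduce]
  | cons a l ih =>
    intro q
    have := ih (update (update S k l) k₁ ((out q (c a)).reverse ++ S k₁))
      (by rw [update_of_ne hk, update_self]) (δ q (c a))
    rw [update_self] at this
    have key : update (update (update (update S k l) k₁ ((out q (c a)).reverse ++ S k₁)) k []) k₁
        ((transduce δ out (δ q (c a)) (l.map c)).reverse ++ ((out q (c a)).reverse ++ S k₁)) =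
        update (update S k []) k₁ ((transduce δ out q ((a :: l).map c)).reverse ++ S k₁) := by
      rw [update_comm hk.symm, update_idem, update_idem]
      simp [transduce]
    rw [key] at this
    refine .head ?_ this
    have hlen : (out q (c a)).length ≤
        Finset.univ.sup fun p : Q × B => (out p.1 p.2).length :=
      Finset.le_sup (f := fun p : Q × B => (out p.1 p.2).length) (Finset.mem_univ (q, c a))
    simp only [transducer, Prog.drain, TM2.step, TM2.stepAux, hl, List.head?_cons, Option.map_some,
      Option.isNone_some, cond_false, List.tail_cons]
    rw [stepAux_pushList _ _ _ _ _ _ _ (by simpa using hlen)]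
    simp [update_of_ne hk.symm]

theorem Prog.exec_unzip {k₁ k₂ : K} (h₁ : k ≠ k₁) (h₂ : k ≠ k₂) (h₁₂ : k₁ ≠ k₂) (d₁ : Γ k₁)
    (d₂ : Γ k₂) (f₁ : B → Γ k₁) (f₂ : B → Γ k₂) (S : ∀ k, List (Γ k)) :
    (Prog.unzip k c k₁ k₂ d₁ d₂ f₁ f₂).Exec S
      (update (update (update S k []) k₁ (((S k).map (f₁ ∘ c)).reverse ++ S k₁)) k₂
        (((S k).map (f₂ ∘ c)).reverse ++ S k₂))
      ((S k).length + 1) := by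
  refine ⟨_, le_rfl, ?_⟩
  change RunsIn (TM2.step (Prog.unzip k c k₁ k₂ d₁ d₂ f₁ f₂).m) _
    ⟨some (), ((), none), S⟩ ⟨none, ((), none), _⟩
  generalize hl : S k = l
  induction l generalizing S with
  | nil =>
    refine .single ?_
    have h1 : update S k [] = S := by rw [← hl, update_eq_self]
    simp [unzip, Prog.drain, hl, h1]
  | cons a l ih =>
    have := ih (update (update (update S k l) k₁ (f₁ (c a) :: S k₁)) k₂ (f₂ (c a) :: S k₂))
      (by rw [update_of_ne h₂, update_of_ne h₁, update_self])
    have key : update (update (update (update (update (update S k l) k₁ (f₁ (c a) :: S k₁)) k₂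
          (f₂ (c a) :: S k₂)) k []) k₁ (((l.map (f₁ ∘ c)).reverse ++ f₁ (c a) :: S k₁)))
          k₂ ((l.map (f₂ ∘ c)).reverse ++ f₂ (c a) :: S k₂) =
        update (update (update S k []) k₁ (((a :: l).map (f₁ ∘ c)).reverse ++ S k₁)) k₂
          (((a :: l).map (f₂ ∘ c)).reverse ++ S k₂) := by
      rw [update_comm h₂.symm, update_comm h₁.symm, update_comm h₁₂.symm, update_idem,
        update_idem, update_idem]
      simp
    rw [update_self, update_of_ne h₁₂, update_self, key] at this
    refine .head ?_ this
    simp [unzip, Prog.drain, hl, update_of_ne h₁.symm, update_of_ne h₂.symm,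
      update_of_ne h₁₂.symm]

end transducer

end SearchClasses

namespace SearchClasses

open Turing Function

/-! ### Registers -/

section registers

variable {ι : Type} (T : ι → FinTM2) (R : Type)

/-- The symbols of the registers. -/
abbrev Sym := Option Bool

/-- The stacks of a program with registers `R` and the machines `T i` as subroutines. -/
abbrev StackIdx := R ⊕ Σ i, (T i).K

/-- The stack alphabets of a program with registers and subroutines. -/
abbrev Alphabet : StackIdx T R → Type
  | .inl _ => Sym
  | .inr p => (T p.1).Γ p.2

variable {R}

/-- The stacks when the registers are `s` and no subroutine is running. -/
def store (s : R → List Sym) : ∀ k, List (Alphabet T R k)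
  | .inl r => s r
  | .inr _ => []

variable [DecidableEq ι] [DecidableEq R]

theorem update_store (s : R → List Sym) (r : R) (l : List Sym) :
    update (store T s) (.inl r) l = store T (update s r l) := by
  funext k
  rcases k with r' | p
  · by_cases h : r' = r
    · subst h; simp [store]
    · rw [update_of_ne (by simpa using h)]; simp [store, h]
  · rw [update_of_ne (by simp)]; rfl

/-- Execution of a program between two states of the registers. -/
def RExec (p : Prog (Alphabet T R)) (s s' : R → List Sym) (t : ℕ) : Prop :=
  p.Exec (store T s) (store T s') t

variable {T}

theorem RExec.mono {p : Prog (Alphabet T R)} {s s' : R → List Sym} {t t' : ℕ}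
    (h : RExec T p s s' t) (ht : t ≤ t') : RExec T p s s' t' := Prog.Exec.mono h ht

theorem RExec.seq {p q : Prog (Alphabet T R)} {s s' s'' : R → List Sym} {t t' : ℕ}
    (hp : RExec T p s s' t) (hq : RExec T q s' s'' t') : RExec T (p.seq q) s s'' (t + t') :=
  Prog.Exec.seq hp hq

theorem rexec_loop_nil {p : Prog (Alphabet T R)} {r : R} {s : R → List Sym} (h : s r = []) :
    RExec T (p.loop (.inl r)) s s 1 :=
  Prog.exec_loop_nil (S := store T s) h

theorem rexec_loop_cons {p : Prog (Alphabet T R)} {r : R} {s s' s'' : R → List Sym} {a : Sym}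
    {l : List Sym} {t t' : ℕ} (h : s r = a :: l) (hp : RExec T p (update s r l) s' t)
    (hl : RExec T (p.loop (.inl r)) s' s'' t') :
    RExec T (p.loop (.inl r)) s s'' (1 + t + t') :=
  Prog.exec_loop_cons (S := store T s) h (by rw [update_store]; exact hp) hl

theorem exists_push (T : ι → FinTM2) (r : R) (l : List Sym) :
    ∃ p : Prog (Alphabet T R), ∀ s, RExec T p s (update s r (l.reverse ++ s r)) 1 := by
  refine ⟨⟨Unit, inferInstance, (), Unit, inferInstance, (), fun _ =>
    pushList (.inl r) (none : Sym) l.length (fun _ => l) .halt⟩, fun s => ⟨1, le_rfl, .single ?_⟩⟩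
  rw [← update_store]
  exact congrArg some (stepAux_pushList _ _ _ _ _ _ _ le_rfl)

theorem exists_transducer (T : ι → FinTM2) {Q : Type} [Fintype Q] (q₀ : Q) (δ : Q → Sym → Q)
    (out : Q → Sym → List Sym) {r r₁ : R} (h : r ≠ r₁) :
    ∃ p : Prog (Alphabet T R), ∀ s, RExec T p s
      (update (update s r []) r₁ ((transduce δ out q₀ (s r)).reverse ++ s r₁))
      ((s r).length + 1) := by
  refine ⟨Prog.transducer (Γ := Alphabet T R) (.inl r) (fun x : Sym => x) q₀ δ (.inl r₁)
    (none : Sym) out, fun s => ?_⟩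
  have := Prog.exec_transducer (Γ := Alphabet T R) (.inl r) (fun x : Sym => x) q₀ δ
    (k₁ := .inl r₁) (by simpa using h) (none : Sym) out (store T s)
  unfold RExec
  rw [← update_store, ← update_store]
  simpa [store] using this

/-- Move a register to another one; the order of the symbols is reversed. -/
theorem exists_move (T : ι → FinTM2) {r r₁ : R} (h : r ≠ r₁) :
    ∃ p : Prog (Alphabet T R), ∀ s, RExec T p s
      (update (update s r []) r₁ ((s r).reverse ++ s r₁)) ((s r).length + 1) := by
  obtain ⟨p, hp⟩ := exists_transducer T () (fun _ _ => ()) (fun _ x => [x]) h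
  refine ⟨p, fun s => ?_⟩
  have := hp s
  rwa [transduce_singleton, List.map_id'] at this

/-- A transducer without output; `r₁` is only its nominal output stack. -/
theorem exists_clear (T : ι → FinTM2) {r r₁ : R} (h : r ≠ r₁) :
    ∃ p : Prog (Alphabet T R), ∀ s, RExec T p s (update s r []) ((s r).length + 1) := by
  obtain ⟨p, hp⟩ := exists_transducer T () (fun _ _ => ()) (fun _ _ => []) h
  refine ⟨p, fun s => ?_⟩
  have := hp s
  rw [transduce_nil] at this
  convert this using 1
  have h' : s r₁ = update s r [] r₁ := by rw [update_of_ne h.symm]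
  simp only [List.reverse_nil, List.nil_append]
  rw [h', update_eq_self]

/-- Moving `r` to `t` reverses it, and distributing `t` over `r` and `u` reverses once more, so `r`
is restored and `u` receives the image in the right order. -/
theorem exists_copy (T : ι → FinTM2) (f : Sym → Sym) {r t u : R} (hrt : r ≠ t) (hru : r ≠ u)
    (htu : t ≠ u) :
    ∃ p : Prog (Alphabet T R), ∀ s, s t = [] → s u = [] → RExec T p s
      (update s u ((s r).map f)) (2 * (s r).length + 2) := by
  obtain ⟨p, hp⟩ := exists_move T hrt
  refine ⟨p.seq (Prog.unzip (Γ := Alphabet T R) (.inl t) (fun x : Sym => x) (.inl r) (.inl u)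
    (none : Sym) (none : Sym) (fun x => x) f), fun s ht hu => ?_⟩
  have h1 := hp s
  have h2 := Prog.exec_unzip (Γ := Alphabet T R) (.inl t) (fun x : Sym => x) (k₁ := .inl r)
    (k₂ := .inl u) (by simpa using hrt.symm) (by simpa using htu) (by simpa using hru)
    (none : Sym) (none : Sym) (fun x => x) f
      (store T (update (update s r []) t ((s r).reverse ++ s t)))
  simp only [update_store, store] at h2
  have h3 := RExec.seq h1 h2
  have key : update (update (update (update (update s r []) t ((s r).reverse ++ s t)) t []) r
      (s r)) u ((s r).map f) = update s u ((s r).map f) := by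
    clear hp h1 h2 h3
    funext x
    by_cases e1 : x = u
    · subst e1; simp
    by_cases e2 : x = r
    · subst e2; simp [e1]
    by_cases e3 : x = t
    · subst e3; simp [e1, e2, ht]
    simp [e1, e2, e3]
  simp only [ht, hu, update_self, update_of_ne hrt, update_of_ne htu.symm, update_of_ne hru.symm,
    List.append_nil, List.map_reverse, List.reverse_reverse, comp_def, List.map_id',
    List.length_reverse] at h3 key
  rw [key] at h3
  exact h3.mono (by omega)

end registers

/-! ### Lengths of the stacks -/

/-- The number of pushes in a statement. -/
def pushCount {K : Type} {Γ : K → Type} {Λ σ : Type} : TM2.Stmt Γ Λ σ → ℕ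
  | .push _ _ q => pushCount q + 1
  | .peek _ _ q | .pop _ _ q | .load _ q => pushCount q
  | .branch _ q₁ q₂ => pushCount q₁ + pushCount q₂
  | .goto _ | .halt => 0

theorem length_stepAux_le {K : Type} [DecidableEq K] {Γ : K → Type} {Λ σ : Type}
    (st : TM2.Stmt Γ Λ σ) (v : σ) (S : ∀ k, List (Γ k)) (k : K) :
    ((TM2.stepAux st v S).stk k).length ≤ (S k).length + pushCount st := by
  induction st generalizing v S with
  | push k' f q ih =>
    refine (ih _ _).trans ?_
    by_cases h : k = k'
    · subst h; simp [pushCount]; omega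
    · simp [pushCount, h]
  | pop k' f q ih =>
    refine (ih _ _).trans ?_
    by_cases h : k = k'
    · subst h; simp [pushCount]
    · simp [pushCount, h]
  | peek k' f q ih => exact ih _ _
  | load f q ih => exact ih _ _
  | branch f q₁ q₂ ih₁ ih₂ =>
    have h1 := ih₁ v S
    have h2 := ih₂ v S
    simp only [TM2.stepAux, pushCount]
    cases f v <;> simp only [cond_true, cond_false] <;> omega
  | goto f => simp [pushCount]
  | halt => simp [pushCount]

/-- A step pushes at most `b` symbols on a stack. Hence outputs of polynomial-time machines have
polynomial length, as composition requires. -/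
theorem length_runsIn_le {K : Type} [DecidableEq K] {Γ : K → Type} {Λ σ : Type} {n : ℕ}
    {M : Λ → TM2.Stmt Γ Λ σ} {c c' : TM2.Cfg Γ Λ σ} (H : RunsIn (TM2.step M) n c c') {b : ℕ}
    (hb : ∀ l, pushCount (M l) ≤ b) (k : K) : (c'.stk k).length ≤ (c.stk k).length + n * b := by
  induction H with
  | refl => simp
  | @head n c c₁ c₂ h _ ih =>
    obtain ⟨l, v, S⟩ := c
    cases l with
    | none => simp at h
    | some l =>
      rw [TM2.step.eq_2] at h
      have h1 := length_stepAux_le (M l) v S k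
      rw [Option.some.inj h] at h1
      have h2 := hb l
      simp only at h1 ⊢
      rw [Nat.succ_mul]
      omega

end SearchClasses

namespace SearchClasses

open Turing Function

/-! ### Emitting programs -/

theorem Polynomial.eval_le_eval (P : Polynomial ℕ) {m n : ℕ} (h : m ≤ n) :
    P.eval m ≤ P.eval n := by
  induction P using Polynomial.induction_on' with
  | add p q hp hq => simpa using add_le_add hp hq
  | monomial k a => simpa using Nat.mul_le_mul_left a (Nat.pow_le_pow_left h k)

section emits

variable {ι α : Type} [DecidableEq ι] (T : ι → FinTM2)

/-- The total length of the values of the variables in the context. -/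
def ctxSize (ctx : List (α → List Sym)) (a : α) : ℕ := (ctx.map fun X => (X a).length).sum

theorem length_le_ctxSize {ctx : List (α → List Sym)} {X : α → List Sym} (h : X ∈ ctx) (a : α) :
    (X a).length ≤ ctxSize ctx a :=
  List.single_le_sum (by simp) _ (List.mem_map.2 ⟨X, h, rfl⟩)

/-- From the registers `regs` with the values `ctx`, a program, which may use the scratch
registers `sc`, emits the value of `F` to the register `o`, in reverse order, in time `P`. -/
def EmitsWith (w : ℕ) (P : Polynomial ℕ) (ctx : List (α → List Sym)) (F : α → List Sym) : Prop :=
  ∀ (R : Type) [DecidableEq R] (regs : List R) (o : R) (sc : List R),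
    w ≤ sc.length → regs.length = ctx.length → (o :: sc).Nodup → (∀ r ∈ regs, r ∉ o :: sc) →
    ∃ p : Prog (Alphabet T R), ∀ (a : α) (s : R → List Sym),
      List.Forall₂ (fun r X => s r = X a) regs ctx → (∀ r ∈ sc, s r = []) →
      RExec T p s (update s o ((F a).reverse ++ s o)) (P.eval (ctxSize ctx a))

/-- `F` can be computed in polynomial time from the variables in the context, by a program which
may call the machines `T i`. -/
def Emits (ctx : List (α → List Sym)) (F : α → List Sym) : Prop :=
  ∃ (w : ℕ) (P : Polynomial ℕ), (∀ a, (F a).length ≤ P.eval (ctxSize ctx a)) ∧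
    EmitsWith T w P ctx F

variable {T}
variable {ctx : List (α → List Sym)} {F G X : α → List Sym}

theorem forall₂_update {R : Type} [DecidableEq R] {regs : List R} {a : α} {s : R → List Sym}
    (h : List.Forall₂ (fun r X => s r = X a) regs ctx) {r : R} (hr : r ∉ regs) (l : List Sym) :
    List.Forall₂ (fun r' X => update s r l r' = X a) regs ctx := by
  induction h with
  | nil => exact .nil
  | cons h _ ih =>
    rw [List.mem_cons, not_or] at hr
    exact .cons (by rwa [update_of_ne (Ne.symm hr.1)]) (ih hr.2)

theorem Emits.const (l : List Sym) : Emits T ctx fun _ => l := by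
  refine ⟨0, Polynomial.C (l.length + 1), fun a => by simp, fun R _ regs o sc _ _ _ _ => ?_⟩
  obtain ⟨p, hp⟩ := exists_push T o l
  exact ⟨p, fun a s _ _ => (hp s).mono (by simp)⟩

/-- Since values are pushed in reverse order on the output register, running one program after the
other concatenates the values. -/
theorem Emits.append (hF : Emits T ctx F) (hG : Emits T ctx G) :
    Emits T ctx fun a => F a ++ G a := by
  obtain ⟨w, P, hP, hF⟩ := hF
  obtain ⟨w', P', hP', hG⟩ := hG
  refine ⟨max w w', P + P', fun a => ?_, fun R _ regs o sc hw hl hn hd => ?_⟩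
  · simpa using add_le_add (hP a) (hP' a)
  · obtain ⟨p, hp⟩ := hF R regs o sc (le_of_max_le_left hw) hl hn hd
    obtain ⟨q, hq⟩ := hG R regs o sc (le_of_max_le_right hw) hl hn hd
    have ho : o ∉ sc := (List.nodup_cons.1 hn).1
    have ho' : o ∉ regs := fun h => hd o h (by simp)
    refine ⟨p.seq q, fun a s hs hsc => ?_⟩
    have h2 := hq a (update s o ((F a).reverse ++ s o)) (forall₂_update hs ho' _)
      (fun r hr => by rw [update_of_ne (ne_of_mem_of_not_mem hr ho), hsc r hr])
    have := (hp a s hs hsc).seq h2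
    simpa using this

/-- The register holding a variable of the context. -/
theorem exists_register {R : Type} {regs : List R} (hl : regs.length = ctx.length) (hX : X ∈ ctx) :
    ∃ r ∈ regs, ∀ (a : α) (s : R → List Sym),
      List.Forall₂ (fun r X => s r = X a) regs ctx → s r = X a := by
  obtain ⟨i, hi, rfl⟩ := List.mem_iff_getElem.1 hX
  refine ⟨regs[i]'(hl ▸ hi), List.getElem_mem _, fun a s h => ?_⟩
  exact h.get (hl ▸ hi) hi

/-- A transducer consumes its input, so it is run on a scratch copy and the register of the variable
survives. -/
theorem Emits.transduce {Q : Type} [Fintype Q] (q₀ : Q) (δ : Q → Sym → Q)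
    (out : Q → Sym → List Sym) (hX : X ∈ ctx) :
    Emits T ctx fun a => SearchClasses.transduce δ out q₀ (X a) := by
  set n := Finset.univ.sup fun p : Q × Sym => (out p.1 p.2).length with hn
  refine ⟨2, Polynomial.C n * Polynomial.X + (3 * Polynomial.X + 3), fun a => ?_,
    fun R _ regs o sc hw hl hnd hd => ?_⟩
  · have h1 : (SearchClasses.transduce δ out q₀ (X a)).length ≤ n * (X a).length :=
      length_transduce_le δ out (fun q b =>
        Finset.le_sup (f := fun p : Q × Sym => (out p.1 p.2).length) (Finset.mem_univ (q, b))) _ _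
    have h2 := Nat.mul_le_mul_left n (length_le_ctxSize hX a)
    simp only [Polynomial.eval_add, Polynomial.eval_mul, Polynomial.eval_C, Polynomial.eval_X,
      Polynomial.eval_ofNat]
    omega
  · obtain ⟨r, hr, hrX⟩ := exists_register hl hX
    match sc, hw with
    | t :: u :: sc, _ =>
      simp only [List.nodup_cons, List.mem_cons, not_or] at hnd hd
      have hr' := hd r hr
      obtain ⟨p, hp⟩ := exists_copy T id (r := r) (t := t) (u := u) (by tauto) (by tauto) (by tauto)
      obtain ⟨q, hq⟩ := exists_transducer T q₀ δ out (r := u) (r₁ := o) (by tauto)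
      refine ⟨p.seq q, fun a s hs hsc => ?_⟩
      have h1 := hp s (hsc t (by simp)) (hsc u (by simp))
      have h2 := h1.seq (hq _)
      have hou : o ≠ u := by tauto
      have hu : s u = [] := hsc u (by simp)
      simp only [List.map_id, update_self, update_idem, update_of_ne hou, hrX a s hs] at h2
      rw [show update s u [] = s by rw [← hu, update_eq_self]] at h2
      refine h2.mono ?_
      have h2 := length_le_ctxSize hX a
      simp only [Polynomial.eval_add, Polynomial.eval_mul, Polynomial.eval_C, Polynomial.eval_X,
        Polynomial.eval_ofNat]
      omega

/-- The value of `F` is emitted, in reverse, to one scratch register and moved to a second one,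
which puts it in the right order. This register is then a variable for `G`, and it is cleared at the
end. -/
theorem Emits.letIn (hF : Emits T ctx F) (hG : Emits T (F :: ctx) G) : Emits T ctx G := by
  obtain ⟨w, P, hP, hF⟩ := hF
  obtain ⟨w', P', hP', hG⟩ := hG
  have hsize : ∀ a, P'.eval (ctxSize (F :: ctx) a) ≤
      (P'.comp (P + Polynomial.X)).eval (ctxSize ctx a) := fun a => by
    rw [Polynomial.eval_comp]
    refine Polynomial.eval_le_eval P' ?_
    have := hP a
    simpa [ctxSize] using this
  -- The three `P` pay for computing `F`, for moving its value and for clearing it, both of the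
  -- latter linear in a length bounded by `P`; the extra 2 is their overhead.
  refine ⟨2 + max w w', 3 * P + P'.comp (P + Polynomial.X) + 2, fun a => ?_,
    fun R _ regs o sc hw hl hnd hd => ?_⟩
  · have := (hP' a).trans (hsize a)
    simp only [Polynomial.eval_add, Polynomial.eval_mul, Polynomial.eval_ofNat]
    omega
  · match sc, hw with
    | [], hw | [_], hw => simp only [List.length_cons, List.length_nil] at hw; omega
    | t :: u :: sc, hw =>
      simp only [List.length_cons] at hw
      have hnd' := hnd
      have hd' := hd
      simp only [List.nodup_cons, List.mem_cons, not_or] at hnd hd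
      obtain ⟨⟨hot, hou, hosc⟩, ⟨htu, htsc⟩, husc, hscn⟩ := hnd
      obtain ⟨p, hp⟩ := hF R regs t sc (by omega) hl (by simp [htsc, hscn])
        (fun r hr => by have := hd r hr; simp; tauto)
      obtain ⟨q, hq⟩ := exists_move T htu
      obtain ⟨p', hp'⟩ := hG R (u :: regs) o sc (by omega) (by simp [hl]) (by simp [hosc, hscn])
        (fun r hr => by
          rcases List.mem_cons.1 hr with rfl | hr
          · simp only [List.mem_cons]; tauto
          · have := hd r hr; simp; tauto)
      obtain ⟨q', hq'⟩ := exists_clear T (r := u) (r₁ := t) (Ne.symm htu)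
      refine ⟨((p.seq q).seq p').seq q', fun a s hs hsc => ?_⟩
      have ht : s t = [] := hsc t (by simp)
      have hu : s u = [] := hsc u (by simp)
      have hur : u ∉ regs := fun h => by have := hd u h; tauto
      have e1 := hp a s hs (fun r hr => hsc r (by simp [hr]))
      have e2 := hq (update s t ((F a).reverse ++ s t))
      have k2 : update (update (update s t ((F a).reverse ++ s t)) t []) u
          ((update s t ((F a).reverse ++ s t) t).reverse ++ update s t ((F a).reverse ++ s t) u) =
          update s u (F a) := by
        simp only [update_self, update_idem, update_of_ne (Ne.symm htu), ht, hu, List.append_nil,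
          List.reverse_reverse]
        rw [show update s t [] = s by rw [← ht, update_eq_self]]
      rw [k2] at e2
      have e3 := hp' a (update s u (F a))
        (.cons (by rw [update_self]) (forall₂_update hs hur _))
        (fun r hr => by rw [update_of_ne (ne_of_mem_of_not_mem hr husc), hsc r (by simp [hr])])
      have e4 := hq' (update (update s u (F a)) o ((G a).reverse ++ update s u (F a) o))
      have k4 : update (update (update s u (F a)) o ((G a).reverse ++ update s u (F a) o)) u [] =
          update s o ((G a).reverse ++ s o) := by
        rw [update_of_ne hou, update_comm (Ne.symm hou), update_idem, update_comm hou,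
          show update s u [] = s by rw [← hu, update_eq_self]]
      rw [k4] at e4
      refine (((e1.seq e2).seq e3).seq e4).mono ?_
      have b1 := hP a
      have b2 := hsize a
      simp only [update_self, update_of_ne (Ne.symm hou), ht, List.append_nil, List.length_reverse,
        Polynomial.eval_add, Polynomial.eval_mul, Polynomial.eval_ofNat]
      omega

/-- Repetition, with a counter. -/
theorem Emits.repeat {H : α × ℕ → List Sym} (hX : X ∈ ctx)
    (hH : Emits T ((fun p : α × ℕ => List.replicate p.2 (some true)) ::
      ctx.map fun Y (p : α × ℕ) => Y p.1) H) :
    Emits T ctx fun a => (List.range (X a).length).flatMap fun t => H (a, t) := by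
  obtain ⟨w, P, hP, hH⟩ := hH
  -- The counter is shorter than a variable of the context, so adding it at most doubles the size of
  -- the context.
  have hsize : ∀ a t, t < (X a).length → P.eval (ctxSize ((fun p : α × ℕ =>
      List.replicate p.2 (some true)) :: ctx.map fun Y (p : α × ℕ) => Y p.1) (a, t)) ≤
      (P.comp (2 * Polynomial.X)).eval (ctxSize ctx a) := fun a t ht => by
    rw [Polynomial.eval_comp]
    refine Polynomial.eval_le_eval P ?_
    have := length_le_ctxSize hX a
    simp only [ctxSize, List.map_cons, List.length_replicate, List.map_map, List.sum_cons,
      Polynomial.eval_mul, Polynomial.eval_ofNat, Polynomial.eval_X, comp_def] at this ⊢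
    omega
  have hlen : ∀ a, ∀ n ≤ (X a).length, ((List.range n).flatMap fun t => H (a, t)).length ≤
      n * (P.comp (2 * Polynomial.X)).eval (ctxSize ctx a) := fun a n hn => by
    induction n with
    | zero => simp
    | succ n ih =>
      have := ih (by omega)
      have h1 := (hP (a, n)).trans (hsize a n (by omega))
      rw [List.range_succ, List.flatMap_append, List.length_append, Nat.succ_mul]
      simp only [List.flatMap_cons, List.flatMap_nil, List.append_nil]
      omega
  refine ⟨3 + w, Polynomial.X * (P.comp (2 * Polynomial.X) + 2) + (3 * Polynomial.X + 4),
    fun a => ?_, fun R _ regs o sc hw hl hnd hd => ?_⟩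
  · refine (hlen a _ le_rfl).trans ?_
    have := Nat.mul_le_mul_right ((P.comp (2 * Polynomial.X)).eval (ctxSize ctx a))
      (length_le_ctxSize hX a)
    refine this.trans ?_
    simp only [Polynomial.eval_add, Polynomial.eval_mul, Polynomial.eval_X, mul_add]
    omega
  · obtain ⟨r, hr, hrX⟩ := exists_register hl hX
    match sc, hw with
    | [], hw | [_], hw | [_, _], hw => simp only [List.length_cons, List.length_nil] at hw; omega
    | t :: u :: c :: sc, hw =>
      simp only [List.length_cons] at hw
      simp only [List.nodup_cons, List.mem_cons, not_or] at hnd hd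
      obtain ⟨⟨hot, hou, hoc, hosc⟩, ⟨htu, htc, htsc⟩, ⟨huc, husc⟩, hcsc, hscn⟩ := hnd
      have hr' := hd r hr
      obtain ⟨p, hp⟩ := exists_copy T (fun _ => some true) (r := r) (t := t) (u := u) (by tauto)
        (by tauto) (by tauto)
      obtain ⟨b, hb⟩ := hH R (c :: regs) o sc (by omega) (by simp [hl]) (by simp [hosc, hscn])
        (fun r hr => by
          rcases List.mem_cons.1 hr with rfl | hr
          · simp only [List.mem_cons]; tauto
          · have := hd r hr; simp; tauto)
      obtain ⟨i, hi⟩ := exists_push T c [some true]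
      obtain ⟨q, hq⟩ := exists_clear T (r := c) (r₁ := t) (Ne.symm htc)
      refine ⟨(p.seq ((b.seq i).loop (.inl u))).seq q, fun a s hs hsc => ?_⟩
      have ht : s t = [] := hsc t (by simp)
      have hu : s u = [] := hsc u (by simp)
      have hc : s c = [] := hsc c (by simp)
      have hur : u ∉ regs := fun h => by have := hd u h; tauto
      have hcr : c ∉ regs := fun h => by have := hd c h; tauto
      have hor : o ∉ regs := fun h => by have := hd o h; tauto
      have hrX' := hrX a s hs
      set N := (X a).length with hN
      set B := (P.comp (2 * Polynomial.X)).eval (ctxSize ctx a) with hB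
      have e1 := hp s ht hu
      rw [hrX', ← hN, List.map_const'] at e1
      -- The loop invariant after `n` rounds: `u` holds the remaining rounds in unary, `c` holds the
      -- counter, and `o` has received the outputs so far.
      let st : ℕ → R → List Sym := fun n => update (update (update s u
        (List.replicate (N - n) (some true))) c (List.replicate n (some true))) o
        (((List.range n).flatMap fun t => H (a, t)).reverse ++ s o)
      have hloop : ∀ m n, n + m = N →
          RExec T ((b.seq i).loop (.inl u)) (st n) (st N) (m * (B + 2) + 1) := fun m => by
        induction m with
        | zero =>
          intro n hn
          obtain rfl : n = N := by omega
          rw [Nat.zero_mul]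
          exact rexec_loop_nil (by simp [st, update_of_ne huc, update_of_ne (Ne.symm hou)])
        | succ m ih =>
          intro n hn
          have f1 := ih (n + 1) (by omega)
          have f2 := hb (a, n) (update (st n) u (List.replicate m (some true)))
            (.cons (by simp [st, update_of_ne (Ne.symm huc), update_of_ne (Ne.symm hoc)])
              (forall₂_update (by
                rw [List.forall₂_map_right_iff]
                exact forall₂_update (forall₂_update (forall₂_update hs hur _) hcr _) hor _)
                hur _))
            (fun r hr => by
              have g1 : r ≠ u := fun e => husc (e ▸ hr)
              have g2 : r ≠ c := fun e => hcsc (e ▸ hr)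
              have g3 : r ≠ o := fun e => hosc (e ▸ hr)
              simp only [st, update_of_ne g1, update_of_ne g2, update_of_ne g3]
              exact hsc r (by simp [hr]))
          have f3 := f2.seq (hi _)
          refine (rexec_loop_cons (a := some true) (l := List.replicate m (some true))
            ?_ f3 (?_ : RExec T _ _ (st N) (m * (B + 2) + 1))).mono ?_
          · simp only [st, update_of_ne huc, update_of_ne (Ne.symm hou), update_self]
            rw [show N - n = m + 1 by omega, List.replicate_succ]
          · convert f1 using 1
            funext x
            by_cases x1 : x = o
            · subst x1
              simp [st, hoc, hou, List.range_succ]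
            by_cases x2 : x = c
            · subst x2
              simp [st, x1, Ne.symm huc, List.replicate_succ]
            by_cases x3 : x = u
            · subst x3
              simp [st, x1, x2, show N - (n + 1) = m by omega]
            simp [st, x1, x2, x3]
          · have := hsize a n (by omega)
            rw [Nat.succ_mul]
            omega
      have e2 := hloop N 0 (by omega)
      have k2 : st 0 = update s u (List.replicate N (some true)) := by
        funext x
        by_cases x1 : x = o
        · subst x1
          simp [st, hou]
        by_cases x2 : x = c
        · subst x2
          simp [st, x1, Ne.symm huc, hc]
        by_cases x3 : x = u
        · subst x3
          simp [st, x1, x2]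
        simp [st, x1, x2, x3]
      rw [k2] at e2
      have e3 := hq (st N)
      have k3 : update (st N) c [] = update s o
          (((List.range N).flatMap fun t => H (a, t)).reverse ++ s o) := by
        funext x
        by_cases x1 : x = o
        · subst x1
          simp [st, hoc]
        by_cases x2 : x = c
        · subst x2
          simp [x1, hc]
        by_cases x3 : x = u
        · subst x3
          simp [st, x1, x2, hu]
        simp [st, x1, x2, x3]
      rw [k3, show st N c = List.replicate N (some true) by simp [st, Ne.symm hoc]] at e3
      refine ((e1.seq e2).seq e3).mono ?_
      have h1 : N ≤ ctxSize ctx a := length_le_ctxSize hX a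
      have h2 := Nat.mul_le_mul_right (B + 2) h1
      simp only [Polynomial.eval_add, Polynomial.eval_mul, Polynomial.eval_X,
        Polynomial.eval_ofNat, List.length_replicate, ← hB]
      omega

end emits

end SearchClasses

namespace SearchClasses

open Turing Function

/-! ### Calling Turing machines -/

/-- The machine `M` computes `f` in polynomial time. -/
def Computes (M : FinTM2) {β γ A B : Type} (ea : β → List A) (eb : γ → List B) (f : β → γ) : Prop :=
  ∃ (i : M.Γ M.k₀ ≃ A) (o : M.Γ M.k₁ ≃ B) (P : Polynomial ℕ), ∀ x,
    ∃ n ≤ P.eval (ea x).length, RunsIn (TM2.step M.m) n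
      ⟨some M.main, M.initialState, update (fun _ => []) M.k₀ ((ea x).map i.symm)⟩
      ⟨none, M.initialState, update (fun _ => []) M.k₁ ((eb (f x)).map o.symm)⟩

theorem initList_eq (M : FinTM2) (l : List (M.Γ M.k₀)) :
    initList M l = ⟨some M.main, M.initialState, update (fun _ => []) M.k₀ l⟩ := by
  unfold initList
  congr 1
  funext k
  by_cases h : k = M.k₀
  · subst h; simp
  · simp [h]

theorem haltList_eq (M : FinTM2) (l : List (M.Γ M.k₁)) :
    haltList M l = ⟨none, M.initialState, update (fun _ => []) M.k₁ l⟩ := by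
  unfold haltList
  congr 1
  funext k
  by_cases h : k = M.k₁
  · subst h; simp
  · simp [h]

/-- Brings the machine itself to the front, so that finitely many machines can form a family of
subroutines. -/
theorem polyTime_iff_exists_computes {β γ A B : Type} {ea : β → List A} {eb : γ → List B}
    {f : β → γ} : PolyTime ea eb f ↔ ∃ M, Computes M ea eb f := by
  constructor
  · rintro ⟨h⟩
    refine ⟨h.tm, h.inputAlphabet, h.outputAlphabet, h.time, fun x => ?_⟩
    obtain ⟨⟨n, hn⟩, hle⟩ := h.outputsFun x
    refine ⟨n, hle, runsIn_iff_iterate.2 ?_⟩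
    simp only [Option.map_some, initList_eq, haltList_eq] at hn
    exact hn
  · rintro ⟨M, i, o, P, h⟩
    choose n hn hr using h
    refine ⟨⟨⟨M, i, o⟩, P, fun x => ⟨⟨n x, ?_⟩, hn x⟩⟩⟩
    simp only [Option.map_some, initList_eq, haltList_eq]
    exact runsIn_iff_iterate.1 (hr x)

theorem Computes.length_le {M : FinTM2} {β γ A B : Type} {ea : β → List A} {eb : γ → List B}
    {f : β → γ} (h : Computes M ea eb f) :
    ∃ P : Polynomial ℕ, ∀ x, (eb (f x)).length ≤ P.eval (ea x).length := by
  obtain ⟨i, o, P, h⟩ := h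
  have := M.ΛFin
  refine ⟨Polynomial.X + P * Polynomial.C (Finset.univ.sup fun l => pushCount (M.m l)),
    fun x => ?_⟩
  obtain ⟨n, hn, hr⟩ := h x
  have h1 := length_runsIn_le hr (b := Finset.univ.sup fun l => pushCount (M.m l))
    (fun l => Finset.le_sup (f := fun l => pushCount (M.m l)) (Finset.mem_univ l)) M.k₁
  have h2 : (update (fun k => ([] : List (M.Γ k))) M.k₀ ((ea x).map i.symm) M.k₁).length ≤
      (ea x).length := by
    generalize M.k₁ = k
    by_cases hk : k = M.k₀
    · subst hk; simp
    · simp [hk]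
  have h3 := Nat.mul_le_mul_right (Finset.univ.sup fun l => pushCount (M.m l)) hn
  simp only [update_self, List.length_map] at h1
  simp only [Polynomial.eval_add, Polynomial.eval_X, Polynomial.eval_mul, Polynomial.eval_C]
  omega

section call

variable {ι α : Type} [DecidableEq ι] {T : ι → FinTM2}

/-- The machine `T i` as a program. -/
def subProg (T : ι → FinTM2) (R : Type) (i : ι) :
    Prog fun k : (T i).K => Alphabet T R (.inr ⟨i, k⟩) where
  Λ := (T i).Λ
  finΛ := (T i).ΛFin
  main := (T i).main
  σ := (T i).σ
  finσ := (T i).σFin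
  init := (T i).initialState
  m := (T i).m

/-- The reversed argument in `t` is drained to the input stack of the machine, which restores its
order; the machine runs; its output stack is drained to `o`. By definition of computing, the machine
leaves all its other stacks empty and its state initial, so it can be called repeatedly. -/
theorem exists_call {i : ι} {β γ A B : Type} [Fintype B]
    {ea : β → List A} {eb : γ → List B} {f : β → γ} (h : Computes (T i) ea eb f) :
    ∃ P : Polynomial ℕ, ∀ (R : Type) [DecidableEq R] (encA : A → Sym) (decA : Sym → A),
      LeftInverse decA encA →
      ∀ (encB : B → Sym) (t o : R), t ≠ o →
      ∃ p : Prog (Alphabet T R), ∀ (x : β) (s : R → List Sym),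
        s t = ((ea x).map encA).reverse →
        RExec T p s (update (update s t []) o (((eb (f x)).map encB).reverse ++ s o))
          (P.eval (ea x).length) := by
  obtain ⟨Q, hQ⟩ := h.length_le
  obtain ⟨iA, oB, P, h⟩ := h
  refine ⟨Polynomial.X + 1 + P + (Q + 1), fun R _ encA decA hdec encB t o hto => ?_⟩
  set k₀ : StackIdx T R := .inr ⟨i, (T i).k₀⟩ with hk₀
  set k₁ : StackIdx T R := .inr ⟨i, (T i).k₁⟩ with hk₁
  refine ⟨((Prog.transducer (Γ := Alphabet T R) (.inl t) (fun x : Sym => x) () (fun _ _ => ())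
      (.inr ⟨i, (T i).k₀⟩) (iA.symm (decA none)) (fun _ x => [iA.symm (decA x)])).seq
    ((subProg T R i).embed fun k => .inr ⟨i, k⟩)).seq
    (Prog.transducer (Γ := Alphabet T R) (.inr ⟨i, (T i).k₁⟩) oB () (fun _ _ => ()) (.inl o)
      (none : Sym) (fun _ x => [encB x])), fun x s hs => ?_⟩
  have e1 := Prog.exec_transducer (Γ := Alphabet T R) (.inl t) (fun x : Sym => x) ()
    (fun _ _ => ()) (k₁ := k₀) (by simp [hk₀]) (iA.symm (decA none))
    (fun _ x => [iA.symm (decA x)]) (store T s)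
  have e3 := Prog.exec_transducer (Γ := Alphabet T R) k₁ oB () (fun _ _ => ()) (k₁ := .inl o)
    (by simp [hk₁]) (none : Sym) (fun _ x => [encB x])
    (update (store T (update s t [])) k₁ ((eb (f x)).map oB.symm))
  simp only [transduce_singleton] at e1 e3
  have l1 : ((List.map (fun x => iA.symm (decA x)) ((store T s (.inl t)).map (fun x : Sym => x))
      ).reverse ++ store T s k₀ : List ((T i).Γ (T i).k₀)) = (ea x).map iA.symm := by
    have : store T s (.inl t) = ((ea x).map encA).reverse := hs
    rw [this, List.map_id', List.map_reverse, List.reverse_reverse, List.map_map]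
    rw [show store T s k₀ = [] from rfl, List.append_nil]
    simp [comp_def, hdec _]
  rw [l1, update_store] at e1
  obtain ⟨n, hn, hr⟩ := h x
  have e2 : ((subProg T R i).embed fun k => .inr ⟨i, k⟩).Exec
      (update (store T (update s t [])) k₀ ((ea x).map iA.symm))
      (update (store T (update s t [])) k₁ ((eb (f x)).map oB.symm)) (P.eval (ea x).length) := by
    have hinj : Injective fun k : (T i).K => (Sum.inr ⟨i, k⟩ : StackIdx T R) := fun k k' e => by
      simpa using e
    have hup : ∀ (k : (T i).K) (l : List ((T i).Γ k)),
        (fun k' : (T i).K => update (store T (update s t [])) (.inr ⟨i, k⟩) l (.inr ⟨i, k'⟩)) =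
          update (fun k' => ([] : List ((T i).Γ k'))) k l := fun k l =>
      update_comp_eq_of_injective' (store T (update s t [])) hinj k l
    refine Prog.Exec.embed hinj
      (S₁ := update (fun k' => ([] : List ((T i).Γ k'))) (T i).k₁ ((eb (f x)).map oB.symm))
      ⟨n, hn, ?_⟩ (fun k => ?_) (fun k' hk' => ?_)
    · rw [← hup (T i).k₀] at hr
      exact hr
    · exact congrFun (hup _ _) k
    · rw [update_of_ne (hk' _).symm, update_of_ne (hk' _).symm]
  have l3 : update (update (update (store T (update s t [])) k₁ ((eb (f x)).map oB.symm)) k₁ [])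
      (.inl o) ((List.map encB ((update (store T (update s t [])) k₁ ((eb (f x)).map oB.symm) k₁
        ).map oB)).reverse ++ update (store T (update s t [])) k₁ ((eb (f x)).map oB.symm) (.inl o))
      = store T (update (update s t []) o (((eb (f x)).map encB).reverse ++ s o)) := by
    rw [update_idem, update_self, update_of_ne (by simp [hk₁]), List.map_map,
      ← update_store T (update s t []) o]
    rw [show update (store T (update s t [])) k₁ [] = store T (update s t []) from
      update_eq_self (a := k₁) (f := store T (update s t []))]
    simp [store, hto.symm, comp_def]
  rw [l3] at e3
  refine ((e1.seq e2).seq e3).mono ?_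
  have h1 : (store T s (.inl t)).length = (ea x).length := by
    have : store T s (.inl t) = ((ea x).map encA).reverse := hs
    simp [this]
  have h2 := hQ x
  rw [h1, update_self, List.length_map]
  simp only [Polynomial.eval_add, Polynomial.eval_X, Polynomial.eval_one]
  omega

theorem Emits.call {ctx : List (α → List Sym)} {i : ι} {β γ A B : Type} [Fintype B]
    {ea : β → List A} {eb : γ → List B} {f : β → γ} (h : Computes (T i) ea eb f) (φ : α → β)
    {encA : A → Sym} {decA : Sym → A} (hA : LeftInverse decA encA) (encB : B → Sym)
    (hF : Emits T ctx fun a => (ea (φ a)).map encA) :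
    Emits T ctx fun a => (eb (f (φ a))).map encB := by
  obtain ⟨w, P, hP, hF⟩ := hF
  obtain ⟨Q, hQ⟩ := h.length_le
  obtain ⟨P', hcall⟩ := exists_call h
  have hlen : ∀ a, (ea (φ a)).length ≤ P.eval (ctxSize ctx a) := fun a => by simpa using hP a
  refine ⟨1 + w, P + Q.comp P + P'.comp P, fun a => ?_, fun R _ regs o sc hw hl hnd hd => ?_⟩
  · have := (hQ (φ a)).trans (Polynomial.eval_le_eval Q (hlen a))
    simp only [List.length_map, Polynomial.eval_add, Polynomial.eval_comp]
    omega
  · match sc, hw with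
    | [], hw => simp only [List.length_nil] at hw; omega
    | t :: sc, hw =>
      simp only [List.length_cons] at hw
      simp only [List.nodup_cons, List.mem_cons, not_or] at hnd hd
      obtain ⟨⟨hot, hosc⟩, htsc, hscn⟩ := hnd
      obtain ⟨p, hp⟩ := hF R regs t sc (by omega) hl (by simp [htsc, hscn])
        (fun r hr => by have := hd r hr; simp; tauto)
      obtain ⟨q, hq⟩ := hcall R encA decA hA encB t o (Ne.symm hot)
      refine ⟨p.seq q, fun a s hs hsc => ?_⟩
      have ht : s t = [] := hsc t (by simp)
      have e1 := hp a s hs (fun r hr => hsc r (by simp [hr]))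
      rw [ht, List.append_nil] at e1
      have e2 := hq (φ a) _ (update_self (f := s) t (((ea (φ a)).map encA).reverse))
      rw [update_idem, update_of_ne hot,
        show update s t [] = s by rw [← ht, update_eq_self]] at e2
      refine (e1.seq e2).mono ?_
      have := Polynomial.eval_le_eval P' (hlen a)
      simp only [Polynomial.eval_add, Polynomial.eval_comp]
      omega

/-- The stack alphabets after adding an input and an output stack. -/
abbrev IOAlphabet (T : ι → FinTM2) (R A B : Type) : StackIdx T R ⊕ Bool → Type
  | .inl k => Alphabet T R k
  | .inr false => A
  | .inr true => B

theorem exists_computes [Fintype ι] {β γ A B : Type} [Fintype A] [Fintype B] {ea : β → List A}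
    {eb : γ → List B} {f : β → γ} {R : Type} [Fintype R] [DecidableEq R]
    (p : Prog (IOAlphabet T R A B)) (P : Polynomial ℕ)
    (h : ∀ x, p.Exec (update (fun _ => []) (.inr false) (ea x))
      (update (fun _ => []) (.inr true) (eb (f x))) (P.eval (ea x).length)) :
    ∃ M, Computes M ea eb f := by
  have := fun i => (T i).kFin
  have := p.finΛ
  have := p.finσ
  refine ⟨{ K := StackIdx T R ⊕ Bool, kDecidableEq := inferInstance, kFin := inferInstance,
            k₀ := .inr false, k₁ := .inr true, Γ := IOAlphabet T R A B, Λ := p.Λ, main := p.main,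
            ΛFin := p.finΛ, σ := p.σ, initialState := p.init, σFin := p.finσ,
            Γk₀Fin := (inferInstance : Fintype A), m := p.m },
    Equiv.refl A, Equiv.refl B, P, fun x => ?_⟩
  have hA : (ea x).map (Equiv.refl A).symm = ea x := by simp
  have hB : (eb (f x)).map (Equiv.refl B).symm = eb (f x) := by simp
  rw [hA, hB]
  exact h x

/-- Input and output have their own alphabets, so the program on registers is placed between two
transducers that translate between these alphabets and the register symbols. -/
theorem Emits.polyTime [Fintype ι] {β γ A B : Type} [Fintype A] [Fintype B] {ea : β → List A}
    {eb : γ → List B} (f : β → γ) (encA : A → Sym) {encB : B → Sym} {decB : Sym → B}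
    (hB : LeftInverse decB encB)
    (h : Emits T [fun x => (ea x).map encA] fun x => (eb (f x)).map encB) :
    PolyTime ea eb f := by
  obtain ⟨w, P, hP, h⟩ := h
  -- `none` holds the variable, `some none` the output, and the rest are the `w` scratch registers.
  let R := Option (Option (Fin w))
  let o : R := some none
  obtain ⟨p, hp⟩ := h R [none] o ((List.finRange w).map fun i => some (some i))
    (by simp) rfl (by
      refine List.nodup_cons.2 ⟨fun h => ?_, ?_⟩
      · obtain ⟨i, -, e⟩ := List.mem_map.1 h
        exact absurd (Option.some.inj e) (Option.some_ne_none i)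
      · exact (List.nodup_finRange w).map fun i j e => Option.some.inj (Option.some.inj e))
    (by simp [o])
  have hon : o ≠ none := by simp [o]
  -- The input first arrives reversed in `o`, which is free until the output is emitted; the move
  -- puts it right.
  obtain ⟨q, hq⟩ := exists_move T (r := o) (r₁ := none) hon
  obtain ⟨c, hc⟩ := exists_clear T (r := none) (r₁ := o) hon.symm
  have inner : ∀ x, RExec T ((q.seq p).seq c)
      (update (fun _ => []) o ((ea x).map encA).reverse)
      (update (fun _ => []) o ((eb (f x)).map encB).reverse)
      ((ea x).length + 1 + P.eval (ea x).length + ((ea x).length + 1)) := fun x => by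
    have e1 := hq (update (fun _ => []) o ((ea x).map encA).reverse)
    rw [update_idem, update_self, List.reverse_reverse, update_of_ne hon.symm, List.append_nil,
      show update (fun _ : R => ([] : List Sym)) o [] = fun _ => [] from
        update_eq_self (f := fun _ : R => ([] : List Sym)) o] at e1
    have e2 := hp x (update (fun _ => []) none ((ea x).map encA)) (.cons (by simp) .nil)
      (by simp)
    rw [update_of_ne hon, List.append_nil] at e2
    have e3 := hc (update (update (fun _ => []) none ((ea x).map encA)) o
      ((eb (f x)).map encB).reverse)
    have key : update (update (update (fun _ : R => ([] : List Sym)) none ((ea x).map encA)) o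
        ((eb (f x)).map encB).reverse) none [] =
        update (fun _ => []) o ((eb (f x)).map encB).reverse := by
      rw [update_comm hon, update_idem,
        show update (fun _ : R => ([] : List Sym)) none [] = fun _ => [] from
          update_eq_self (f := fun _ : R => ([] : List Sym)) none]
    rw [update_of_ne hon.symm, update_self, key] at e3
    simpa [ctxSize] using (e1.seq e2).seq e3
  refine polyTime_iff_exists_computes.2 (exists_computes (T := T) (R := R)
    (((Prog.transducer (Γ := IOAlphabet T R A B) (.inr false) (fun x : A => x) ()
      (fun _ _ => ()) (.inl (.inl o)) (none : Sym) (fun _ x => [encA x])).seq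
      (((q.seq p).seq c).embed (Γ' := IOAlphabet T R A B) Sum.inl)).seq
      (Prog.transducer (Γ := IOAlphabet T R A B) (.inl (.inl o)) (fun x : Sym => x) ()
      (fun _ _ => ()) (.inr true) (decB none) (fun _ x => [decB x])))
    (3 * Polynomial.X + 3 + 2 * P + 1) fun x => ?_)
  have e1 := Prog.exec_transducer (Γ := IOAlphabet T R A B) (.inr false) (fun x : A => x) ()
    (fun _ _ => ()) (k₁ := .inl (.inl o)) (by simp) (none : Sym) (fun _ x => [encA x])
    (update (fun _ => []) (.inr false) (ea x))
  have e3 := Prog.exec_transducer (Γ := IOAlphabet T R A B) (.inl (.inl o)) (fun x : Sym => x) ()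
    (fun _ _ => ()) (k₁ := .inr true) (by simp) (decB none) (fun _ x => [decB x])
    (update (fun _ => []) (.inl (.inl o)) ((eb (f x)).map encB).reverse)
  have nil_eq : ∀ k, update (fun k => ([] : List (IOAlphabet T R A B k))) k [] = fun _ => [] :=
    fun k => update_eq_self (f := fun k => ([] : List (IOAlphabet T R A B k))) k
  rw [transduce_singleton, update_idem, nil_eq, update_self, update_of_ne (by simp),
    List.append_nil, List.map_id'] at e1
  rw [transduce_singleton, update_idem, nil_eq, update_self, update_of_ne (by simp),
    List.append_nil, List.map_id', List.map_reverse, List.reverse_reverse, List.map_map,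
    show decB ∘ encB = id from funext hB, List.map_id] at e3
  have hst : ∀ l : List Sym, (fun k => update (fun k => ([] : List (IOAlphabet T R A B k)))
      (.inl (.inl o)) l (.inl k)) = store T (update (fun _ => []) o l) := fun l => by
    rw [← update_store]
    refine (update_comp_eq_of_injective' (fun k => ([] : List (IOAlphabet T R A B k)))
      Sum.inl_injective (Sum.inl o) l).trans ?_
    congr 1
    funext k
    cases k <;> rfl
  have e2 : (((q.seq p).seq c).embed (Γ' := IOAlphabet T R A B) Sum.inl).Exec
      (update (fun _ => []) (.inl (.inl o)) ((ea x).map encA).reverse)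
      (update (fun _ => []) (.inl (.inl o)) ((eb (f x)).map encB).reverse) _ :=
    Prog.Exec.embed Sum.inl_injective (by rw [hst]; exact inner x) (fun k => congrFun (hst _) k)
      (fun k' hk' => by rw [update_of_ne (hk' _).symm, update_of_ne (hk' _).symm])
  refine ((e1.seq e2).seq e3).mono ?_
  have := hP x
  simp only [List.length_map, List.length_reverse, ctxSize, List.map_cons, List.map_nil,
    List.sum_cons, List.sum_nil, add_zero, Polynomial.eval_add, Polynomial.eval_mul,
    Polynomial.eval_ofNat, Polynomial.eval_X, Polynomial.eval_one] at this ⊢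
  omega

end call

end SearchClasses

namespace SearchClasses

open Turing Function

/-! ### Composition of reductions -/

section

variable {ι α : Type} [DecidableEq ι] {T : ι → FinTM2} {ctx : List (α → List Sym)}

theorem Emits.var {X : α → List Sym} (hX : X ∈ ctx) : Emits T ctx X := by
  have := Emits.transduce (T := T) () (fun _ _ => ()) (fun _ x => [x]) hX
  simpa [transduce_singleton] using this

theorem Emits.encTriple {a b c : α → List Bool} (ha : Emits T ctx fun t => (a t).map some)
    (hb : Emits T ctx fun t => (b t).map some) (hc : Emits T ctx fun t => (c t).map some) :
    Emits T ctx fun t => (encTriple (a t, b t, c t)).map id := by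
  have := ha.append ((Emits.const [none]).append (hb.append ((Emits.const [none]).append hc)))
  simpa [SearchClasses.encTriple, encPair] using this

/-- The transducer which extracts the symbols between two consecutive separators. -/
def fieldOut (i q : Fin 3) (x : Sym) : List Sym := if q = i ∧ x.isSome then [x] else []

/-- Count the separators. -/
def fieldStep (q : Fin 3) (x : Sym) : Fin 3 := if x.isNone then q + 1 else q

theorem transduce_field (i q : Fin 3) (l : List Bool) (m : List Sym) :
    transduce fieldStep (fieldOut i) q (l.map some ++ m) =
      (if q = i then l.map some else []) ++ transduce fieldStep (fieldOut i) q m := by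
  induction l with
  | nil => simp
  | cons b l ih =>
    have h : fieldStep q (some b) = q := rfl
    simp only [List.map_cons, List.cons_append, transduce, h, ih]
    by_cases hq : q = i <;> simp [hq, fieldOut]

theorem transduce_field_none (i q : Fin 3) (m : List Sym) :
    transduce fieldStep (fieldOut i) q (none :: m) =
      transduce fieldStep (fieldOut i) (q + 1) m := by
  simp [transduce, fieldOut, fieldStep]

/-- The state is the number of separators seen. There are only two, so counting in `Fin 3` does not
wrap around. -/
theorem transduce_encTriple (i : Fin 3) (x y z : List Bool) :
    transduce fieldStep (fieldOut i) 0 (encTriple (x, y, z)) =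
      (if i = 0 then x else if i = 1 then y else z).map some := by
  rw [encTriple, encPair, transduce_field, transduce_field_none, transduce_field,
    transduce_field_none, ← List.append_nil (List.map some z), transduce_field]
  fin_cases i <;> simp [transduce]

theorem Emits.fst {ctx : List (List Bool × List Bool × List Bool → List Sym)}
    (h : (fun t => (SearchClasses.encTriple t).map id) ∈ ctx) :
    Emits T ctx fun t => t.1.map some := by
  convert Emits.transduce (T := T) 0 fieldStep (fieldOut 0) h using 1
  funext t
  rw [List.map_id, transduce_encTriple]
  rfl

theorem Emits.snd {ctx : List (List Bool × List Bool × List Bool → List Sym)}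
    (h : (fun t => (SearchClasses.encTriple t).map id) ∈ ctx) :
    Emits T ctx fun t => t.2.1.map some := by
  convert Emits.transduce (T := T) 0 fieldStep (fieldOut 1) h using 1
  funext t
  rw [List.map_id, transduce_encTriple]
  rfl

theorem Emits.thd {ctx : List (List Bool × List Bool × List Bool → List Sym)}
    (h : (fun t => (SearchClasses.encTriple t).map id) ∈ ctx) :
    Emits T ctx fun t => t.2.2.map some := by
  convert Emits.transduce (T := T) 0 fieldStep (fieldOut 2) h using 1
  funext t
  rw [List.map_id, transduce_encTriple]
  rfl

end

theorem leftInverse_getD_some : LeftInverse (fun x : Sym => x.getD false) some := fun _ => rfl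

theorem PolyTime.comp {f g : List Bool → List Bool} (hf : PolyTime id id f)
    (hg : PolyTime id id g) : PolyTime id id fun x => g (f x) := by
  obtain ⟨M, hM⟩ := polyTime_iff_exists_computes.1 hf
  obtain ⟨N, hN⟩ := polyTime_iff_exists_computes.1 hg
  let T : Bool → FinTM2 := fun b => cond b N M
  have hf : Computes (T false) id id f := hM
  have hg : Computes (T true) id id g := hN
  refine Emits.polyTime (T := T) _ some leftInverse_getD_some ?_
  exact Emits.call hg f leftInverse_getD_some some
    (Emits.call hf id leftInverse_getD_some some (Emits.var (by simp)))

/-- Instances are mapped by `f' ∘ f` and solutions are pulled back by `g'` and then by `g`. The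
intermediate instance `f x` is not part of the input of the second map and has to be recomputed, so
three machines are called. -/
theorem SearchProblem.Reducible.trans {P Q R : SearchProblem} (hPQ : P.Reducible Q)
    (hQR : Q.Reducible R) : P.Reducible R := by
  obtain ⟨f, g, hf, hg, h⟩ := hPQ
  obtain ⟨f', g', hf', hg', h'⟩ := hQR
  refine ⟨fun x => f' (f x), fun t => g (t.1, f t.1, g' (f t.1, t.2.1, t.2.2)), hf.comp hf', ?_,
    fun x hx => ⟨(h' _ (h x hx).1).1, fun y hy => (h x hx).2 _ ((h' _ (h x hx).1).2 y hy)⟩⟩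
  obtain ⟨M, hM⟩ := polyTime_iff_exists_computes.1 hf
  obtain ⟨N, hN⟩ := polyTime_iff_exists_computes.1 hg
  obtain ⟨N', hN'⟩ := polyTime_iff_exists_computes.1 hg'
  let T : Fin 3 → FinTM2 := ![M, N, N']
  have hf : Computes (T 0) id id f := hM
  have hg : Computes (T 1) encTriple id g := hN
  have hg' : Computes (T 2) encTriple id g' := hN'
  refine Emits.polyTime (T := T) _ id leftInverse_getD_some ?_
  have hid : LeftInverse (id : Sym → Sym) id := fun _ => rfl
  have hfx : Emits T [fun t => (encTriple t).map id] fun t => (f t.1).map some :=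
    Emits.call hf (fun t : List Bool × List Bool × List Bool => t.1) leftInverse_getD_some some
      (Emits.fst (by simp))
  have hy : Emits T [fun t => (encTriple t).map id] fun t =>
      (g' (f t.1, t.2.1, t.2.2)).map some :=
    Emits.call hg' (fun t : List Bool × List Bool × List Bool => (f t.1, t.2.1, t.2.2)) hid some
      (Emits.encTriple hfx (Emits.snd (by simp)) (Emits.thd (by simp)))
  exact Emits.call hg (fun t : List Bool × List Bool × List Bool =>
    (t.1, f t.1, g' (f t.1, t.2.1, t.2.2))) hid some
    (Emits.encTriple (Emits.fst (by simp)) hfx hy)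

end SearchClasses

namespace SearchClasses

/-! ### Gates -/

theorem runGates_append (gs gs' : List Gate) (w : List Bool) :
    runGates (gs ++ gs') w = runGates gs' (runGates gs w) := by
  induction gs generalizing w with
  | nil => rfl
  | cons g gs ih => exact ih _

theorem exists_runGates_eq (gs : List Gate) (w : List Bool) :
    ∃ l, l.length = gs.length ∧ runGates gs w = l ++ w := by
  induction gs generalizing w with
  | nil => exact ⟨[], rfl, rfl⟩
  | cons g gs ih =>
    obtain ⟨l, hl, h⟩ := ih (g.eval w :: w)
    exact ⟨l ++ [g.eval w], by simp [hl], by simp [runGates, h]⟩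

theorem getD_append_add (l l' : List Bool) {k : ℕ} (h : l.length = k) (i : ℕ) :
    (l ++ l').getD (k + i) false = l'.getD i false := by
  rw [List.getD_append_right _ _ _ _ (by omega)]
  congr 1
  omega

theorem getD_runGates (gs : List Gate) (w : List Bool) (i : ℕ) :
    (runGates gs w).getD (gs.length + i) false = w.getD i false := by
  obtain ⟨l, hl, h⟩ := exists_runGates_eq gs w
  rw [h, getD_append_add l w hl]

theorem Gate.InRange.mono {k k' : ℕ} {g : Gate} (h : g.InRange k) (hk : k ≤ k') :
    g.InRange k' := by
  cases g <;> simp only [Gate.InRange] at h ⊢ <;> omega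

theorem WellFormed.mono {k k' : ℕ} {gs : List Gate} (h : WellFormed k gs) (hk : k ≤ k') :
    WellFormed k' gs := by
  induction gs generalizing k k' with
  | nil => trivial
  | cons g gs ih => exact ⟨h.1.mono hk, ih h.2 (by omega)⟩

theorem wellFormed_append {k : ℕ} {gs gs' : List Gate} :
    WellFormed k (gs ++ gs') ↔ WellFormed k gs ∧ WellFormed (k + gs.length) gs' := by
  induction gs generalizing k with
  | nil => simp [WellFormed]
  | cons g gs ih =>
    simp only [List.cons_append, WellFormed, ih, List.length_cons, and_assoc]
    rw [show k + 1 + gs.length = k + (gs.length + 1) by omega]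

theorem Gate.eval_append {g : Gate} {x : List Bool} (h : g.InRange x.length) (r : List Bool) :
    g.eval (x ++ r) = g.eval x := by
  cases g with
  | and i j => simp only [Gate.eval, List.getD_append _ _ _ _ h.1, List.getD_append _ _ _ _ h.2]
  | or i j => simp only [Gate.eval, List.getD_append _ _ _ _ h.1, List.getD_append _ _ _ _ h.2]
  | not i => simp only [Gate.eval, List.getD_append _ _ _ _ h]

/-- Gates that are well-formed on the first wires do not see the other ones. -/
theorem runGates_append_right {gs : List Gate} {x : List Bool} (h : WellFormed x.length gs)
    (r : List Bool) : runGates gs (x ++ r) = runGates gs x ++ r := by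
  induction gs generalizing x with
  | nil => rfl
  | cons g gs ih =>
    rw [runGates, runGates, Gate.eval_append h.1, ← List.cons_append,
      ih (x := g.eval x :: x) h.2]

/-- A copy of a wire. -/
def Gate.copy (i : ℕ) : Gate := .and i i

theorem Gate.eval_copy (i : ℕ) (w : List Bool) : (Gate.copy i).eval w = w.getD i false := by
  simp [Gate.copy, Gate.eval]

/-- Each new wire shifts all positions by one, so a constant argument reads wires ever closer to the
front. Repeating one gate thus copies a block in its order. -/
theorem runGates_replicate_copy (a m : ℕ) (w : List Bool) (h : a + m ≤ w.length) :
    runGates (List.replicate m (Gate.copy (a + m - 1))) w = (w.drop a).take m ++ w := by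
  induction m generalizing a w with
  | zero => rfl
  | succ m ih =>
    have h1 := ih (a + 1) (w.getD (a + m) false :: w) (by simp; omega)
    rw [List.replicate_succ, runGates, Gate.eval_copy]
    rw [show a + (m + 1) - 1 = a + m by omega]
    rw [show a + 1 + m - 1 = a + m by omega] at h1
    rw [h1, List.drop_succ_cons, List.take_add_one, List.append_assoc]
    rw [List.getElem?_drop, List.getElem?_eq_getElem (by omega),
      List.getD_eq_getElem _ _ (by omega)]
    rfl

theorem wellFormed_replicate_copy (i m k : ℕ) (h : i < k) :
    WellFormed k (List.replicate m (Gate.copy i)) := by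
  induction m generalizing k with
  | zero => trivial
  | succ m ih => exact ⟨⟨h, h⟩, ih _ (by omega)⟩

/-- Copy the wires with the given indices, one after the other, after `p` other copies. -/
def copyGates : ℕ → List ℕ → List Gate
  | _, [] => []
  | p, i :: is => Gate.copy (p + i) :: copyGates (p + 1) is

theorem length_copyGates (p : ℕ) (is : List ℕ) : (copyGates p is).length = is.length := by
  induction is generalizing p with
  | nil => rfl
  | cons i is ih => simp [copyGates, ih]

theorem copyGates_append (p : ℕ) (is is' : List ℕ) :
    copyGates p (is ++ is') = copyGates p is ++ copyGates (p + is.length) is' := by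
  induction is generalizing p with
  | nil => rfl
  | cons i is ih =>
    simp only [List.cons_append, copyGates, ih, List.length_cons]
    rw [show p + 1 + is.length = p + (is.length + 1) by omega]

/-- Each copy lands in front of the previous ones, hence the reversal; `l` stands for the copies
already made. -/
theorem runGates_copyGates (is : List ℕ) (l w : List Bool) :
    runGates (copyGates l.length is) (l ++ w) =
      (is.map fun i => w.getD i false).reverse ++ (l ++ w) := by
  induction is generalizing l with
  | nil => rfl
  | cons i is ih =>
    have := ih (w.getD i false :: l)
    rw [copyGates, runGates, Gate.eval_copy, getD_append_add _ _ rfl]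
    simpa using this

theorem wellFormed_copyGates {k p : ℕ} {is : List ℕ} (h : ∀ i ∈ is, i < k) :
    WellFormed (p + k) (copyGates p is) := by
  induction is generalizing p with
  | nil => trivial
  | cons i is ih =>
    have hi := h i (by simp)
    refine ⟨⟨by omega, by omega⟩, ?_⟩
    have := ih (p := p + 1) (fun i hi => h i (by simp [hi]))
    rwa [show p + 1 + k = p + k + 1 by omega] at this

/-! ### Gates for arbitrary Boolean functions -/

/-- Shannon expansion on the first of the `r` bits. The offset `d` skips wires in front of the
arguments, which is needed to apply the induction hypothesis on top of earlier gates. -/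
theorem exists_gates_bool (h : List Bool → Bool) (d r : ℕ) :
    ∃ gs : List Gate, (∀ k, d + r ≤ k → 1 ≤ k → WellFormed k gs) ∧
      ∀ w : List Bool, d + r ≤ w.length → 1 ≤ w.length →
        (runGates gs w).getD 0 false = h ((w.drop d).take r) := by
  induction r generalizing d h with
  | zero =>
    cases hb : h [] with
    | true =>
      -- Constants are obtained as x ∨ ¬x and x ∧ ¬x, which is why at least one wire is required.
      refine ⟨[.not 0, .or 0 1], fun k _ hk => ?_, fun w _ hw => ?_⟩
      · simp only [WellFormed, Gate.InRange, and_true]; omega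
      · cases hx : w.getD 0 false <;> simp [runGates, Gate.eval, hb, hx, List.getD_cons_zero,
          List.getD_cons_succ, -List.getD_eq_getElem?_getD]
    | false =>
      refine ⟨[.not 0, .and 0 1], fun k _ hk => ?_, fun w _ hw => ?_⟩
      · simp only [WellFormed, Gate.InRange, and_true]; omega
      · cases hx : w.getD 0 false <;> simp [runGates, Gate.eval, hb, hx, List.getD_cons_zero,
          List.getD_cons_succ, -List.getD_eq_getElem?_getD]
  | succ r ih =>
    obtain ⟨g₀, wf₀, h₀⟩ := ih (fun l => h (false :: l)) (d + 1)
    obtain ⟨g₁, wf₁, h₁⟩ := ih (fun l => h (true :: l)) (d + 1 + g₀.length)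
    -- The last four gates compute x ∧ h₁, ¬x, ¬x ∧ h₀ and their disjunction, where x is the
    -- selecting bit and h₀, h₁ are the two restrictions; the increments 1 and 2 in the arguments
    -- count the gates just added.
    refine ⟨g₀ ++ (g₁ ++ [.and 0 (g₁.length + (g₀.length + d)),
        .not (g₁.length + (g₀.length + d) + 1),
      .and 0 (g₁.length + 2), .or 0 2]), fun k hk hk' => ?_, fun w hw hw' => ?_⟩
    · refine wellFormed_append.2 ⟨wf₀ k (by omega) hk', wellFormed_append.2
        ⟨wf₁ _ (by omega) (by omega), ?_⟩⟩
      simp only [WellFormed, Gate.InRange, and_true]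
      omega
    · have e₀ := h₀ w (by omega) hw'
      have e₁ := h₁ (runGates g₀ w) (by rw [length_runGates]; omega)
        (by rw [length_runGates]; omega)
      obtain ⟨l₀, hl₀, hr₀⟩ := exists_runGates_eq g₀ w
      have e₂ : (runGates g₀ w).drop (d + 1 + g₀.length) = w.drop (d + 1) := by
        rw [hr₀, ← hl₀, Nat.add_comm, List.drop_append]
        simp
      rw [e₂] at e₁
      set w₁ := runGates g₀ w with hw₁
      set w₂ := runGates g₁ w₁ with hw₂
      have f₀ : w₂.getD g₁.length false = h (false :: (w.drop (d + 1)).take r) := by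
        rw [← e₀, hw₂, ← getD_runGates g₁ w₁ 0, Nat.add_zero]
      have f₂ : w₂.getD (g₁.length + (g₀.length + d)) false = w.getD d false := by
        rw [hw₂, getD_runGates, hw₁, getD_runGates]
      have f₃ : (w.drop d).take (r + 1) = w.getD d false :: (w.drop (d + 1)).take r := by
        rw [List.drop_eq_getElem_cons (by omega), List.take_succ_cons,
          List.getD_eq_getElem _ _ (by omega)]
      rw [runGates_append, runGates_append, ← hw₁, ← hw₂, f₃]
      simp only [runGates, Gate.eval, List.getD_cons_zero, List.getD_cons_succ, e₁, f₀, f₂]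
      cases w.getD d false <;> simp

theorem exists_gates (hs : List (List Bool → Bool)) (d r : ℕ) :
    ∃ gs : List Gate, (∀ k, d + r ≤ k → 1 ≤ k → WellFormed k gs) ∧
      ∀ w : List Bool, d + r ≤ w.length → 1 ≤ w.length →
        (runGates gs w).take hs.length = hs.map fun h => h ((w.drop d).take r) := by
  induction hs with
  | nil => exact ⟨[], fun _ _ _ => trivial, fun _ _ _ => rfl⟩
  | cons h hs ih =>
    obtain ⟨g, wf, hg⟩ := ih
    obtain ⟨g', wf', hg'⟩ := exists_gates_bool h (d + g.length) r
    -- That enough wires carry the earlier outputs is read off from a single evaluation, at an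
    -- all-false word.
    have hlen : hs.length ≤ max (d + r) 1 + g.length := by
      have := congrArg List.length
        (hg (List.replicate (max (d + r) 1) false) (by simp) (by simp))
      simp only [List.length_take, List.length_map, length_runGates, List.length_replicate] at this
      omega
    -- After the new value is computed, the earlier outputs are copied in front of it and then the
    -- new value in front of these, so that all outputs are contiguous.
    refine ⟨g ++ (g' ++ (List.replicate hs.length (Gate.copy (g'.length + hs.length - 1)) ++
      [Gate.copy hs.length])), fun k hk hk' => ?_, fun w hw hw' => ?_⟩
    · refine wellFormed_append.2 ⟨wf k hk hk', wellFormed_append.2 ⟨wf' _ (by omega) (by omega),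
        wellFormed_append.2 ⟨wellFormed_replicate_copy _ _ _ (by omega), ?_⟩⟩⟩
      simp only [WellFormed, Gate.copy, Gate.InRange, and_true, List.length_replicate]
      omega
    · obtain ⟨l, hl, hr⟩ := exists_runGates_eq g w
      have e := hg w hw hw'
      have e' := hg' (runGates g w) (by rw [length_runGates]; omega)
        (by rw [length_runGates]; omega)
      have e₂ : (runGates g w).drop (d + g.length) = w.drop d := by
        rw [hr, ← hl, Nat.add_comm, List.drop_append]
        simp
      rw [e₂] at e'
      obtain ⟨l', hl', hr'⟩ := exists_runGates_eq g' (runGates g w)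
      have e₃ : (runGates g' (runGates g w)).drop g'.length = runGates g w := by
        rw [hr', ← hl', List.drop_left]
      rw [runGates_append, runGates_append, runGates_append, runGates_replicate_copy _ _ _
        (by simp only [length_runGates]; omega), e₃, e, runGates, runGates, Gate.eval_copy,
        List.getD_append_right _ _ _ _ (by simp), List.length_map, Nat.sub_self, e',
        List.length_cons, List.take_succ_cons, List.take_append_of_le_length (by simp),
        List.take_of_length_le (i := hs.length) (by simp), List.map_cons]

end SearchClasses

namespace SearchClasses

/-! ### Circuit building blocks -/

/-- Gates for the function `F` from `r` bits to `m` bits. -/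
noncomputable def boolGates (F : List Bool → List Bool) (r m : ℕ) : List Gate :=
  (exists_gates ((List.range m).map fun j l => (F l).getD j false) 0 r).choose

theorem wellFormed_boolGates (F : List Bool → List Bool) (r m : ℕ) {k : ℕ} (hr : r ≤ k)
    (hk : 1 ≤ k) : WellFormed k (boolGates F r m) :=
  (exists_gates ((List.range m).map fun j l => (F l).getD j false) 0 r).choose_spec.1 k
    (by omega) hk

theorem map_range_getD (l : List Bool) :
    (List.range l.length).map (fun j => l.getD j false) = l := by
  refine List.ext_getElem (by simp) fun i h1 h2 => ?_
  simp [List.getElem?_eq_getElem h2]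

theorem take_runGates_boolGates (F : List Bool → List Bool) (r m : ℕ) {w : List Bool}
    (hr : r ≤ w.length) (hw : 1 ≤ w.length) (hF : (F (w.take r)).length = m) :
    (runGates (boolGates F r m) w).take m = F (w.take r) := by
  have : (runGates (boolGates F r m) w).take _ = _ :=
    (exists_gates ((List.range m).map fun j l => (F l).getD j false) 0 r).choose_spec.2 w
      (by omega) hw
  simp only [List.length_map, List.length_range, List.map_map, Function.comp_def,
    List.drop_zero] at this
  rw [this, ← hF, map_range_getD]

/-- Gates for `F`, applied to the wires with the indices `is`. -/
noncomputable def chunk (is : List ℕ) (F : List Bool → List Bool) (m : ℕ) : List Gate :=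
  copyGates 0 is.reverse ++ boolGates F is.length m

theorem length_chunk (is : List ℕ) (F : List Bool → List Bool) (m : ℕ) :
    (chunk is F m).length = is.length + (boolGates F is.length m).length := by
  simp [chunk, length_copyGates]

theorem wellFormed_chunk {is : List ℕ} (F : List Bool → List Bool) (m : ℕ) {k : ℕ} (hk : 1 ≤ k)
    (h : ∀ i ∈ is, i < k) : WellFormed k (chunk is F m) := by
  refine wellFormed_append.2 ⟨?_, wellFormed_boolGates _ _ _ ?_ (by omega)⟩
  · have := wellFormed_copyGates (k := k) (p := 0) (is := is.reverse) (by simpa using h)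
    rwa [Nat.zero_add] at this
  · simp [length_copyGates]

/-- Copying reverses, so the reversed index list in `chunk` presents the arguments to the gadget in
the intended order. -/
theorem take_runGates_chunk {is : List ℕ} {F : List Bool → List Bool} {m : ℕ} {w : List Bool}
    (hw : 1 ≤ w.length) (hF : (F (is.map fun i => w.getD i false)).length = m) :
    (runGates (chunk is F m) w).take m = F (is.map fun i => w.getD i false) := by
  have h := runGates_copyGates is.reverse [] w
  simp only [List.length_nil, List.nil_append, List.map_reverse, List.reverse_reverse] at h
  rw [chunk, runGates_append, h]
  have h2 : ((is.map fun i => w.getD i false) ++ w).take is.length =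
      is.map fun i => w.getD i false := List.take_left' (by simp)
  rw [take_runGates_boolGates _ _ _ (by simp) (by simp; omega) (by rw [h2, hF]), h2]

theorem getD_take {l : List Bool} {m j : ℕ} (h : j < m) :
    (l.take m).getD j false = l.getD j false := by
  simp [List.getElem?_take_of_lt h]

/-- `n` blocks of gates. -/
def loopGates (n : ℕ) (body : ℕ → List Gate) : List Gate := (List.range n).flatMap body

theorem loopGates_succ (n : ℕ) (body : ℕ → List Gate) :
    loopGates (n + 1) body = loopGates n body ++ body n := by
  simp [loopGates, List.range_succ]

theorem length_loopGates {n s : ℕ} {body : ℕ → List Gate} (h : ∀ t < n, (body t).length = s) :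
    (loopGates n body).length = s * n := by
  induction n with
  | zero => rfl
  | succ n ih =>
    rw [loopGates_succ, List.length_append, ih fun t ht => h t (by omega), h n (by omega),
      Nat.mul_succ]

theorem wellFormed_loopGates {n s k : ℕ} {body : ℕ → List Gate}
    (h : ∀ t < n, (body t).length = s) (hwf : ∀ t < n, WellFormed (k + s * t) (body t)) :
    WellFormed k (loopGates n body) := by
  induction n with
  | zero => trivial
  | succ n ih =>
    rw [loopGates_succ]
    refine wellFormed_append.2 ⟨ih (fun t ht => h t (by omega)) fun t ht => hwf t (by omega), ?_⟩
    rw [length_loopGates fun t ht => h t (by omega)]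
    exact hwf n (by omega)

theorem getD_runGates' {gs : List Gate} {s : ℕ} (h : gs.length = s) (w : List Bool) (i : ℕ) :
    (runGates gs w).getD (s + i) false = w.getD i false := by
  subst h
  exact getD_runGates gs w i

/-- A loop of chunks, each one updating the `a` foremost wires. -/
theorem take_runGates_foldLoop {F : List Bool → List Bool} {a n s : ℕ} {js : ℕ → List ℕ}
    (hs : ∀ t < n, (chunk (List.range a ++ (js t).map (s * t + ·)) F a).length = s)
    (hF : ∀ l, (F l).length = a) {w : List Bool} (hw : 1 ≤ w.length) (ha : a ≤ w.length) :
    (runGates (loopGates n fun t => chunk (List.range a ++ (js t).map (s * t + ·)) F a) w).take a =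
      (List.range n).foldl (fun acc t => F (acc ++ (js t).map fun i => w.getD i false))
        (w.take a) := by
  induction n with
  | zero => rfl
  | succ n ih =>
    have hs' : ∀ t < n, (chunk (List.range a ++ (js t).map (s * t + ·)) F a).length = s :=
      fun t ht => hs t (by omega)
    specialize ih hs'
    have hlen := length_loopGates hs'
    rw [loopGates_succ, runGates_append, take_runGates_chunk (by rw [length_runGates]; omega)
      (hF _), List.range_succ, List.foldl_append, List.foldl_cons, List.foldl_nil, ← ih,
      List.map_append, List.map_map]
    congr 2
    · refine List.ext_getElem (by simp [length_runGates]; omega) fun i h1 h2 => ?_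
      simp only [List.length_map, List.length_range] at h1
      rw [List.getElem_map, List.getElem_range, List.getElem_take,
        List.getD_eq_getElem _ _ (by rw [length_runGates]; omega)]
    · refine List.map_congr_left fun i _ => ?_
      exact getD_runGates' hlen w i

/-- A loop of chunks which depend on the wires before the loop. -/
theorem getD_runGates_mapLoop {F : List Bool → List Bool} {m n s : ℕ} {js : ℕ → List ℕ}
    (hs : ∀ t < n, (chunk ((js t).map (s * t + ·)) F m).length = s)
    (hF : ∀ l, (F l).length = m) {w : List Bool} (hw : 1 ≤ w.length) {t j : ℕ} (ht : t < n)
    (hj : j < m) :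
    (runGates (loopGates n fun t => chunk ((js t).map (s * t + ·)) F m) w).getD
      (s * (n - 1 - t) + j) false = (F ((js t).map fun i => w.getD i false)).getD j false := by
  induction n with
  | zero => omega
  | succ n ih =>
    have hs' : ∀ t < n, (chunk ((js t).map (s * t + ·)) F m).length = s :=
      fun t ht => hs t (by omega)
    have hlen := length_loopGates hs'
    rw [loopGates_succ, runGates_append]
    rcases Nat.lt_succ_iff_lt_or_eq.1 ht with h | rfl
    -- One further round pushes the earlier results down by exactly `s` wires.
    · rw [show s * (n + 1 - 1 - t) + j = s + (s * (n - 1 - t) + j) by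
        rw [show n + 1 - 1 - t = (n - 1 - t) + 1 by omega, Nat.mul_succ]; omega,
        getD_runGates' (hs n (by omega)), ih hs' h]
    · rw [show s * (t + 1 - 1 - t) + j = j by simp, ← getD_take hj,
        take_runGates_chunk (by rw [length_runGates]; omega) (hF _), List.map_map]
      congr 2
      exact List.map_congr_left fun i _ => getD_runGates' hlen w i

/-- The gates which put together the blocks of length `b` that start at the indices
`e + s * t`. -/
def gatherGates (n b e s : ℕ) : List Gate :=
  loopGates n fun t => List.replicate b (Gate.copy (e + s * t + b * t + b - 1))

theorem length_gatherGates (n b e s : ℕ) : (gatherGates n b e s).length = b * n :=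
  length_loopGates fun _ _ => List.length_replicate

/-- The summand `b * t` in the gate arguments compensates for the `t` blocks copied before. The last
block copied is in front, hence the reversed range. -/
theorem runGates_gatherGates {n b e s : ℕ} {w : List Bool}
    (h : ∀ t < n, e + s * t + b ≤ w.length) :
    runGates (gatherGates n b e s) w =
      ((List.range n).reverse.flatMap fun t => (w.drop (e + s * t)).take b) ++ w := by
  induction n with
  | zero => rfl
  | succ n ih =>
    specialize ih fun t ht => h t (by omega)
    have h1 := h n (by omega)
    have hlen := congrArg List.length ih
    rw [gatherGates] at ih hlen
    rw [length_runGates, length_loopGates fun _ _ => List.length_replicate, List.length_append]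
      at hlen
    have key : runGates (List.replicate b (Gate.copy (e + s * n + b * n + b - 1)))
        (((List.range n).reverse.flatMap fun t => (w.drop (e + s * t)).take b) ++ w) =
        (w.drop (e + s * n)).take b ++
          (((List.range n).reverse.flatMap fun t => (w.drop (e + s * t)).take b) ++ w) := by
      rw [runGates_replicate_copy _ _ _ (by rw [List.length_append]; omega)]
      congr 2
      rw [show e + s * n + b * n = ((List.range n).reverse.flatMap fun t =>
        (w.drop (e + s * t)).take b).length + (e + s * n) by omega, ← List.drop_drop,
        List.drop_left]
    rw [gatherGates, loopGates_succ, runGates_append, ih, key, List.range_succ,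
      List.reverse_append, List.reverse_singleton, List.singleton_append, List.flatMap_cons,
      List.append_assoc]

theorem wellFormed_gatherGates {n b e s k : ℕ} (hb : 1 ≤ b) (h : ∀ t < n, e + s * t + b ≤ k) :
    WellFormed k (gatherGates n b e s) :=
  wellFormed_loopGates (fun _ _ => List.length_replicate) fun t ht =>
    wellFormed_replicate_copy _ _ _ (by have := h t ht; omega)

end SearchClasses

namespace SearchClasses

/-! ### The circuit of the reduction -/

section walk

variable (b n : ℕ) (CG : List Gate)

/-- Evaluate the circuit `CG` at the vertex `v` read from the input, at its candidate predecessor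
and at its candidate successor. -/
def walkGates : List Gate :=
  copyGates 0 ((List.range n).map fun t => b + b * t) ++ (copyGates 0 (List.range n) ++ (CG ++
    (List.replicate n (Gate.copy (n - 1)) ++ (CG ++
      (List.replicate n (Gate.copy (CG.length + 3 * n - 1)) ++ CG)))))

theorem length_walkGates : (walkGates b n CG).length = 3 * (CG.length + n) + n := by
  simp [walkGates, length_copyGates]
  ring

variable {b n CG}

theorem wellFormed_walkGates (hb : 1 ≤ b) (hwf : WellFormed n CG) :
    WellFormed (b * (n + 1)) (walkGates b n CG) := by
  have h1 : 1 ≤ b * (n + 1) := Nat.mul_pos hb (by omega)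
  refine wellFormed_append.2 ⟨?_, wellFormed_append.2 ⟨?_, wellFormed_append.2 ⟨hwf.mono ?_,
    wellFormed_append.2 ⟨wellFormed_replicate_copy _ _ _ ?_, wellFormed_append.2 ⟨hwf.mono ?_,
    wellFormed_append.2 ⟨wellFormed_replicate_copy _ _ _ ?_, hwf.mono ?_⟩⟩⟩⟩⟩⟩
  · have := wellFormed_copyGates (k := b * (n + 1)) (p := 0)
      (is := (List.range n).map fun t => b + b * t) (fun i hi => by
        obtain ⟨t, ht, rfl⟩ := List.mem_map.1 hi
        have := Nat.mul_lt_mul_of_pos_left (List.mem_range.1 ht) hb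
        rw [Nat.mul_succ]
        omega)
    rwa [Nat.zero_add] at this
  · have := wellFormed_copyGates (k := b * (n + 1) + n) (p := 0)
      (is := List.range n) (fun i hi => by have := List.mem_range.1 hi; omega)
    rw [Nat.zero_add] at this
    exact this.mono (by simp [length_copyGates])
  all_goals simp only [length_copyGates, List.length_map, List.length_range, List.length_replicate]
  all_goals omega

/-- The given circuit refers only to its own inputs and gates, so running it on top of other wires
leaves its values unchanged. The final order of the wires is: the run at S(v), the run at P(v), the
run at v, the reversed v, the input. -/
theorem runGates_walkGates (hwf : WellFormed n CG) (hm : n + n ≤ n + CG.length) {inp v : List Bool}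
    (hv : v = (List.range n).map fun t => inp.getD (b + b * t) false) :
    runGates (walkGates b n CG) inp =
      runGates CG (((runGates CG v).drop n).take n) ++ (runGates CG ((runGates CG v).take n) ++
        (runGates CG v ++ (v.reverse ++ inp))) := by
  have hvl : v.length = n := by simp [hv]
  have h1 := runGates_copyGates ((List.range n).map fun t => b + b * t) [] inp
  simp only [List.length_nil, List.nil_append, List.map_map, Function.comp_def, ← hv] at h1
  -- A second copying pass undoes the reversal made by the first.
  have h2 := runGates_copyGates (List.range n) [] (v.reverse ++ inp)
  simp only [List.length_nil, List.nil_append] at h2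
  have h3 : ((List.range n).map fun i => (v.reverse ++ inp).getD i false) = v.reverse := by
    have := map_range_getD v.reverse
    rw [List.length_reverse, hvl] at this
    refine (List.map_congr_left fun i hi => ?_).trans this
    exact List.getD_append _ _ _ _ (by simpa [hvl] using hi)
  rw [h3, List.reverse_reverse] at h2
  have len : ∀ x : List Bool, x.length = n → (runGates CG x).length = n + CG.length :=
    fun x hx => by
    rw [length_runGates, hx]
  set O₁ := runGates CG v with hO₁
  have l₁ : O₁.length = n + CG.length := len v hvl
  set P := O₁.take n with hP
  have lP : P.length = n := by simp [hP, l₁]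
  set O₂ := runGates CG P with hO₂
  have l₂ : O₂.length = n + CG.length := len P lP
  set S := (O₁.drop n).take n with hS
  have lS : S.length = n := by simp [hS, l₁]; omega
  have h4 : runGates CG (v ++ (v.reverse ++ inp)) = O₁ ++ (v.reverse ++ inp) :=
    runGates_append_right (by rwa [hvl]) _
  have h5 : runGates (List.replicate n (Gate.copy (n - 1))) (O₁ ++ (v.reverse ++ inp)) =
      P ++ (O₁ ++ (v.reverse ++ inp)) := by
    have := runGates_replicate_copy 0 n (O₁ ++ (v.reverse ++ inp)) (by simp [l₁]; omega)
    rwa [Nat.zero_add, List.drop_zero, List.take_append_of_le_length (by omega)] at this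
  have h6 : runGates CG (P ++ (O₁ ++ (v.reverse ++ inp))) =
      O₂ ++ (O₁ ++ (v.reverse ++ inp)) := runGates_append_right (by rwa [lP]) _
  have h7 : runGates (List.replicate n (Gate.copy (CG.length + 3 * n - 1)))
      (O₂ ++ (O₁ ++ (v.reverse ++ inp))) = S ++ (O₂ ++ (O₁ ++ (v.reverse ++ inp))) := by
    -- The candidate successor is the second block of `n` wires of the run at v, which lies below
    -- all of `O₂`.
    have := runGates_replicate_copy (O₂.length + n) n (O₂ ++ (O₁ ++ (v.reverse ++ inp)))
      (by simp [l₁, l₂]; omega)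
    rw [show O₂.length + n + n - 1 = CG.length + 3 * n - 1 by omega, ← List.drop_drop,
      List.drop_left, List.drop_append_of_le_length (by omega),
      List.take_append_of_le_length (by simp [l₁]; omega)] at this
    exact this
  have h8 : runGates CG (S ++ (O₂ ++ (O₁ ++ (v.reverse ++ inp)))) =
      runGates CG S ++ (O₂ ++ (O₁ ++ (v.reverse ++ inp))) :=
    runGates_append_right (by rwa [lS]) _
  simp only [walkGates, runGates_append, h1, h2, h4, h5, h6, h7, h8]

end walk

section assembly

variable (b n : ℕ) (CG : List Gate) (Ff Fm Fi : List Bool → List Bool)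

/-- The sizes of the parts of the circuit. -/
noncomputable def initSize : ℕ := (chunk [] (fun _ => [false, false, false]) 3).length

/-- The size of one round of the loop, independent of the round. The number 5 counts the three flags
and two single bits, and `b` is the length of a block; `muxSize` has one more block, the copy index.
-/
noncomputable def flagSize : ℕ := 5 + b + (boolGates Ff (5 + b) 3).length

noncomputable def muxSize : ℕ := 5 + b + b + (boolGates Fm (5 + b + b) b).length

noncomputable def incSize : ℕ := b + (boolGates Fi b b).length

/-- The wires of the bits of the `t`-th coordinate, below `e` other wires. -/
def coordIdx (g e t : ℕ) : List ℕ :=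
  (List.range b).map fun j => e + (3 * (g + n) + n) + b + b * t + j

/-- The wires of the bits of the copy index, below `e` other wires. -/
def copyIdx (g e : ℕ) : List ℕ :=
  (List.range b).map fun j => e + (3 * (g + n) + n) + j

/-- The wires compared in the `t`-th step of the computation of the flags. -/
noncomputable def flagIdx (g t : ℕ) : List ℕ :=
  (initSize + t) :: (initSize + (g + n) + n + t) :: coordIdx b n g initSize t

/-- The number of wires up to the computation of the flags. -/
noncomputable def flagEnd : ℕ := flagSize b Ff * n + initSize

/-- The wires which determine the `t`-th coordinate of the output. -/
noncomputable def muxIdx (g t : ℕ) : List ℕ :=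
  List.range 3 ++ ((flagEnd b n Ff + 2 * (g + n) + t) ::
    (flagEnd b n Ff + 2 * (g + n) + n + t) ::
      (coordIdx b n g (flagEnd b n Ff) t ++ copyIdx b n g (flagEnd b n Ff)))

/-- The gates that compute the output from the values of a circuit with `g` gates. -/
noncomputable def outputGates (g : ℕ) : List Gate :=
  chunk [] (fun _ => [false, false, false]) 3 ++
    (loopGates n (fun t =>
        chunk (List.range 3 ++ (flagIdx b n g t).map (flagSize b Ff * t + ·)) Ff 3) ++
      (loopGates n (fun t =>
          chunk ((muxIdx b n Ff g t).map (muxSize b Fm * t + ·)) Fm b) ++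
        (chunk (copyIdx b n g (muxSize b Fm * n + flagEnd b n Ff)) Fi b ++
          (gatherGates n b (incSize b Fi) (muxSize b Fm) ++
            List.replicate b (Gate.copy (b * n + b - 1))))))

/-- The gates of the circuit on `[q]ⁿ⁺¹`, given the gates of the circuit of the graph. -/
noncomputable def lonelyGates : List Gate :=
  walkGates b n CG ++ outputGates b n Ff Fm Fi CG.length

/-- The flags computed by the circuit. -/
def flags (PS SP : List Bool) (blk : ℕ → List Bool) : List Bool :=
  (List.range n).foldl (fun acc t => Ff (acc ++ (PS.getD t false :: SP.getD t false :: blk t)))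
    [false, false, false]

variable {b n CG Ff Fm Fi}

theorem length_flagChunk (t : ℕ) :
    (chunk (List.range 3 ++ (flagIdx b n CG.length t).map (flagSize b Ff * t + ·)) Ff 3).length =
      flagSize b Ff := by
  rw [length_chunk,
    show (List.range 3 ++ (flagIdx b n CG.length t).map (flagSize b Ff * t + ·)).length =
    5 + b by simp [flagIdx, coordIdx]; omega, flagSize]

theorem length_muxChunk (t : ℕ) :
    (chunk ((muxIdx b n Ff CG.length t).map (muxSize b Fm * t + ·)) Fm b).length =
      muxSize b Fm := by
  rw [length_chunk, show ((muxIdx b n Ff CG.length t).map (muxSize b Fm * t + ·)).length =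
    5 + b + b by simp [muxIdx, coordIdx, copyIdx]; omega, muxSize]

theorem length_incChunk (e : ℕ) : (chunk (copyIdx b n CG.length e) Fi b).length = incSize b Fi := by
  rw [length_chunk, show (copyIdx b n CG.length e).length = b by simp [copyIdx], incSize]

theorem mul_lt_mul_succ {t n j : ℕ} (ht : t < n) (hj : j < b) : b + b * t + j < b * (n + 1) := by
  have := Nat.mul_le_mul_left b (show t + 2 ≤ n + 1 by omega)
  rw [Nat.mul_add] at this
  omega

theorem wellFormed_lonelyGates (hb : 1 ≤ b) (hwf : WellFormed n CG) :
    WellFormed (b * (n + 1)) (lonelyGates b n CG Ff Fm Fi) := by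
  have hb' : b * (n + 1) = b * n + b := by ring
  have hpos : 1 ≤ b * (n + 1) := by omega
  -- Three constant wires on top of a single one need at least two gates; this makes the flag
  -- positions 0, 1, 2 legal arguments.
  have hinit : 2 ≤ initSize := by
    have := congrArg List.length (take_runGates_chunk (is := []) (w := [false])
      (F := fun _ => [false, false, false]) (m := 3) (by simp) rfl)
    simp only [List.length_take, length_runGates, List.length_cons, List.length_nil] at this
    rw [initSize]
    omega
  have hlf := length_loopGates (n := n) fun t _ => length_flagChunk (b := b) (n := n) (CG := CG)
    (Ff := Ff) t
  have hlm := length_loopGates (n := n) fun t _ => length_muxChunk (b := b) (n := n) (CG := CG)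
    (Ff := Ff) (Fm := Fm) t
  have hcoord : ∀ e t, t < n → ∀ i ∈ coordIdx b n CG.length e t,
      i < b * (n + 1) + (3 * (CG.length + n) + n) + e := fun e t ht i hi => by
    obtain ⟨j, hj, rfl⟩ := List.mem_map.1 hi
    have := mul_lt_mul_succ ht (List.mem_range.1 hj)
    omega
  have hcopy : ∀ e, ∀ i ∈ copyIdx b n CG.length e,
      i < b * (n + 1) + (3 * (CG.length + n) + n) + e := fun e i hi => by
    obtain ⟨j, hj, rfl⟩ := List.mem_map.1 hi
    have := List.mem_range.1 hj
    omega
  refine wellFormed_append.2 ⟨wellFormed_walkGates hb hwf, ?_⟩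
  rw [length_walkGates]
  refine wellFormed_append.2 ⟨wellFormed_chunk _ _ (by omega) (by simp), ?_⟩
  rw [← initSize]
  refine wellFormed_append.2 ⟨wellFormed_loopGates (fun t _ => length_flagChunk t) fun t ht =>
    wellFormed_chunk _ _ (by omega) fun i hi => ?_, ?_⟩
  · simp only [List.mem_append, List.mem_range, List.mem_map, flagIdx, List.mem_cons] at hi
    rcases hi with hi | ⟨i, rfl | rfl | hi, rfl⟩
    · omega
    · omega
    · omega
    · have := hcoord _ t ht i hi
      omega
  rw [hlf]
  refine wellFormed_append.2 ⟨wellFormed_loopGates (fun t _ => length_muxChunk t) fun t ht =>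
    wellFormed_chunk _ _ (by omega) fun i hi => ?_, ?_⟩
  · simp only [List.mem_append, List.mem_range, List.mem_map, muxIdx, List.mem_cons] at hi
    rcases hi with ⟨i, hi | rfl | rfl | hi | hi, rfl⟩
    · omega
    · simp only [flagEnd]; omega
    · simp only [flagEnd]; omega
    · have := hcoord _ t ht i hi
      simp only [flagEnd] at this
      omega
    · have := hcopy _ i hi
      simp only [flagEnd] at this
      omega
  rw [hlm]
  refine wellFormed_append.2 ⟨wellFormed_chunk _ _ (by omega) fun i hi => ?_, ?_⟩
  · have := hcopy _ i hi
    simp only [flagEnd] at this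
    omega
  rw [length_incChunk]
  refine wellFormed_append.2 ⟨wellFormed_gatherGates hb fun t ht => ?_,
    wellFormed_replicate_copy _ _ _ ?_⟩
  · have := Nat.mul_le_mul_left (muxSize b Fm) ht.le
    omega
  · rw [length_gatherGates]
    omega

theorem take_drop_eq_of_getD {w l : List Bool} {k : ℕ} (hk : k + l.length ≤ w.length)
    (h : ∀ j < l.length, w.getD (k + j) false = l.getD j false) :
    (w.drop k).take l.length = l := by
  refine List.ext_getElem (by simp; omega) fun j h1 h2 => ?_
  have := h j h2
  rw [List.getD_eq_getElem _ _ (by omega), List.getD_eq_getElem _ _ h2] at this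
  simpa using this

theorem reverse_range (n : ℕ) : (List.range n).reverse = (List.range n).map fun t => n - 1 - t :=
  List.ext_getElem (by simp) fun i h1 h2 => by simp

/-- Each phase leaves all earlier wires readable at a known offset, so the proof tracks how the
offset of the wires `W` of the walk grows (`g0`, `g1`, `g2`) and what each phase puts in front. -/
theorem take_runGates_lonelyGates (hb : 1 ≤ b) (hwf : WellFormed n CG) (hm : n + n ≤ n + CG.length)
    (hFf : ∀ l, (Ff l).length = 3) (hFm : ∀ l, (Fm l).length = b) (hFi : ∀ l, (Fi l).length = b)
    {inp v c : List Bool} {blk : ℕ → List Bool} (hinp : inp.length = b * (n + 1))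
    (hv : v = (List.range n).map fun t => inp.getD (b + b * t) false)
    (hc : c = (List.range b).map fun j => inp.getD j false)
    (hblk : ∀ t, blk t = (List.range b).map fun j => inp.getD (b + b * t + j) false)
    {P S PS SP : List Bool} (hP : P = (runGates CG v).take n)
    (hS : S = ((runGates CG v).drop n).take n) (hPS : PS = (runGates CG S).take n)
    (hSP : SP = ((runGates CG P).drop n).take n) :
    (runGates (lonelyGates b n CG Ff Fm Fi) inp).take (b * (n + 1)) =
      Fi c ++ (List.range n).flatMap fun t => Fm (flags n Ff PS SP blk ++
        (P.getD t false :: S.getD t false :: (blk t ++ c))) := by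
  set L := CG.length + n with hL
  have hcl : c.length = b := by simp [hc]
  have hwalk := runGates_walkGates hwf hm hv
  rw [← hP, ← hS] at hwalk
  have hvl : v.length = n := by simp [hv]
  have len : ∀ x : List Bool, x.length = n → (runGates CG x).length = L := fun x hx => by
    rw [length_runGates, hx, hL, Nat.add_comm]
  have hPl : P.length = n := by simp [hP, len v hvl]; omega
  have hSl : S.length = n := by
    have := len v hvl
    rw [hS, List.length_take, List.length_drop]
    omega
  have l₁ := len v hvl
  have l₂ := len P hPl
  have l₃ := len S hSl
  set W := runGates (walkGates b n CG) inp with hW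
  have hWl : W.length = b * (n + 1) + (3 * L + n) := by
    rw [hW, length_runGates, length_walkGates, hinp]
  have hpos : 1 ≤ b * (n + 1) := Nat.mul_pos hb n.succ_pos
  -- The runs are stacked with the latest first, each of length `L`: P(S(v)) starts at 0, S(P(v)) at
  -- `L + n`, P(v) at `2 * L`, S(v) at `2 * L + n`, and the input at `3 * L + n`.
  have W₁ : ∀ t < n, W.getD t false = PS.getD t false := fun t ht => by
    rw [hwalk, List.getD_append _ _ _ _ (by omega), hPS, getD_take ht]
  have W₂ : ∀ t < n, W.getD (L + n + t) false = SP.getD t false := fun t ht => by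
    rw [hwalk, Nat.add_assoc, getD_append_add _ _ l₃,
      List.getD_append _ _ _ _ (by omega), hSP, getD_take ht]
    simp
  have W₃ : ∀ t < n, W.getD (2 * L + t) false = P.getD t false := fun t ht => by
    rw [hwalk, show 2 * L + t = L + (L + t) by omega, getD_append_add _ _ l₃,
      getD_append_add _ _ l₂, List.getD_append _ _ _ _ (by omega), hP, getD_take ht]
  have W₄ : ∀ t < n, W.getD (2 * L + n + t) false = S.getD t false := fun t ht => by
    rw [hwalk, show 2 * L + n + t = L + (L + (n + t)) by omega, getD_append_add _ _ l₃,
      getD_append_add _ _ l₂, List.getD_append _ _ _ _ (by omega), hS, getD_take ht]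
    simp
  have W₅ : ∀ i, W.getD (3 * L + n + i) false = inp.getD i false := fun i => by
    rw [hwalk, show 3 * L + n + i = L + (L + (L + (n + i))) by omega, getD_append_add _ _ l₃,
      getD_append_add _ _ l₂, getD_append_add _ _ l₁, getD_append_add _ _ (by simpa using hvl)]
  set W0 := runGates (chunk [] (fun _ => [false, false, false]) 3) W with hW0
  have h0 : W0.take 3 = [false, false, false] := take_runGates_chunk (by omega) rfl
  have h0l : W0.length = W.length + initSize := length_runGates _ _
  have g0 : ∀ i, W0.getD (initSize + i) false = W.getD i false := getD_runGates' rfl W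
  set W1 := runGates (loopGates n (fun t =>
        chunk (List.range 3 ++ (flagIdx b n CG.length t).map (flagSize b Ff * t + ·)) Ff 3)) W0
    with hW1
  have hlf := length_loopGates (n := n) fun t _ => length_flagChunk (b := b) (n := n) (CG := CG)
    (Ff := Ff) t
  have hlm := length_loopGates (n := n) fun t _ => length_muxChunk (b := b) (n := n) (CG := CG)
    (Ff := Ff) (Fm := Fm) t
  have h3 : 3 ≤ W0.length := by
    have := congrArg List.length h0
    simp at this
    omega
  have h1l : W1.length = W0.length + flagSize b Ff * n := by rw [hW1, length_runGates, hlf]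
  have g1 : ∀ i, W1.getD (flagEnd b n Ff + i) false = W.getD i false := fun i => by
    rw [flagEnd, Nat.add_assoc, hW1, getD_runGates' hlf, g0]
  have h1 : W1.take 3 = flags n Ff PS SP blk := by
    rw [hW1, take_runGates_foldLoop (fun t _ => length_flagChunk t) hFf (by omega) h3, h0, flags]
    refine List.foldl_ext _ _ _ fun acc t ht => ?_
    have ht := List.mem_range.1 ht
    rw [flagIdx, List.map_cons, List.map_cons, g0, Nat.add_assoc, Nat.add_assoc, g0, W₁ t ht,
      ← Nat.add_assoc, W₂ t ht, hblk, coordIdx, List.map_map]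
    congr 4
    refine List.map_congr_left fun j _ => ?_
    rw [Function.comp_apply, ← W₅, ← g0]
    congr 1
    omega
  set W2 := runGates (loopGates n (fun t =>
          chunk ((muxIdx b n Ff CG.length t).map (muxSize b Fm * t + ·)) Fm b)) W1 with hW2
  have h2l : W2.length = W1.length + muxSize b Fm * n := by rw [hW2, length_runGates, hlm]
  have hcopy : ∀ (w : List Bool) (e : ℕ), (∀ i, w.getD (e + i) false = W.getD i false) →
      (copyIdx b n CG.length e).map (fun i => w.getD i false) = c := fun w e h => by
    rw [copyIdx, List.map_map, hc]
    refine List.map_congr_left fun j _ => ?_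
    rw [Function.comp_apply, ← W₅, ← h]
    congr 1
    omega
  set out : ℕ → List Bool := fun t => Fm (flags n Ff PS SP blk ++
        (P.getD t false :: S.getD t false :: (blk t ++ c))) with hout
  have h2 : ∀ t < n, ∀ j < b, W2.getD (muxSize b Fm * (n - 1 - t) + j) false =
      (out t).getD j false := fun t ht j hj => by
    rw [hW2, getD_runGates_mapLoop (fun t _ => length_muxChunk t) hFm (by omega) ht hj, hout]
    congr 2
    rw [muxIdx, List.map_append, List.map_cons, List.map_cons, List.map_append, hcopy W1 _ g1,
      Nat.add_assoc, g1, W₃ t ht, Nat.add_assoc, Nat.add_assoc, g1, ← Nat.add_assoc, W₄ t ht,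
      ← h1, hblk, coordIdx, List.map_map]
    have e3 := map_range_getD (W1.take 3)
    rw [List.length_take, min_eq_left (by omega)] at e3
    congr 1
    · rw [← e3]
      exact List.map_congr_left fun i hi => (getD_take (List.mem_range.1 hi)).symm
    · congr 3
      refine List.map_congr_left fun j _ => ?_
      rw [Function.comp_apply, ← W₅, ← g1]
      congr 1
      omega
  have g2 : ∀ i, W2.getD (muxSize b Fm * n + flagEnd b n Ff + i) false = W.getD i false :=
    fun i => by rw [Nat.add_assoc, hW2, getD_runGates' hlm, g1]
  set W3 := runGates (chunk (copyIdx b n CG.length (muxSize b Fm * n + flagEnd b n Ff)) Fi b) W2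
    with hW3
  have h3' : W3.take b = Fi c := by
    rw [hW3, take_runGates_chunk (by omega) (hFi _), hcopy W2 _ g2]
  have h3l : W3.length = W2.length + incSize b Fi := by
    rw [hW3, length_runGates, length_incChunk]
  -- The loop left coordinate t in block n - 1 - t, and gathering reverses the blocks, so the
  -- coordinates come out in order.
  have hgather : runGates (gatherGates n b (incSize b Fi) (muxSize b Fm)) W3 =
      (List.range n).flatMap out ++ W3 := by
    rw [runGates_gatherGates fun t ht => ?_, reverse_range, List.flatMap_map]
    · congr 1
      refine List.flatMap_congr fun t ht => ?_
      have ht := List.mem_range.1 ht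
      have hol : (out t).length = b := hFm _
      have hle := Nat.mul_le_mul_left (muxSize b Fm) (show n - 1 - t ≤ n by omega)
      have := take_drop_eq_of_getD (w := W3) (l := out t)
        (k := incSize b Fi + muxSize b Fm * (n - 1 - t)) (by rw [Nat.mul_succ] at hWl; omega)
        fun j hj => by
          rw [← h2 t ht j (by omega), Nat.add_assoc, hW3, getD_runGates' (length_incChunk _)]
      rwa [hol] at this
    · have hle := Nat.mul_le_mul_left (muxSize b Fm) ht.le
      rw [Nat.mul_succ] at hWl
      omega
  have hfl : ((List.range n).flatMap out).length = b * n := by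
    rw [List.length_flatMap, List.map_congr_left (g := fun _ => b) (fun t _ => hFm _)]
    simp [Nat.mul_comm]
  have hlast : runGates (List.replicate b (Gate.copy (b * n + b - 1)))
      ((List.range n).flatMap out ++ W3) = Fi c ++ ((List.range n).flatMap out ++ W3) := by
    rw [runGates_replicate_copy _ _ _ (by rw [List.length_append, hfl, Nat.mul_succ] at *; omega),
      ← hfl, List.drop_left, h3']
  rw [lonelyGates, outputGates]
  simp only [runGates_append, ← hW, ← hW0, ← hW1, ← hW2, ← hW3, hgather, hlast]
  rw [← List.append_assoc]
  exact List.take_left' (by rw [List.length_append, hFi, hfl, Nat.mul_succ, Nat.add_comm])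

end assembly

end SearchClasses

namespace SearchClasses

/-! ### The vertices that remain unmatched -/

section cycle

variable {k : ℕ} {V W : Type} {mk : Fin (k + 2) → W → V} {f : V → V} {p s : W → W}

/-- The map on `[q] × W` that sends `(c, w)` to `(c + 1, w)`, except that `w` is replaced by `p w`
if `c = 0` and by `s w` if `c = q - 1`. -/
def IsShift (mk : Fin (k + 2) → W → V) (f : V → V) (p s : W → W) : Prop :=
  ∀ c w, f (mk c w) = mk (c + 1) (if c = 0 then p w else if c = Fin.last (k + 1) then s w else w)

/-- The cycle is (0, w), (1, p w), ..., (q-1, p w); it closes because the last step applies `s`. -/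
theorem IsShift.exists_cycle (hf : IsShift mk f p s) (hmk : Function.Injective2 mk) {w : W}
    (h : s (p w) = w) : ∃ u : Fin (k + 2) → V, Function.Injective u ∧
      (∀ i, f (u i) = u (finRotate (k + 2) i)) ∧
      ∀ i, u i = mk i (if i = 0 then w else p w) := by
  refine ⟨fun i => mk i (if i = 0 then w else p w), fun i j hij => (hmk hij).1, fun i => ?_,
    fun i => rfl⟩
  rw [hf, finRotate_apply]
  congr 1
  by_cases h0 : i = 0
  · simp [h0]
  by_cases hl : i = Fin.last (k + 1)
  · simp [hl, h]
  · have : i + 1 ≠ 0 := fun e => hl (by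
      rw [← Fin.last_add_one] at e
      exact add_right_cancel e)
    simp [h0, hl, this]

/-- Follow (0, w) for q steps. By the form of the map this ends at (0, s (p w)); on a cycle of
length q it is a return to the start. -/
theorem IsShift.eq_of_cycle (hf : IsShift mk f p s) (hmk : Function.Injective2 mk)
    {u : Fin (k + 2) → V} (hu : ∀ i, f (u i) = u (finRotate (k + 2) i)) {w : W}
    (h : mk 0 w ∈ Set.range u) : s (p w) = w := by
  obtain ⟨i, hi⟩ := h
  -- Between the application of `p` at copy 0 and of `s` at the last copy, only the copy index
  -- changes.
  have h1 : ∀ m : ℕ, m ≤ k → f^[m + 1] (u i) = mk (Fin.ofNat (k + 2) (m + 1)) (p w) := by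
    intro m
    induction m with
    | zero =>
      intro _
      have : Fin.ofNat (k + 2) (0 + 1) = 0 + 1 := rfl
      rw [this, Function.iterate_one, hi, hf, if_pos rfl]
    | succ m ih =>
      intro hm
      rw [Function.iterate_succ_apply', ih (by omega), hf]
      have e1 : (Fin.ofNat (k + 2) (m + 1)).val = m + 1 := Nat.mod_eq_of_lt (by omega)
      have e2 : Fin.ofNat (k + 2) (m + 1) ≠ 0 := fun e => by
        have := congrArg Fin.val e
        rw [e1] at this
        simp at this
      have e3 : Fin.ofNat (k + 2) (m + 1) ≠ Fin.last (k + 1) := fun e => by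
        have := congrArg Fin.val e
        rw [e1] at this
        simp at this
        omega
      rw [if_neg e2, if_neg e3]
      congr 1
      refine Fin.ext ?_
      rw [Fin.val_add, e1]
      simp
  have h2 : ∀ m : ℕ, f^[m] (u i) = u (i + Fin.ofNat (k + 2) m) := by
    intro m
    induction m with
    | zero => simp
    | succ m ih =>
      rw [Function.iterate_succ_apply', ih, hu, finRotate_apply, add_assoc]
      congr 2
      refine Fin.ext ?_
      simp [Fin.val_add]
  have h3 := h2 (k + 1 + 1)
  have e : Fin.ofNat (k + 2) (k + 1) = Fin.last (k + 1) := Fin.ext (Nat.mod_eq_of_lt (by omega))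
  rw [Function.iterate_succ_apply', h1 k le_rfl, e, hf, Fin.last_add_one] at h3
  have e' : Fin.ofNat (k + 2) (k + 1 + 1) = 0 := Fin.ext (Nat.mod_self _)
  rw [e', add_zero, hi] at h3
  simpa [Fin.last_pos.ne'] using (hmk h3).2

end cycle

/-! ### Predecessors and successors on words that need not code a vertex. -/

section retain

variable {X W : Type} {P S : X → X} {dig : X → W} {low : W → X}

/-- The elements of `W` that do not code a vertex of the graph, and those that code an isolated
vertex. -/
def Retained (P S : X → X) (dig : X → W) (low : W → X) (w : W) : Prop :=
  dig (low w) ≠ w ∨ (P (S (low w)) ≠ low w ∧ S (P (low w)) ≠ low w)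

open Classical in
/-- The function `f` on the vertices of the graph, transferred to `W`. -/
noncomputable def follow (P S : X → X) (dig : X → W) (low : W → X) (f : X → X) (w : W) : W :=
  if Retained P S dig low w then w else dig (f (low w))

theorem retained_dig (hl : Function.LeftInverse low dig) {x : X} :
    Retained P S dig low (dig x) ↔ P (S x) ≠ x ∧ S (P x) ≠ x := by
  simp [Retained, hl x]

/-- Retained words are fixed by both maps and cannot violate the equation. So w codes some x that is
not retained, and S(P(x)) ≠ x leaves P(S(x)) = x as the only reason for this: x has an outgoing edge
and no incoming one. -/
theorem exists_of_follow_succ_pred_ne (hl : Function.LeftInverse low dig) {w : W}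
    (h : follow P S dig low S (follow P S dig low P w) ≠ w) :
    P (S (low w)) = low w ∧ S (low w) ≠ low w ∧ S (P (low w)) ≠ low w ∧ dig (low w) = w := by
  by_cases hw : Retained P S dig low w
  · simp [follow, hw] at h
  have h1 : follow P S dig low P w = dig (P (low w)) := if_neg hw
  have hd : dig (low w) = w := by_contra fun e => hw (Or.inl e)
  -- If S(P(x)) = x, then P(x) is not retained either, since P(S(P(x))) = P(x), and following S from
  -- it leads back to w.
  have hS : S (P (low w)) ≠ low w := fun e => by
    rw [h1, follow, if_neg, hl, e, hd] at h
    · exact h rfl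
    · rw [retained_dig hl]
      exact fun h => h.1 (by rw [e])
  have hP : P (S (low w)) = low w := by_contra fun e => hw (Or.inr ⟨e, hS⟩)
  exact ⟨hP, fun e => hS (by rw [e] at hP; rw [hP, e]), hS, hd⟩

/-- The notion of a retained word is symmetric in P and S, so this is the preceding statement for
the reversed graph. -/
theorem exists_of_follow_pred_succ_ne (hl : Function.LeftInverse low dig) {w : W}
    (h : follow P S dig low P (follow P S dig low S w) ≠ w) :
    S (P (low w)) = low w ∧ P (low w) ≠ low w ∧ P (S (low w)) ≠ low w ∧ dig (low w) = w := by
  have hr : ∀ w, Retained S P dig low w ↔ Retained P S dig low w := fun w => by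
    simp [Retained, and_comm]
  have hf : ∀ f w, follow S P dig low f w = follow P S dig low f w := fun f w => by
    by_cases hw : Retained P S dig low w <;> simp [follow, hr, hw]
  rw [← hf, ← hf] at h
  exact exists_of_follow_succ_pred_ne hl h

/-- `h3` is in-degree 0, with candidate loops allowed. If P(x) = x, then S moves x away; otherwise
P(x) ≠ x is either retained and stays put, or is followed by S to a vertex other than x. -/
theorem follow_succ_pred_source_ne (hl : Function.LeftInverse low dig) {x : X}
    (h1 : P (S x) = x) (h2 : S x ≠ x) (h3 : S (P x) = x → P x = x) :
    follow P S dig low S (follow P S dig low P (dig x)) ≠ dig x := by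
  have hr : ¬ Retained P S dig low (dig x) := fun h => ((retained_dig hl).1 h).1 h1
  have h4 : ∀ f, follow P S dig low f (dig x) = dig (f x) := fun f => by rw [follow, if_neg hr, hl]
  rw [h4]
  by_cases h5 : P x = x
  · rw [h5, h4]
    exact fun e => h2 (hl.injective e)
  · rw [follow]
    split_ifs with h
    · exact fun e => h5 (hl.injective e)
    · rw [hl]
      exact fun e => h5 (h3 (hl.injective e))

end retain

end SearchClasses

namespace SearchClasses

/-! ### The instance of Lonely -/

section blocks

variable {k : ℕ}

theorem one_le_clog (k : ℕ) : 1 ≤ Nat.clog 2 (k + 2) := Nat.clog_pos (by omega) (by omega)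

theorem length_block (a : Fin (k + 2)) : (block a).length = Nat.clog 2 (k + 2) := by simp [block]

/-- All bits from position ⌈log₂ q⌉ on vanish for numbers below q, so the block determines the
number. -/
theorem block_injective : Function.Injective (block (q := k + 2)) := fun a c h => by
  refine Fin.ext (Nat.eq_of_testBit_eq fun j => ?_)
  by_cases hj : j < Nat.clog 2 (k + 2)
  · have := congrArg (fun l => l.getD j false) h
    simpa [block, hj] using this
  · have hle : k + 2 ≤ 2 ^ j :=
      (Nat.le_pow_clog (by omega) _).trans (Nat.pow_le_pow_right (by omega) (by omega))
    rw [Nat.testBit_lt_two_pow (by omega), Nat.testBit_lt_two_pow (by omega)]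

/-- The lowest bit of an element of `[q]`. -/
def lowBit (a : Fin (k + 2)) : Bool := (a : ℕ).testBit 0

theorem getD_zero_block (a : Fin (k + 2)) : (block a).getD 0 false = lowBit a := by
  have : 0 < Nat.clog 2 (k + 2) := one_le_clog k
  simp [block, lowBit, this]

variable (k) in
/-- A bit as an element of `[q]`. -/
def bitDigit (x : Bool) : Fin (k + 2) := if x then 1 else 0

theorem lowBit_bitDigit (x : Bool) : lowBit (bitDigit k x) = x := by
  cases x
  · simp [lowBit, bitDigit]
  · simp [lowBit, bitDigit]

theorem length_flatMap_block (l : List (Fin (k + 2))) :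
    (l.flatMap block).length = l.length * Nat.clog 2 (k + 2) := by
  rw [List.length_flatMap, List.map_congr_left (g := fun _ => Nat.clog 2 (k + 2))
    (fun a _ => length_block a)]
  simp

theorem getD_flatMap_block (l : List (Fin (k + 2))) {i j : ℕ}
    (hj : j < Nat.clog 2 (k + 2)) :
    (l.flatMap block).getD (Nat.clog 2 (k + 2) * i + j) false =
      (block (l.getD i 0)).getD j false := by
  induction l generalizing i with
  | nil => simp [block, hj]
  | cons a l ih =>
    rw [List.flatMap_cons]
    cases i with
    | zero =>
      rw [Nat.mul_zero, Nat.zero_add, List.getD_append _ _ _ _ (by rwa [length_block]),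
        List.getD_cons_zero]
    | succ i =>
      rw [Nat.mul_succ, Nat.add_comm _ (Nat.clog _ _), Nat.add_assoc,
        getD_append_add _ _ (length_block a), List.getD_cons_succ]
      exact ih

theorem any_range_getD_ne {α : Type} [DecidableEq α] (d : α) {n : ℕ} {l l' : List α}
    (hl : l.length = n) (hl' : l'.length = n) :
    ((List.range n).any fun t => decide (l.getD t d ≠ l'.getD t d)) = decide (l ≠ l') := by
  rw [Bool.eq_iff_iff, List.any_eq_true, decide_eq_true_iff]
  constructor
  · rintro ⟨t, _, h⟩ rfl
    simp at h
  · intro h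
    by_contra! hc
    refine h (List.ext_getElem (by omega) fun t h1 h2 => ?_)
    have := hc t (List.mem_range.2 (by omega))
    rw [List.getD_eq_getElem _ _ h1, List.getD_eq_getElem _ _ h2] at this
    simpa using this

variable (k)

/-- One step of the computation of the flags: the flags, two bits to be compared with the bit
coded by a block, and that block. -/
def flagFun (l : List Bool) : List Bool :=
  [l.getD 0 false || decide (l.getD 3 false ≠ l.getD 5 false),
    l.getD 1 false || decide (l.getD 4 false ≠ l.getD 5 false),
    l.getD 2 false || decide (l.drop 5 ≠ block (bitDigit k (l.getD 5 false)))]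

/-- The output block: the arguments are the flags, the bits of the candidate predecessor and
successor, the input block and the block of the copy index. -/
def muxFun (l : List Bool) : List Bool :=
  let blk := (List.range (Nat.clog 2 (k + 2))).map fun j => l.getD (5 + j) false
  let c := l.drop (5 + Nat.clog 2 (k + 2))
  if (l.getD 2 false || (l.getD 0 false && l.getD 1 false)) = true then blk
  else if c = block (0 : Fin (k + 2)) then block (bitDigit k (l.getD 3 false))
  else if c = block (Fin.last (k + 1)) then block (bitDigit k (l.getD 4 false))
  else blk

/-- The block of the next copy index. -/
noncomputable def incFun (l : List Bool) : List Bool :=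
  block (Function.invFun (block (q := k + 2)) l + 1)

theorem length_muxFun (l : List Bool) : (muxFun k l).length = Nat.clog 2 (k + 2) := by
  unfold muxFun
  dsimp only
  split_ifs <;> simp only [List.length_map, List.length_range, length_block]

variable {k}

theorem incFun_block (c : Fin (k + 2)) : incFun k (block c) = block (c + 1) := by
  rw [incFun, Function.leftInverse_invFun block_injective]

/-- The fold accumulates disjunctions, so the flags say whether P(S(x)) or S(P(x)) differs from x
and whether the word has a digit other than 0 and 1, where x consists of the lowest bits of the
word. -/
theorem flags_eq {n : ℕ} (w : List (Fin (k + 2))) (PS SP : List Bool) :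
    flags n (flagFun k) PS SP (fun t => block (w.getD t 0)) =
      [(List.range n).any fun t => decide (PS.getD t false ≠ lowBit (w.getD t 0)),
        (List.range n).any fun t => decide (SP.getD t false ≠ lowBit (w.getD t 0)),
        (List.range n).any fun t => decide (w.getD t 0 ≠ bitDigit k (lowBit (w.getD t 0)))] := by
  unfold flags
  induction n with
  | zero => rfl
  | succ n ih =>
    rw [List.range_succ, List.foldl_append, ih]
    have h : ∀ x y z p s (a : Fin (k + 2)), flagFun k ([x, y, z] ++ (p :: s :: block a)) =
        [x || decide (p ≠ lowBit a), y || decide (s ≠ lowBit a),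
          z || decide (a ≠ bitDigit k (lowBit a))] := fun x y z p s a => by
      have := getD_zero_block a
      simp only [flagFun, List.cons_append, List.nil_append, List.drop_succ_cons, List.drop_zero,
        List.getD_cons_succ, List.getD_cons_zero, this, ne_eq, block_injective.eq_iff]
    simp only [List.foldl_cons, List.foldl_nil, h, List.any_append, List.any_cons, List.any_nil,
      Bool.or_false]

theorem muxFun_eq (x y z p s : Bool) (a c : Fin (k + 2)) :
    muxFun k ([x, y, z] ++ (p :: s :: (block a ++ block c))) =
      block (if z = true ∨ (x = true ∧ y = true) then a else if c = 0 then bitDigit k p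
        else if c = Fin.last (k + 1) then bitDigit k s else a) := by
  have h1 : ((List.range (Nat.clog 2 (k + 2))).map fun j =>
      ([x, y, z] ++ (p :: s :: (block a ++ block c))).getD (5 + j) false) = block a := by
    have := map_range_getD (block a)
    rw [length_block] at this
    refine (List.map_congr_left fun j hj => ?_).trans this
    rw [Nat.add_comm 5 j]
    exact List.getD_append (block a) (block c) false j (by simpa [length_block] using hj)
  have h2 : ([x, y, z] ++ (p :: s :: (block a ++ block c))).drop (5 + Nat.clog 2 (k + 2)) =
      block c := by
    rw [← List.drop_drop]
    exact List.drop_left' (length_block a)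
  simp only [muxFun, h1, h2, block_injective.eq_iff]
  simp only [List.cons_append, List.nil_append, List.getD_cons_succ, List.getD_cons_zero,
    Bool.or_eq_true, Bool.and_eq_true, apply_ite block]

end blocks

/-! ### Degrees in terms of the candidate neighbours, and the circuit as a shift. -/

section instances

variable {k : ℕ} (I : EOLData)

theorem EOLData.length_pred (v : List.Vector Bool I.n) : (I.pred v).length = I.n := by
  simp [EOLData.pred]

theorem EOLData.length_succ (v : List.Vector Bool I.n) : (I.succ v).length = I.n := by
  simp [EOLData.succ]

/-- The candidate predecessor as a vertex. -/
def EOLData.predV (v : List.Vector Bool I.n) : List.Vector Bool I.n := ⟨I.pred v, I.length_pred v⟩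

/-- The candidate successor as a vertex. -/
def EOLData.succV (v : List.Vector Bool I.n) : List.Vector Bool I.n := ⟨I.succ v, I.length_succ v⟩

theorem EOLData.toList_predV (v : List.Vector Bool I.n) :
    (I.predV v).toList = (runGates I.circuit.gates v.toList).take I.n := by
  simp [EOLData.predV, EOLData.pred, Circuit.eval, List.take_take]

theorem EOLData.toList_succV (v : List.Vector Bool I.n) :
    (I.succV v).toList = ((runGates I.circuit.gates v.toList).drop I.n).take I.n := by
  simp [EOLData.succV, EOLData.succ, Circuit.eval, List.drop_take]

theorem EOLData.edge_iff (u v : List.Vector Bool I.n) :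
    I.Edge u v ↔ u ≠ v ∧ I.succV u = v ∧ I.predV v = u := by
  exact and_congr_right fun _ => and_congr
    (⟨fun h => List.Vector.eq _ _ h, fun h => congrArg List.Vector.toList h⟩)
    (⟨fun h => List.Vector.eq _ _ h, fun h => congrArg List.Vector.toList h⟩)

/-- The only possible in-neighbour is the candidate predecessor, so the set of in-neighbours is
empty or a singleton. -/
theorem EOLData.inDeg_eq (v : List.Vector Bool I.n) :
    (I.inDeg v = 0 ∨ I.inDeg v = 1) ∧
      (I.inDeg v = 1 ↔ I.succV (I.predV v) = v ∧ I.predV v ≠ v) := by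
  have : {u | I.Edge u v} = {u | u = I.predV v ∧ I.succV (I.predV v) = v ∧ I.predV v ≠ v} := by
    ext u
    simp only [Set.mem_ofPred_eq, I.edge_iff]
    constructor
    · rintro ⟨h1, h2, rfl⟩
      exact ⟨rfl, h2, h1⟩
    · rintro ⟨rfl, h2, h3⟩
      exact ⟨h3, h2, rfl⟩
  rw [EOLData.inDeg, this]
  by_cases h : I.succV (I.predV v) = v ∧ I.predV v ≠ v <;> simp [h]

theorem EOLData.outDeg_eq (v : List.Vector Bool I.n) :
    (I.outDeg v = 0 ∨ I.outDeg v = 1) ∧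
      (I.outDeg v = 1 ↔ I.predV (I.succV v) = v ∧ I.succV v ≠ v) := by
  have : {u | I.Edge v u} = {u | u = I.succV v ∧ I.predV (I.succV v) = v ∧ I.succV v ≠ v} := by
    ext u
    simp only [Set.mem_ofPred_eq, I.edge_iff]
    constructor
    · rintro ⟨h1, rfl, h2⟩
      exact ⟨rfl, h2, h1.symm⟩
    · rintro ⟨rfl, h2, h3⟩
      exact ⟨h3.symm, rfl, h2⟩
  rw [EOLData.outDeg, this]
  by_cases h : I.predV (I.succV v) = v ∧ I.succV v ≠ v <;> simp [h]

variable (k) in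
/-- A vertex of the graph as an element of `[q]ⁿ`. -/
def digits {n : ℕ} (x : List.Vector Bool n) : List.Vector (Fin (k + 2)) n := x.map (bitDigit k)

/-- The lowest bits. -/
def lowBits {n : ℕ} (w : List.Vector (Fin (k + 2)) n) : List.Vector Bool n := w.map lowBit

theorem lowBits_digits {n : ℕ} : Function.LeftInverse (lowBits (n := n)) (digits k) := fun x =>
  List.Vector.eq _ _ (by
    rw [lowBits, digits, List.Vector.toList_map, List.Vector.toList_map, List.map_map]
    exact (List.map_congr_left fun a _ => lowBit_bitDigit a).trans (List.map_id _))

variable (k) in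
/-- The circuit of the instance of Lonely. -/
noncomputable def lonelyCircuit :
    Circuit ((I.n + 1) * Nat.clog 2 (k + 2)) ((I.n + 1) * Nat.clog 2 (k + 2)) where
  gates := lonelyGates (Nat.clog 2 (k + 2)) I.n I.circuit.gates (flagFun k) (muxFun k) (incFun k)
  wellFormed := by
    rw [Nat.mul_comm]
    exact wellFormed_lonelyGates (one_le_clog k) I.circuit.wellFormed
  enough := Nat.le_add_right _ _

/-- Compares the wire-level description of the output with the abstract map, block by block: the
first block is the incremented copy index, and every other block is chosen according to the flags.
-/
theorem isShift_lonelyCircuit : IsShift (k := k)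
    (fun c w => vertexCode (List.Vector.cons c w)) (lonelyCircuit k I).eval
    (follow I.predV I.succV (digits k) lowBits I.predV)
    (follow I.predV I.succV (digits k) lowBits I.succV) := by
  classical
  intro c w
  have hb := one_le_clog k
  set x := lowBits w with hx
  have hxl : ∀ t, x.toList.getD t false = lowBit (w.toList.getD t 0) := fun t => by
    have := List.getD_map (l := w.toList) 0 (n := t) lowBit
    rwa [show lowBit (0 : Fin (k + 2)) = false by simp [lowBit],
      ← List.Vector.toList_map, ← lowBits, ← hx] at this
  have hdl : ∀ (y : List.Vector Bool I.n) t,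
      (digits k y).toList.getD t 0 = bitDigit k (y.toList.getD t false) := fun y t => by
    rw [digits, List.Vector.toList_map]
    exact List.getD_map (d := false) (f := bitDigit k) ..
  have hflags : ∀ PS SP : List.Vector Bool I.n, flags I.n (flagFun k) PS.toList SP.toList
      (fun t => block (w.toList.getD t 0)) =
        [decide (PS ≠ x), decide (SP ≠ x), decide (digits k x ≠ w)] := fun PS SP => by
    have hne : ∀ {α : Type} (u v : List.Vector α I.n), u.toList ≠ v.toList ↔ u ≠ v := fun u v =>
      List.Vector.toList_injective.ne_iff
    rw [flags_eq]
    simp only [← hxl, ← hdl]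
    rw [any_range_getD_ne _ PS.toList_length x.toList_length,
      any_range_getD_ne _ SP.toList_length x.toList_length,
      any_range_getD_ne _ w.toList_length (digits k x).toList_length]
    simp only [hne, ne_comm]
  have hfollow : ∀ f : List.Vector Bool I.n → List.Vector Bool I.n,
      ∀ t, (follow I.predV I.succV (digits k) lowBits f w).toList.getD t 0 =
        if Retained I.predV I.succV (digits k) lowBits w then w.toList.getD t 0 else
          bitDigit k ((f x).toList.getD t false) := fun f t => by
    rw [follow]
    split_ifs
    · rfl
    · exact hdl _ _
  have hinp : ∀ t j, j < Nat.clog 2 (k + 2) → ((c :: w.toList).flatMap block).getD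
      (Nat.clog 2 (k + 2) + Nat.clog 2 (k + 2) * t + j) false =
        (block (w.toList.getD t 0)).getD j false := fun t j hj => by
    rw [Nat.add_comm (Nat.clog 2 (k + 2)), ← Nat.mul_succ, getD_flatMap_block _ hj,
      List.getD_cons_succ]
  have hinp' : ∀ j, j < Nat.clog 2 (k + 2) → ((c :: w.toList).flatMap block).getD j false =
      (block c).getD j false := fun j hj => by
    have := getD_flatMap_block (c :: w.toList) (i := 0) hj
    rwa [Nat.mul_zero, Nat.zero_add, List.getD_cons_zero] at this
  refine List.Vector.eq _ _ ?_
  change (runGates (lonelyGates _ I.n I.circuit.gates (flagFun k) (muxFun k) (incFun k))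
    ((c :: w.toList).flatMap block)).take _ = (_ :: _).flatMap block
  rw [Nat.mul_comm, take_runGates_lonelyGates (v := x.toList) (c := block c)
    (blk := fun t => block (w.toList.getD t 0)) (P := (I.predV x).toList)
    (S := (I.succV x).toList) (PS := (I.predV (I.succV x)).toList)
    (SP := (I.succV (I.predV x)).toList) hb I.circuit.wellFormed]
  · rw [incFun_block, List.flatMap_cons, hflags]
    congr 1
    set w' := if c = 0 then follow I.predV I.succV (digits k) lowBits I.predV w else
      if c = Fin.last (k + 1) then follow I.predV I.succV (digits k) lowBits I.succV w else w
      with hw'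
    have h1 : w'.toList = (List.range I.n).map fun t => w'.toList.getD t 0 :=
      List.ext_getElem (by simp) fun i h1 h2 => by
        rw [List.getElem_map, List.getElem_range, List.getD_eq_getElem _ _ h1]
    change _ = w'.toList.flatMap block
    rw [h1, List.flatMap_map]
    refine List.flatMap_congr fun t _ => ?_
    rw [muxFun_eq]
    congr 1
    -- The condition under which the output gadget keeps the input block is exactly that the word is
    -- retained.
    have hr : (decide (digits k x ≠ w) = true ∨ decide (I.predV (I.succV x) ≠ x) = true ∧
        decide (I.succV (I.predV x) ≠ x) = true) ↔
          Retained I.predV I.succV (digits k) lowBits w := by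
      simp only [decide_eq_true_iff, Retained, hx]
    simp only [hr, hw']
    split_ifs with h1 h2 h3 h2 h3 <;>
      first | rfl | rw [hfollow, if_pos h1] | rw [hfollow, if_neg h1]
  · have := I.circuit.enough
    omega
  · exact fun _ => rfl
  · exact length_muxFun k
  · exact fun _ => length_block _
  · rw [length_flatMap_block, Nat.mul_comm]
    simp
  · refine List.ext_getElem (by simp) fun t h1 h2 => ?_
    rw [List.getElem_map, List.getElem_range, ← List.getD_eq_getElem _ false h1, hxl,
      ← getD_zero_block, ← hinp t 0 hb]
    rfl
  · have := map_range_getD (block c)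
    rw [length_block] at this
    refine this.symm.trans (List.map_congr_left fun j hj => ?_)
    rw [hinp' j (List.mem_range.1 hj)]
  · intro t
    have := map_range_getD (block (w.toList.getD t 0))
    rw [length_block] at this
    refine this.symm.trans (List.map_congr_left fun j hj => ?_)
    rw [hinp t j (List.mem_range.1 hj)]
  · exact I.toList_predV x
  · exact I.toList_succV x
  · exact I.toList_predV _
  · exact I.toList_succV _

end instances

end SearchClasses

namespace SearchClasses

/-! ### Unique readability of the encodings. -/

section codes

theorem flatMap_injective {α β : Type} {f : α → List β} (hf : Function.Injective f) {m : ℕ}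
    (hm : 1 ≤ m) (hl : ∀ a, (f a).length = m) :
    Function.Injective fun l : List α => l.flatMap f := by
  intro l
  induction l with
  | nil =>
    intro l' h
    cases l' with
    | nil => rfl
    | cons a l' =>
      have := congrArg List.length h
      simp only [List.flatMap_nil, List.length_nil, List.flatMap_cons, List.length_append, hl]
        at this
      omega
  | cons a l ih =>
    intro l' h
    cases l' with
    | nil =>
      have := congrArg List.length h
      simp only [List.flatMap_nil, List.length_nil, List.flatMap_cons, List.length_append, hl]
        at this
      omega
    | cons a' l' =>
      simp only [List.flatMap_cons] at h
      obtain ⟨h1, h2⟩ := List.append_inj h (by rw [hl, hl])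
      rw [hf h1, ih h2]

theorem unary_append_inj {m n : ℕ} {l l' : List Bool} (h : unary m ++ l = unary n ++ l') :
    m = n ∧ l = l' := by
  induction m generalizing n with
  | zero =>
    cases n with
    | zero => simpa [unary] using h
    | succ n => simp [unary, List.replicate_succ] at h
  | succ m ih =>
    cases n with
    | zero => simp [unary, List.replicate_succ] at h
    | succ n =>
      simp only [unary, List.replicate_succ, List.cons_append, List.cons.injEq, true_and] at h
      have := ih h
      exact ⟨by omega, this.2⟩

theorem Gate.code_append_inj {g g' : Gate} {l l' : List Bool} (h : g.code ++ l = g'.code ++ l') :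
    g = g' ∧ l = l' := by
  cases g <;> cases g' <;>
    simp only [Gate.code, List.cons_append, List.append_assoc, List.cons.injEq, true_and,
      reduceCtorEq, false_and, and_false] at h
  · obtain ⟨rfl, h₁⟩ := unary_append_inj h
    obtain ⟨rfl, h₂⟩ := unary_append_inj h₁
    exact ⟨rfl, h₂⟩
  · obtain ⟨rfl, h₁⟩ := unary_append_inj h
    obtain ⟨rfl, h₂⟩ := unary_append_inj h₁
    exact ⟨rfl, h₂⟩
  · obtain ⟨rfl, h₁⟩ := unary_append_inj h
    exact ⟨rfl, h₁⟩

/-- The end marker 00 cannot be confused with a gate, whose tag is 11, 10 or 01. -/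
theorem gates_append_inj {gs gs' : List Gate} {l l' : List Bool}
    (h : gs.flatMap Gate.code ++ ([false, false] ++ l) =
      gs'.flatMap Gate.code ++ ([false, false] ++ l')) : gs = gs' ∧ l = l' := by
  induction gs generalizing gs' with
  | nil =>
    cases gs' with
    | nil => simpa using h
    | cons g gs' => cases g <;> simp [Gate.code] at h
  | cons g gs ih =>
    cases gs' with
    | nil => cases g <;> simp [Gate.code] at h
    | cons g' gs' =>
      rw [List.flatMap_cons, List.flatMap_cons, List.append_assoc, List.append_assoc] at h
      obtain ⟨rfl, h₁⟩ := Gate.code_append_inj h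
      obtain ⟨rfl, h₂⟩ := ih h₁
      exact ⟨rfl, h₂⟩

variable {k : ℕ}

theorem vertexCode_injective {n : ℕ} : Function.Injective (vertexCode (q := k + 2) (n := n)) :=
  fun _ _ h => List.Vector.eq _ _ (flatMap_injective block_injective (one_le_clog k) length_block
    (congrArg List.Vector.toList h))

/-- A solution of a string is a solution of some instance with that code; injectivity identifies
this instance with the one produced by the reduction. -/
theorem LonelyData.code_injective : Function.Injective (LonelyData.code (q := k + 2)) := by
  rintro ⟨n, hn, ⟨gs, h1, h2⟩, D, h3, h4, h5⟩ ⟨n', hn', ⟨gs', h1', h2'⟩, D', h3', h4', h5'⟩ h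
  simp only [LonelyData.code, Circuit.code, List.append_assoc] at h
  obtain ⟨rfl, h₆⟩ := unary_append_inj h
  obtain ⟨rfl, h₇⟩ := gates_append_inj h₆
  obtain rfl := flatMap_injective (m := n * Nat.clog 2 (k + 2))
    (fun v w h => vertexCode_injective (List.Vector.eq _ _ h))
    (Nat.mul_pos hn (one_le_clog k)) (fun v => List.Vector.toList_length _) h₇
  rfl

end codes

/-! ### From solutions of Lonely to solutions of End-of-Line. -/

section solutions

variable {k : ℕ} (I : EOLData)

variable (k) in
/-- The instance of Lonely. -/
noncomputable def lonelyData : LonelyData (k + 2) where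
  n := I.n + 1
  n_pos := by omega
  circuit := lonelyCircuit k I
  designated := [List.Vector.cons 0 (digits k I.start)]
  nodup := List.nodup_singleton _
  one_le := le_rfl
  le_pred := by simp

theorem cons_vertexCode_injective {n : ℕ} : Function.Injective2
    fun (c : Fin (k + 2)) (w : List.Vector (Fin (k + 2)) n) =>
      vertexCode (List.Vector.cons c w) := by
  intro c c' w w' h
  have := congrArg List.Vector.toList (vertexCode_injective h)
  rw [List.Vector.toList_cons, List.Vector.toList_cons, List.cons.injEq] at this
  exact ⟨this.1, List.Vector.eq _ _ this.2⟩

theorem mem_edges_of_follow {w : List.Vector (Fin (k + 2)) I.n}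
    (h : follow I.predV I.succV (digits k) lowBits I.succV
      (follow I.predV I.succV (digits k) lowBits I.predV w) = w) :
    Set.range (fun i => List.Vector.cons i
      (if i = 0 then w else follow I.predV I.succV (digits k) lowBits I.predV w)) ∈
      (lonelyData k I).edges := by
  obtain ⟨u, hu1, hu2, hu3⟩ := (isShift_lonelyCircuit I).exists_cycle cons_vertexCode_injective h
  refine ⟨_, fun i j hij => hu1 ?_, fun i => ?_, rfl⟩
  · rw [hu3, hu3]
    exact congrArg vertexCode hij
  · have := hu2 i
    rwa [hu3, hu3] at this

theorem not_mem_edge_of_deg {w : List.Vector (Fin (k + 2)) (I.n + 1)}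
    (h : (lonelyData k I).deg w = 0) {e : Set (List.Vector (Fin (k + 2)) (I.n + 1))}
    (he : e ∈ (lonelyData k I).edges) : w ∉ e := fun hw => by
  have := (Set.ncard_eq_zero (Set.toFinite _)).1 h
  exact Set.eq_empty_iff_forall_notMem.1 this e ⟨he, hw⟩

/-- A matched designated vertex is impossible, an unmatched copy 0 gives a source, and an unmatched
copy c ≠ 0 gives a sink. -/
theorem isSol_of_isSol_lonelyData (hI : I.Valid) {u : List.Vector (Fin (k + 2)) (I.n + 1)}
    (hu : (lonelyData k I).IsSol u) : I.IsSol (lowBits u.tail) := by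
  obtain ⟨c, w, rfl⟩ : ∃ c w, u = List.Vector.cons c w := ⟨u.head, u.tail, by simp⟩
  rw [List.Vector.tail_cons]
  have hl : Function.LeftInverse (lowBits (n := I.n)) (digits k) := lowBits_digits
  rcases hu with ⟨hm, hd⟩ | ⟨hm, hd⟩
  · exfalso
    have hm := List.mem_singleton.1 hm
    obtain ⟨rfl, rfl⟩ := cons_vertexCode_injective (congrArg vertexCode hm)
    obtain ⟨e, he⟩ := Set.ncard_eq_one.1 hd
    obtain ⟨⟨u, hu, hu', rfl⟩, i, hi⟩ : e ∈ {e | e ∈ (lonelyData k I).edges ∧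
      List.Vector.cons 0 (digits k I.start) ∈ e} := he.symm.subset (Set.mem_singleton e)
    have h1 := (I.outDeg_eq I.start).2.1 hI.2
    refine follow_succ_pred_source_ne hl h1.1 h1.2 (fun e => by_contra fun e' => ?_)
      ((isShift_lonelyCircuit I).eq_of_cycle cons_vertexCode_injective (u := vertexCode ∘ u) hu'
        ⟨i, congrArg vertexCode hi⟩)
    -- A return from the predecessor of the start, if that is a different vertex, would be an
    -- incoming edge.
    have := (I.inDeg_eq I.start).2.2 ⟨e, e'⟩
    rw [hI.1] at this
    omega
  · by_cases hc : c = 0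
    · subst hc
      -- This source is not the start, as otherwise the vertex would be the designated one.
      have h := exists_of_follow_succ_pred_ne hl (w := w) fun h =>
        not_mem_edge_of_deg I hd (mem_edges_of_follow I h) ⟨0, by simp⟩
      refine Or.inr ⟨(I.inDeg_eq _).1.resolve_right fun e => h.2.2.1 ((I.inDeg_eq _).2.1 e).1,
        (I.outDeg_eq _).2.2 ⟨h.1, h.2.1⟩, fun e => hm ?_⟩
      rw [← h.2.2.2, e]
      exact List.mem_singleton.2 rfl
    -- If p (s w) = w, the hyperedge through (0, s w) would contain (c, w), since c ≠ 0 carries the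
    -- word p (s w).
    · have h := exists_of_follow_pred_succ_ne hl (w := w) fun h =>
        not_mem_edge_of_deg I hd (mem_edges_of_follow I (by rw [h])) ⟨c, by simp [hc, h]⟩
      exact Or.inl ⟨(I.inDeg_eq _).2.2 ⟨h.1, h.2.1⟩,
        (I.outDeg_eq _).1.resolve_right fun e => h.2.2.1 ((I.outDeg_eq _).2.1 e).1⟩

end solutions

end SearchClasses

namespace SearchClasses

open Turing Function

/-! ### Emitting circuits -/

section

variable {ι α : Type} [DecidableEq ι] (T : ι → FinTM2) (ctx : List (α → List Sym))

/-- The number `u` can be emitted in unary. -/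
def EmitsUnary (u : α → ℕ) : Prop := Emits T ctx fun a => List.replicate (u a) (some true)

/-- The lists `L` have a fixed length and consist of numbers that can be emitted in unary. -/
def EmitsIndices (L : α → List ℕ) : Prop :=
  ∃ us : List (α → ℕ), (∀ u ∈ us, EmitsUnary T ctx u) ∧ ∀ a, L a = us.map fun u => u a

variable {T ctx} {u v : α → ℕ} {L L' : α → List ℕ} {X : α → List Sym}

theorem EmitsUnary.const (c : ℕ) : EmitsUnary T ctx fun _ => c := Emits.const _

theorem EmitsUnary.length (hX : X ∈ ctx) : EmitsUnary T ctx fun a => (X a).length := by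
  have := Emits.transduce (T := T) () (fun _ _ => ()) (fun _ _ => [some true]) hX
  simpa only [EmitsUnary, transduce_singleton, List.map_const'] using this

theorem EmitsUnary.add (hu : EmitsUnary T ctx u) (hv : EmitsUnary T ctx v) :
    EmitsUnary T ctx fun a => u a + v a := by
  have := Emits.append hu hv
  simpa only [EmitsUnary, List.replicate_add] using this

theorem EmitsUnary.mul (c : ℕ) (hu : EmitsUnary T ctx u) : EmitsUnary T ctx fun a => c * u a := by
  induction c with
  | zero => simpa using EmitsUnary.const 0
  | succ c ih => simpa only [Nat.succ_mul] using ih.add hu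

/-- A two-state automaton drops the first symbol; truncated subtraction agrees with its empty output
on the empty word. -/
theorem EmitsUnary.pred (hu : EmitsUnary T ctx u) : EmitsUnary T ctx fun a => u a - 1 := by
  refine Emits.letIn hu ?_
  have := Emits.transduce (T := T) (ctx := (fun a => List.replicate (u a) (some true)) :: ctx)
    false (fun _ _ => true) (fun q x => if q then [x] else []) List.mem_cons_self
  refine (congrArg _ (funext fun a => ?_)).mp this
  show _ = List.replicate (u a - 1) (some true)
  generalize u a = m
  cases m with
  | zero => rfl
  | succ m =>
    rw [List.replicate_succ, transduce]
    have h : ∀ l : List Sym, transduce (fun (_ : Bool) (_ : Sym) => true)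
        (fun q x => if q then [x] else []) true l = l := fun l => by
      induction l with
      | nil => rfl
      | cons x l ih => simpa [transduce] using ih
    simp [h]

theorem EmitsIndices.nil : EmitsIndices T ctx fun _ => [] := ⟨[], by simp, fun _ => rfl⟩

theorem EmitsIndices.cons (hu : EmitsUnary T ctx u) (h : EmitsIndices T ctx L) :
    EmitsIndices T ctx fun a => u a :: L a := by
  obtain ⟨us, hus, h⟩ := h
  exact ⟨u :: us, by simpa using ⟨hu, hus⟩, fun a => by simp [h]⟩

theorem EmitsIndices.append (h : EmitsIndices T ctx L) (h' : EmitsIndices T ctx L') :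
    EmitsIndices T ctx fun a => L a ++ L' a := by
  obtain ⟨us, hus, h⟩ := h
  obtain ⟨us', hus', h'⟩ := h'
  refine ⟨us ++ us', fun u hu => ?_, fun a => by simp [h, h']⟩
  exact (List.mem_append.1 hu).elim (hus u) (hus' u)

theorem EmitsIndices.reverse (h : EmitsIndices T ctx L) :
    EmitsIndices T ctx fun a => (L a).reverse := by
  obtain ⟨us, hus, h⟩ := h
  exact ⟨us.reverse, by simpa using hus, fun a => by simp [h]⟩

theorem EmitsIndices.range (m : ℕ) : EmitsIndices T ctx fun _ => List.range m :=
  ⟨(List.range m).map fun j _ => j, fun u hu => by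
    obtain ⟨j, _, rfl⟩ := List.mem_map.1 hu
    exact EmitsUnary.const j, fun a => by simp [Function.comp_def]⟩

theorem EmitsIndices.map_add (hu : EmitsUnary T ctx u) (h : EmitsIndices T ctx L) :
    EmitsIndices T ctx fun a => (L a).map (u a + ·) := by
  obtain ⟨us, hus, h⟩ := h
  refine ⟨us.map fun v a => u a + v a, fun w hw => ?_, fun a => by simp [h, Function.comp_def]⟩
  obtain ⟨v, hv, rfl⟩ := List.mem_map.1 hw
  exact hu.add (hus v hv)

/-- The code of a list of gates on the tape. -/
def codeSym (gs : List Gate) : List Sym := (gs.flatMap Gate.code).map some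

theorem codeSym_append (gs gs' : List Gate) : codeSym (gs ++ gs') = codeSym gs ++ codeSym gs' := by
  simp [codeSym]

theorem codeSym_loopGates (n : ℕ) (body : ℕ → List Gate) :
    codeSym (loopGates n body) = (List.range n).flatMap fun t => codeSym (body t) := by
  simp [codeSym, loopGates, List.flatMap_assoc, List.map_flatMap]

theorem Emits.code_append {G G' : α → List Gate} (h : Emits T ctx fun a => codeSym (G a))
    (h' : Emits T ctx fun a => codeSym (G' a)) : Emits T ctx fun a => codeSym (G a ++ G' a) := by
  simpa only [codeSym_append] using h.append h'

theorem EmitsUnary.emits_unary (hu : EmitsUnary T ctx u) :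
    Emits T ctx fun a => (unary (u a)).map some := by
  simpa [unary] using Emits.append hu (Emits.const [some false])

theorem EmitsUnary.emits_copy (hu : EmitsUnary T ctx u) :
    Emits T ctx fun a => codeSym [Gate.copy (u a)] := by
  have := (Emits.const [some true, some true]).append (hu.emits_unary.append hu.emits_unary)
  simpa [codeSym, Gate.copy, Gate.code] using this

theorem EmitsIndices.emits_copyGates (h : EmitsIndices T ctx L) (p : ℕ) :
    Emits T ctx fun a => codeSym (copyGates p (L a)) := by
  obtain ⟨us, hus, h⟩ := h
  simp only [h]
  clear h
  induction us generalizing p with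
  | nil => exact Emits.const []
  | cons u us ih =>
    exact Emits.code_append ((EmitsUnary.const p).add (hus u (by simp))).emits_copy
      (ih (p + 1) fun v hv => hus v (List.mem_cons_of_mem _ hv))

/-- Only the copied indices vary with the input. The gates of the Boolean gadget form a fixed list,
emitted as a constant, so their noncomputable choice is harmless. -/
theorem EmitsIndices.emits_chunk (h : EmitsIndices T ctx L) (F : List Bool → List Bool) (m : ℕ) :
    Emits T ctx fun a => codeSym (chunk (L a) F m) := by
  obtain ⟨us, hus, hL⟩ := id h
  refine Emits.code_append (h.reverse.emits_copyGates 0) ?_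
  simp only [hL, List.length_map]
  exact Emits.const _

theorem EmitsUnary.emits_replicate_copy (hu : EmitsUnary T ctx u) (m : ℕ) :
    Emits T ctx fun a => codeSym (List.replicate m (Gate.copy (u a))) := by
  induction m with
  | zero => exact Emits.const []
  | succ m ih => exact Emits.code_append hu.emits_copy ih

variable (ctx) in
/-- The context in the body of a loop. -/
abbrev loopCtx : List (α × ℕ → List Sym) :=
  (fun p : α × ℕ => List.replicate p.2 (some true)) :: ctx.map fun Y (p : α × ℕ) => Y p.1

theorem EmitsUnary.counter : EmitsUnary T (loopCtx ctx) fun p : α × ℕ => p.2 := by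
  have := EmitsUnary.length (T := T) (ctx := loopCtx ctx) List.mem_cons_self
  simpa only [List.length_replicate] using this

theorem EmitsUnary.length_loop (hX : X ∈ ctx) :
    EmitsUnary T (loopCtx ctx) fun p => (X p.1).length :=
  EmitsUnary.length (X := fun p : α × ℕ => X p.1)
    (List.mem_cons_of_mem _ (List.mem_map.2 ⟨X, hX, rfl⟩))

theorem Emits.code_loop {body : α → ℕ → List Gate} (hX : X ∈ ctx)
    (h : Emits T (loopCtx ctx) fun p => codeSym (body p.1 p.2)) :
    Emits T ctx fun a => codeSym (loopGates (X a).length (body a)) := by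
  simpa only [codeSym_loopGates] using Emits.repeat hX h

/-- Turns a list of copies of variable length into a counted loop; the summand `t` accounts for the
copies already made. -/
theorem copyGates_map_range (n : ℕ) (f : ℕ → ℕ) :
    copyGates 0 ((List.range n).map f) = loopGates n fun t => [Gate.copy (t + f t)] := by
  induction n with
  | zero => rfl
  | succ n ih =>
    rw [List.range_succ, List.map_append, copyGates_append, ih, loopGates_succ]
    simp [copyGates]

theorem replicate_eq_loopGates (n : ℕ) (g : Gate) :
    List.replicate n g = loopGates n fun _ => [g] := by
  simp [loopGates, ← List.map_eq_flatMap]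

end

end SearchClasses

namespace SearchClasses

open Turing Function

/-! ### Emitting the code of the circuit of the reduction. -/

section

variable {ι α : Type} [DecidableEq ι] {T : ι → FinTM2} {ctx : List (α → List Sym)}
  {b : ℕ} {Ff Fm Fi : List Bool → List Bool} {u g t : α → ℕ} {N G : α → List Sym}

theorem EmitsIndices.map_range_add (m : ℕ) (hu : EmitsUnary T ctx u) :
    EmitsIndices T ctx fun a => (List.range m).map fun j => u a + j :=
  EmitsIndices.map_add hu (EmitsIndices.range m)

theorem EmitsIndices.copyIdx {n e : α → ℕ} (hn : EmitsUnary T ctx n) (hg : EmitsUnary T ctx g)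
    (he : EmitsUnary T ctx e) :
    EmitsIndices T ctx fun a => SearchClasses.copyIdx b (n a) (g a) (e a) :=
  .map_range_add b (he.add (((hg.add hn).mul 3).add hn))

theorem EmitsIndices.coordIdx {n e : α → ℕ} (hn : EmitsUnary T ctx n) (hg : EmitsUnary T ctx g)
    (he : EmitsUnary T ctx e) (ht : EmitsUnary T ctx t) :
    EmitsIndices T ctx fun a => SearchClasses.coordIdx b (n a) (g a) (e a) (t a) :=
  .map_range_add b (((he.add (((hg.add hn).mul 3).add hn)).add (.const b)).add (ht.mul b))

theorem EmitsUnary.flagEnd {n : α → ℕ} (hn : EmitsUnary T ctx n) :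
    EmitsUnary T ctx fun a => SearchClasses.flagEnd b (n a) Ff :=
  (hn.mul _).add (.const _)

theorem EmitsIndices.flagIdx {n : α → ℕ} (hn : EmitsUnary T ctx n) (hg : EmitsUnary T ctx g)
    (ht : EmitsUnary T ctx t) :
    EmitsIndices T ctx fun a => SearchClasses.flagIdx b (n a) (g a) (t a) :=
  .cons ((EmitsUnary.const _).add ht) <|
    .cons ((((EmitsUnary.const _).add (hg.add hn)).add hn).add ht) <|
      .coordIdx hn hg (.const _) ht

theorem EmitsIndices.muxIdx {n : α → ℕ} (hn : EmitsUnary T ctx n) (hg : EmitsUnary T ctx g)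
    (ht : EmitsUnary T ctx t) :
    EmitsIndices T ctx fun a => SearchClasses.muxIdx b (n a) Ff (g a) (t a) :=
  (EmitsIndices.range 3).append <| .cons ((hn.flagEnd.add ((hg.add hn).mul 2)).add ht) <|
    .cons (((hn.flagEnd.add ((hg.add hn).mul 2)).add hn).add ht) <|
      (EmitsIndices.coordIdx hn hg hn.flagEnd ht).append (.copyIdx hn hg hn.flagEnd)

/-- The skeleton of loops and chunks is fixed by q; the gate arguments are built from `n`, the
number of gates and the loop counter by addition, constant multiples and `pred`. -/
theorem Emits.outputGates (hN : N ∈ ctx) (hG : G ∈ ctx) :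
    Emits T ctx fun a => codeSym (outputGates b (N a).length Ff Fm Fi (G a).length) := by
  have hn := EmitsUnary.length (T := T) hN
  have hn' := EmitsUnary.length_loop (T := T) hN
  have hg' := EmitsUnary.length_loop (T := T) hG
  have ht := EmitsUnary.counter (T := T) (ctx := ctx)
  refine .code_append (EmitsIndices.emits_chunk .nil _ _) (.code_append (Emits.code_loop hN ?_)
    (.code_append (Emits.code_loop hN ?_) (.code_append (EmitsIndices.emits_chunk ?_ _ _)
      (.code_append (Emits.code_loop hN ?_) (EmitsUnary.emits_replicate_copy ?_ _)))))
  · exact EmitsIndices.emits_chunk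
      ((EmitsIndices.range 3).append (.map_add (ht.mul _) (.flagIdx hn' hg' ht))) _ _
  · exact EmitsIndices.emits_chunk (.map_add (ht.mul _) (.muxIdx hn' hg' ht)) _ _
  · exact .copyIdx hn (.length hG) ((hn.mul _).add hn.flagEnd)
  · exact EmitsUnary.emits_replicate_copy
      (((((EmitsUnary.const _).add (ht.mul _)).add (ht.mul b)).add (.const b)).pred) _
  · exact ((hn.mul b).add (.const b)).pred

/-- The code of `walkGates`, given the code of the circuit. -/
def walkCode (b n g : ℕ) (C : List Sym) : List Sym :=
  codeSym (loopGates n fun t => [Gate.copy (t + (b + b * t))]) ++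
    (codeSym (loopGates n fun t => [Gate.copy (t + t)]) ++ (C ++
      (codeSym (loopGates n fun _ => [Gate.copy (n - 1)]) ++ (C ++
        (codeSym (loopGates n fun _ => [Gate.copy (g + 3 * n - 1)]) ++ C)))))

theorem codeSym_walkGates (b n : ℕ) (CG : List Gate) :
    codeSym (walkGates b n CG) = walkCode b n CG.length (codeSym CG) := by
  have h := copyGates_map_range n fun t => t
  rw [List.map_id'] at h
  simp only [walkGates, codeSym_append, copyGates_map_range, h, replicate_eq_loopGates, walkCode]

theorem Emits.walkCode {C : α → List Sym} (hN : N ∈ ctx) (hG : G ∈ ctx) (hC : C ∈ ctx) :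
    Emits T ctx fun a => walkCode b (N a).length (G a).length (C a) := by
  have hn' := EmitsUnary.length_loop (T := T) hN
  have hg' := EmitsUnary.length_loop (T := T) hG
  have ht := EmitsUnary.counter (T := T) (ctx := ctx)
  refine .append (.code_loop hN ?_) (.append (.code_loop hN ?_) (.append (.var hC)
    (.append (.code_loop hN ?_) (.append (.var hC) (.append (.code_loop hN ?_) (.var hC))))))
  · exact (ht.add ((EmitsUnary.const b).add (ht.mul b))).emits_copy
  · exact (ht.add ht).emits_copy
  · exact hn'.pred.emits_copy
  · exact (hg'.add (hn'.mul 3)).pred.emits_copy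

/-- The code of the instance of Lonely, given the code of the circuit and of the vertex. -/
noncomputable def lonelyCode (b : ℕ) (Ff Fm Fi : List Bool → List Bool) (n g : ℕ)
    (C V : List Sym) : List Sym :=
  (unary (n + 1)).map some ++ (walkCode b n g C ++ (codeSym (outputGates b n Ff Fm Fi g) ++
    ([some false, some false] ++ V)))

theorem Emits.lonelyCode {C V : α → List Sym} (hN : N ∈ ctx) (hG : G ∈ ctx) (hC : C ∈ ctx)
    (hV : Emits T ctx V) :
    Emits T ctx fun a => lonelyCode b Ff Fm Fi (N a).length (G a).length (C a) (V a) :=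
  .append ((EmitsUnary.length hN).add (.const 1)).emits_unary (.append (.walkCode hN hG hC)
    (.append (.outputGates hN hG) (.append (.const _) hV)))

end

theorem Emits.polyTime_getD {ι : Type} [DecidableEq ι] [Fintype ι] {T : ι → FinTM2}
    {F : List Bool → List Sym} (h : Emits T [fun x => x.map some] F) :
    PolyTime id id fun x => (F x).map fun s => s.getD false := by
  refine Emits.polyTime (T := T) _ some leftInverse_getD_some (Emits.letIn h ?_)
  have := Emits.transduce (T := T) () (fun _ _ => ()) (fun _ x => [some (x.getD false)])
    (List.mem_cons_self (a := F) (l := [fun x => x.map some]))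
  simpa [transduce_singleton, Function.comp_def] using this

/-! ### Parsing the instances of End-of-Line -/

/-- The states of the parser: `0` in the number of the inputs, `1` and `2`, `3` before the two
bits of a tag, `4` and `5` in the first of two arguments and the last argument of a gate, `6` in
the vertex. -/
def parseStep (q : Fin 7) (s : Sym) : Fin 7 :=
  let x := s.getD false
  ![if x then 0 else 1, if x then 3 else 2, if x then 5 else 6, 4, if x then 4 else 5,
    if x then 5 else 1, 6] q

def parseNum (q : Fin 7) (s : Sym) : List Sym := if q = 0 ∧ s = some true then [some true] else []

/-- State 5 reads a `false` exactly once per gate, at the end of its last argument. -/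
def parseSize (q : Fin 7) (s : Sym) : List Sym := if q = 5 ∧ s = some false then [some true] else []

/-- In state 1 the first bit of a tag is withheld, since a `false` may also begin the end marker; it
is printed together with the second bit. -/
def parseGates (q : Fin 7) (s : Sym) : List Sym :=
  ![[], [], if s = some true then [some false, some true] else [], [some true, s], [s], [s], []] q

def parseVertex (f : Sym → List Sym) (q : Fin 7) (s : Sym) : List Sym := if q = 6 then f s else []

section

variable {C : Type} (out : Fin 7 → Sym → List C)

theorem transduce_unary {q q' : Fin 7} (h : parseStep q (some true) = q)
    (h' : parseStep q (some false) = q') (m : ℕ) (l : List Sym) :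
    transduce parseStep out q ((unary m).map some ++ l) =
      (List.range m).flatMap (fun _ => out q (some true)) ++
        (out q (some false) ++ transduce parseStep out q' l) := by
  induction m with
  | zero => simp [unary, transduce, h']
  | succ m ih =>
    rw [List.range_succ_eq_map, List.flatMap_cons, List.flatMap_map]
    simp only [unary, List.replicate_succ, List.cons_append, List.map_cons, transduce, h] at ih ⊢
    rw [ih, List.append_assoc]

theorem transduce_codeSym {m : Gate → List C}
    (h : ∀ g l, transduce parseStep out 1 (g.code.map some ++ l) =
      m g ++ transduce parseStep out 1 l) (gs : List Gate) (l : List Sym) :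
    transduce parseStep out 1 (codeSym gs ++ l) = gs.flatMap m ++ transduce parseStep out 1 l := by
  induction gs with
  | nil => simp [codeSym]
  | cons g gs ih =>
    rw [List.flatMap_cons, List.append_assoc, ← ih, ← h]
    simp [codeSym]

theorem transduce_vertex (l : List Sym) : transduce parseStep out 6 l = l.flatMap (out 6) := by
  induction l with
  | nil => rfl
  | cons s l ih =>
    rw [List.flatMap_cons, ← ih]
    rfl

/-- A gate leads the parser from state 1 back to state 1, so a parser is determined by what it
prints on single gates and at the boundaries of the parts. -/
theorem transduce_eolCode (I : EOLData) {m : Gate → List C}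
    (h : ∀ g l, transduce parseStep out 1 (g.code.map some ++ l) =
      m g ++ transduce parseStep out 1 l) :
    transduce parseStep out 0 (I.code.map some) =
      (List.range I.n).flatMap (fun _ => out 0 (some true)) ++ (out 0 (some false) ++
        (I.circuit.gates.flatMap m ++ (out 1 (some false) ++ (out 2 (some false) ++
          (I.start.toList.map some).flatMap (out 6))))) := by
  have hcode : I.code.map some = (unary I.n).map some ++ (codeSym I.circuit.gates ++
      (some false :: some false :: I.start.toList.map some)) := by
    simp [EOLData.code, Circuit.code, codeSym]
  rw [hcode, transduce_unary out (q := 0) (q' := 1) rfl rfl, transduce_codeSym out h,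
    ← transduce_vertex]
  rfl

theorem transduce_gate (g : Gate) (l : List Sym) :
    transduce parseStep out 1 (g.code.map some ++ l) = (match g with
      | .and i j => out 1 (some true) ++ (out 3 (some true) ++
          ((List.range i).flatMap (fun _ => out 4 (some true)) ++ (out 4 (some false) ++
            ((List.range j).flatMap (fun _ => out 5 (some true)) ++ out 5 (some false)))))
      | .or i j => out 1 (some true) ++ (out 3 (some false) ++
          ((List.range i).flatMap (fun _ => out 4 (some true)) ++ (out 4 (some false) ++
            ((List.range j).flatMap (fun _ => out 5 (some true)) ++ out 5 (some false)))))
      | .not i => out 1 (some false) ++ (out 2 (some true) ++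
          ((List.range i).flatMap (fun _ => out 5 (some true)) ++ out 5 (some false)))) ++
      transduce parseStep out 1 l := by
  have h4 := transduce_unary out (q := 4) (q' := 5) rfl rfl
  have h5 := transduce_unary out (q := 5) (q' := 1) rfl rfl
  have e1 : parseStep 1 (some true) = 3 := rfl
  have e2 : parseStep 1 (some false) = 2 := rfl
  have e3 : parseStep 2 (some true) = 5 := rfl
  have e4 : ∀ x, parseStep 3 x = 4 := fun _ => rfl
  cases g <;> simp only [Gate.code, List.map_cons, List.map_append, List.cons_append,
    List.append_assoc, transduce, e1, e2, e3, e4, h4, h5]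

end

theorem flatMap_const_nil {A B : Type} (l : List A) : l.flatMap (fun _ => ([] : List B)) = [] := by
  simp

theorem flatMap_range_singleton (m : ℕ) (s : Sym) :
    (List.range m).flatMap (fun _ => [s]) = List.replicate m s := by
  rw [← List.map_eq_flatMap, List.map_const', List.length_range]

theorem transduce_parseNum (I : EOLData) :
    (transduce parseStep parseNum 0 (I.code.map some)).length = I.n := by
  rw [transduce_eolCode (m := fun _ => []) _ I fun g l => ?_]
  · simp [parseNum, flatMap_range_singleton, comp_def]
  · rw [transduce_gate]
    cases g <;> simp [parseNum, flatMap_const_nil]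

theorem transduce_parseSize (I : EOLData) :
    (transduce parseStep parseSize 0 (I.code.map some)).length = I.circuit.gates.length := by
  rw [transduce_eolCode (m := fun _ => [some true]) _ I fun g l => ?_]
  · simp [parseSize, comp_def]
  · rw [transduce_gate]
    cases g <;> simp [parseSize, flatMap_const_nil]

theorem transduce_parseGates (I : EOLData) :
    transduce parseStep parseGates 0 (I.code.map some) = codeSym I.circuit.gates := by
  rw [transduce_eolCode (m := fun g => g.code.map some) _ I fun g l => ?_]
  · have : parseGates 6 = fun _ => [] := rfl
    simp [this, parseGates, flatMap_const_nil, codeSym, List.map_flatMap]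
  · rw [transduce_gate]
    cases g <;> simp [parseGates, Gate.code, flatMap_range_singleton, unary]

theorem transduce_parseVertex (f : Sym → List Sym) (I : EOLData) :
    transduce parseStep (parseVertex f) 0 (I.code.map some) =
      (I.start.toList.map some).flatMap f := by
  rw [transduce_eolCode (m := fun _ => []) _ I fun g l => ?_]
  · simp only [parseVertex, Fin.reduceEq, if_false, flatMap_const_nil]
    rfl
  · rw [transduce_gate]
    cases g <;> simp [parseVertex, flatMap_const_nil]

end SearchClasses

namespace SearchClasses

open Turing Function

/-! ### Reading a vertex of the graph off a vertex of the hypergraph. -/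

section decode

variable {b : ℕ}

/-- Count the symbols modulo `b`, and remember whether the first block is over. -/
def blockStep (hb : 1 ≤ b) (q : Bool × Fin b) (_ : Sym) : Bool × Fin b :=
  if h : q.2 + 1 < b then (q.1, ⟨q.2 + 1, h⟩) else (true, ⟨0, hb⟩)

/-- Print the first symbol of each block but the first. -/
def blockOut (q : Bool × Fin b) (s : Sym) : List Sym :=
  if q.1 = true ∧ q.2.val = 0 then [s] else []

theorem transduce_blockStep_of_pos (hb : 1 ≤ b) (x : Bool) (l m : List Sym) {i : Fin b}
    (hi : 0 < i.val) (hl : l.length + i = b) :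
    transduce (blockStep hb) blockOut (x, i) (l ++ m) =
      transduce (blockStep hb) blockOut (true, ⟨0, hb⟩) m := by
  induction l generalizing i with
  | nil =>
    have := i.2
    simp only [List.length_nil] at hl
    omega
  | cons s l ih =>
    have h0 : blockOut (x, i) s = [] := if_neg fun h => hi.ne' h.2
    rw [List.cons_append, transduce, h0, List.nil_append]
    simp only [List.length_cons] at hl
    by_cases h : i.val + 1 < b
    · rw [show blockStep hb (x, i) s = (x, ⟨i + 1, h⟩) from dif_pos h]
      exact ih (Nat.succ_pos _) (by simp only; omega)
    · rw [show blockStep hb (x, i) s = (true, ⟨0, hb⟩) from dif_neg h,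
        List.eq_nil_of_length_eq_zero (l := l) (by omega), List.nil_append]

theorem transduce_blockStep (hb : 1 ≤ b) (x : Bool) {l : List Bool} (hl : l.length = b)
    (m : List Sym) : transduce (blockStep hb) blockOut (x, ⟨0, hb⟩) (l.map some ++ m) =
      (if x then [some (l.getD 0 false)] else []) ++
        transduce (blockStep hb) blockOut (true, ⟨0, hb⟩) m := by
  cases l with
  | nil =>
    simp only [List.length_nil] at hl
    omega
  | cons a l =>
    have h0 : blockOut (x, (⟨0, hb⟩ : Fin b)) (some a) = if x then [some a] else [] := by
      simp [blockOut]
    rw [List.map_cons, List.cons_append, transduce, h0, List.getD_cons_zero]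
    congr 1
    rw [List.length_cons] at hl
    by_cases h : 0 + 1 < b
    · rw [show blockStep hb (x, ⟨0, hb⟩) (some a) = (x, ⟨0 + 1, h⟩) from dif_pos h]
      exact transduce_blockStep_of_pos hb x _ m Nat.one_pos (by simpa using hl)
    · rw [show blockStep hb (x, ⟨0, hb⟩) (some a) = (true, ⟨0, hb⟩) from dif_neg h,
        List.eq_nil_of_length_eq_zero (l := l) (by omega), List.map_nil, List.nil_append]

/-- Blocks are written with the least significant bit first, so the first symbol of a block is the
lowest bit; the first block, the copy index, is skipped. -/
theorem transduce_vertexCode {k n : ℕ} (u : List.Vector (Fin (k + 2)) (n + 1)) :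
    transduce (blockStep (one_le_clog k)) blockOut (false, ⟨0, one_le_clog k⟩)
      ((vertexCode u).toList.map some) = (lowBits u.tail).toList.map some := by
  obtain ⟨c, w, rfl⟩ : ∃ c w, u = List.Vector.cons c w := ⟨u.head, u.tail, by simp⟩
  change transduce _ _ _ (((c :: w.toList).flatMap block).map some) = _
  rw [List.flatMap_cons, List.map_append, transduce_blockStep _ _ (length_block c),
    List.Vector.tail_cons, lowBits, List.Vector.toList_map]
  simp only [Bool.false_eq_true, if_false, List.nil_append]
  generalize w.toList = l
  induction l with
  | nil => rfl
  | cons a l ih =>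
    rw [List.flatMap_cons, List.map_append, transduce_blockStep _ _ (length_block a), ih,
      getD_zero_block]
    rfl

end decode

/-! ### The reduction as a pair of polynomial-time functions. -/

section reduction

variable (k : ℕ)

/-- The reduction on the instances, with values in the tape alphabet. -/
noncomputable def instanceSym (x : List Bool) : List Sym :=
  lonelyCode (Nat.clog 2 (k + 2)) (flagFun k) (muxFun k) (incFun k)
    (transduce parseStep parseNum 0 (x.map some)).length
    (transduce parseStep parseSize 0 (x.map some)).length
    (transduce parseStep parseGates 0 (x.map some))
    ((block (0 : Fin (k + 2))).map some ++ transduce parseStep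
      (parseVertex fun s => (block (bitDigit k (s.getD false))).map some) 0 (x.map some))

theorem instanceSym_code (I : EOLData) :
    instanceSym k I.code = (lonelyData k I).code.map some := by
  rw [instanceSym, transduce_parseNum, transduce_parseSize, transduce_parseGates,
    transduce_parseVertex, lonelyCode, ← codeSym_walkGates]
  have h : (vertexCode (List.Vector.cons (0 : Fin (k + 2)) (digits k I.start))).toList =
      block (0 : Fin (k + 2)) ++ I.start.toList.flatMap fun x => block (bitDigit k x) := by
    change ((0 : Fin (k + 2)) :: (digits k I.start).toList).flatMap block = _
    rw [List.flatMap_cons, digits, List.Vector.toList_map, List.flatMap_map]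
  simp [LonelyData.code, lonelyData, Circuit.code, lonelyCircuit, lonelyGates, h, codeSym,
    List.map_flatMap, List.flatMap_map]

theorem emits_instanceSym {ι : Type} [DecidableEq ι] (T : ι → FinTM2) :
    Emits T [fun x : List Bool => x.map some] (instanceSym k) := by
  have h : ∀ {ctx : List (List Bool → List Sym)} (out : Fin 7 → Sym → List Sym),
      (fun x : List Bool => x.map some) ∈ ctx →
        Emits T ctx fun x => transduce parseStep out 0 (x.map some) :=
    fun out hX => Emits.transduce (T := T) 0 parseStep out hX
  refine .letIn (h parseNum (by simp)) (.letIn (h parseSize (by simp))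
    (.letIn (h parseGates (by simp)) ?_))
  exact Emits.lonelyCode (by simp) (by simp) (by simp) (.append (.const _) (h _ (by simp)))

/-- The map on solutions ignores the instances and only projects the given vertex. Neither map calls
a machine, so the family of subroutines is empty. -/
theorem reducible_lonely : EndOfLine.Reducible (Lonely (k + 2)) := by
  have hb := one_le_clog k
  refine ⟨fun x => (instanceSym k x).map fun s => s.getD false, fun t => (transduce (blockStep hb)
      blockOut (false, ⟨0, hb⟩) (t.2.2.map some)).map fun s => s.getD false,
    Emits.polyTime_getD (T := Empty.elim) (emits_instanceSym k _), ?_, ?_⟩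
  · refine Emits.polyTime (T := Empty.elim) _ id leftInverse_getD_some
      (Emits.letIn (Emits.thd List.mem_cons_self) (Emits.letIn (Emits.transduce
        (false, ⟨0, hb⟩) (blockStep hb) blockOut List.mem_cons_self) ?_))
    have := Emits.transduce (T := Empty.elim) () (fun _ _ => ())
      (fun _ x => [some (x.getD false)]) (List.mem_cons_self
        (a := fun t : List Bool × List Bool × List Bool => transduce (blockStep hb) blockOut
          (false, ⟨0, hb⟩) (t.2.2.map some))
        (l := [fun t => t.2.2.map some, fun t => (encTriple t).map id]))
    simpa [transduce_singleton, comp_def] using this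
  · rintro _ ⟨I, hI, rfl⟩
    have hcode : ((instanceSym k I.code).map fun s => s.getD false) = (lonelyData k I).code := by
      simp [instanceSym_code, comp_def]
    refine ⟨⟨lonelyData k I, hcode⟩, ?_⟩
    rintro _ ⟨J, hJ, u, rfl, hu⟩
    -- The solution was given for some instance with the same code, which must be the constructed
    -- one.
    obtain rfl := LonelyData.code_injective (hcode.symm.trans hJ)
    refine ⟨I, hI, rfl, lowBits u.tail, ?_, isSol_of_isSol_lonelyData I hI hu⟩
    have := transduce_vertexCode (k := k) (n := I.n) u
    refine (congrArg (List.map fun s : Sym => s.getD false) this).trans ?_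
    rw [List.map_map]
    exact List.map_id _

end reduction

end SearchClasses

theorem mainTheorem9 (q : ℕ) (hq : 2 ≤ q) :
    SearchClasses.EndOfLine.Reducible (SearchClasses.Lonely q) ∧
      SearchClasses.PPAD ⊆ SearchClasses.PPA q := by
  obtain ⟨k, rfl⟩ := Nat.exists_eq_add_of_le' hq
  have h := SearchClasses.reducible_lonely k
  exact ⟨h, fun R hR => ⟨hR.1, hR.2.trans h⟩⟩
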